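/- Work in the category $\mathrm{CGTop}$ of compactly generated Hausdorff spaces and continuous maps, with the open-cover topology; fibre products are taken in $\mathrm{CGTop}$ (that is, with the compactly generated topology), stacks are stacks in groupoids over $\mathrm{CGTop}$, and a space $U$ is identified with the stack it represents. A topological groupoid $\mathcal G=[\mathcal G_1\rightrightarrows M]$ is a groupoid object in $\mathrm{CGTop}$, $B\mathcal G$ is the stack of principal $\mathcal G$-bundles (with structure map admitting local sections), and a topological stack is a stack equivalent to some $B\mathcal G$. Say that a map $f$ is locally a Hurewicz (respectively, Serre) fibration if every point $x$ of its source has an open neighbourhood $U$, and $f(x)$ an open neighbourhood $V\supseteq f(U)$, such that $f|_U\colon U\to V$ is a Hurewicz fibration, i.e. has the homotopy lifting property for all objects of $\mathrm{CGTop}$ (respectively, a Serre fibration, i.e. has it for all cubes). A topological stack is a Hurewicz (respectively, Serre) stack if it is equivalent to $B[R\rightrightarrows X]$ for some topological groupoid whose source map is locally a Hurewicz (respectively, Serre) fibration. A morphism of topological stacks $\mathcal D\to\mathcal C$ is a Hurewicz (respectively, Serre) morphism if for every space $U$ and every morphism $U\to\mathcal C$ the $2$-fibre product $\mathcal D\times_{\mathcal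 C}U$ is a Hurewicz (respectively, Serre) stack. It is a gerbe if both it and its diagonal $\mathcal D\to\mathcal D\times_{\mathcal C}\mathcal D$ are epimorphisms of stacks (every morphism from a space to the target lifts, up to $2$-isomorphism, on the members of an open cover), and a Hurewicz (respectively, Serre) gerbe if it is moreover a Hurewicz (respectively, Serre) morphism. **Proposition.** Let $F\colon[\mathcal G_1\rightrightarrows M]\to[\mathcal H_1\rightrightarrows M]$ be a topological groupoid extension, i.e. a morphism of topological groupoids (continuous functor) that is the identity on $M$ and such that $F\colon\mathcal G_1\to\mathcal H_1$ admits local sections (there is an open cover of $\mathcal H_1$ with a continuous section of $F$ over each member). If the source map $s\colon\mathcal G_1\to M$ is locally a Hurewicz fibration (respectively, locally a Serre fibration), then the associated morphism of stacks $B\mathcal G\to B\mathcal H$, $P\mapsto (P\times_M\mathcal H_1)/\mathcal G_1$, is a Hurewicz gerbe (respectively, a Serre gerbe). -/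

import Mathlib

open CategoryTheory TopologicalSpace Topology

universe u

/-! # Compactly generated Hausdorff spaces -/

/-- An object of `CGTop`: a (small) compactly generated Hausdorff space. -/
structure CGTop : Type (u + 1) where
  carrier : Type u
  [top : TopologicalSpace carrier]
  [cg : CompactlyGeneratedSpace carrier]
  [t2 : T2Space carrier]

namespace CGTop

instance : CoeSort CGTop.{u} (Type u) := ⟨CGTop.carrier⟩

attribute [instance] CGTop.top CGTop.cg CGTop.t2

/-- The category of compactly generated Hausdorff spaces and continuous maps. -/
instance : Category.{u} CGTop.{u} where
  Hom X Y := C(X, Y)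
  id X := ContinuousMap.id X
  comp f g := g.comp f

instance : ConcreteCategory CGTop.{u} (fun X Y => C(X, Y)) where
  hom f := f
  ofHom f := f

/-- Bundle a compactly generated Hausdorff space. -/
abbrev of (X : Type u) [TopologicalSpace X] [CompactlyGeneratedSpace X] [T2Space X] :
    CGTop.{u} := ⟨X⟩

end CGTop

/-- Open subspaces of compactly generated spaces are compactly generated. -/
theorem IsOpen.compactlyGeneratedSpace_subtype {X : Type u} [TopologicalSpace X]
    [CompactlyGeneratedSpace X] {U : Set X} (hU : IsOpen U) : CompactlyGeneratedSpace U := by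
  refine compactlyGeneratedSpace_of_isOpen fun s hs => ?_
  rw [hU.isOpenEmbedding_subtypeVal.isOpen_iff_image_isOpen]
  refine CompactlyGeneratedSpace.isOpen' fun K _ _ _ g hg => ?_
  rw [isOpen_iff_mem_nhds]
  rintro k ⟨y, hy, hyk⟩
  have hkU : g ⁻¹' U ∈ 𝓝 k := (hU.preimage hg).mem_nhds (by
    change g k ∈ U
    rw [← hyk]; exact y.2)
  obtain ⟨L, hL, hLU, hLc⟩ := local_compact_nhds hkU
  have : CompactSpace L := isCompact_iff_compactSpace.mp hLc
  let f : L → U := fun l => ⟨g l, hLU l.2⟩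
  have hf : Continuous f := (hg.comp continuous_subtype_val).subtype_mk _
  have ho := hs L f hf
  obtain ⟨W, hW, hWs⟩ := isOpen_induced_iff.mp ho
  have hkL : k ∈ L := mem_of_mem_nhds hL
  have hkW : k ∈ W := by
    have : (⟨k, hkL⟩ : L) ∈ f ⁻¹' s := by
      change (⟨g k, _⟩ : U) ∈ s
      convert hy using 1
      exact Subtype.ext hyk.symm
    rw [← hWs] at this
    exact this
  filter_upwards [hL, hW.mem_nhds hkW] with l hl hlW
  have : (⟨l, hl⟩ : L) ∈ f ⁻¹' s := by rw [← hWs]; exact hlW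
  exact ⟨_, this, rfl⟩

instance {X : Type u} [TopologicalSpace X] [CompactlyGeneratedSpace X] (U : Opens X) :
    CompactlyGeneratedSpace U := U.2.compactlyGeneratedSpace_subtype

theorem continuous_compactlyGenerated {K : Type u} [TopologicalSpace K] [CompactSpace K]
    [T2Space K] {X : Type u} [TopologicalSpace X] (k : C(K, X)) :
    Continuous[_, TopologicalSpace.compactlyGenerated.{u} X] k := by
  let F : (Σ (i : (S : CompHaus.{u}) × C(S, X)), i.fst) → X := fun x => x.1.2 x.2
  have hF : Continuous[_, TopologicalSpace.compactlyGenerated.{u} X] F :=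
    continuous_coinduced_rng
  let j : K → (Σ (i : (S : CompHaus.{u}) × C(S, X)), i.fst) := fun x => ⟨⟨CompHaus.of K, k⟩, x⟩
  have hj : Continuous j := continuous_sigmaMk
    (σ := fun i : (S : CompHaus.{u}) × C(S, X) => i.fst) (i := ⟨CompHaus.of K, k⟩)
  exact @Continuous.comp _ _ _ _ _ (TopologicalSpace.compactlyGenerated.{u} X) j F hF hj

/-! # Fibre products of compactly generated Hausdorff spaces -/

/-- The fibre product `X ×_Z Y` in `CGTop`. -/
@[ext]
structure FiberProd {X Y Z : CGTop.{u}} (f : C(X, Z)) (g : C(Y, Z)) : Type u where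
  fst : X
  snd : Y
  w : f fst = g snd

namespace FiberProd

variable {X Y Z : CGTop.{u}} {f : C(X, Z)} {g : C(Y, Z)}

/-- The inclusion of the fibre product in the product. -/
def toProd (p : FiberProd f g) : X × Y := (p.fst, p.snd)

/-- The topology of the fibre product is the compactly generated topology associated with
the subspace topology of the product. -/
instance : TopologicalSpace (FiberProd f g) :=
  @TopologicalSpace.compactlyGenerated.{u} (FiberProd f g)
    (TopologicalSpace.induced toProd inferInstance)

theorem continuous_toProd : Continuous (toProd : FiberProd f g → X × Y) := by
  let t : TopologicalSpace (FiberProd f g) := TopologicalSpace.induced toProd inferInstance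
  exact continuous_from_compactlyGenerated.{u} _ fun S k => continuous_induced_dom.comp k.2

theorem continuous_fst : Continuous (FiberProd.fst : FiberProd f g → X) :=
  _root_.continuous_fst.comp continuous_toProd

theorem continuous_snd : Continuous (FiberProd.snd : FiberProd f g → Y) :=
  _root_.continuous_snd.comp continuous_toProd

instance : CompactlyGeneratedSpace (FiberProd f g) :=
  uCompactlyGeneratedSpace_of_coinduced.{u} continuous_coinduced_rng rfl

instance : T2Space (FiberProd f g) :=
  T2Space.of_injective_continuous (f := toProd)
    (fun _ _ h => FiberProd.ext (congrArg Prod.fst h) (congrArg Prod.snd h)) continuous_toProd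

/-- Universal property: a map from a compactly generated space to the fibre product is
continuous when its two components are. -/
theorem continuous_of {W : Type u} [TopologicalSpace W] [CompactlyGeneratedSpace W]
    {h : W → FiberProd f g} (h₁ : Continuous fun x => (h x).fst)
    (h₂ : Continuous fun x => (h x).snd) : Continuous h := by
  refine continuous_from_compactlyGeneratedSpace _ fun K _ _ _ k hk => ?_
  let t : TopologicalSpace (FiberProd f g) := TopologicalSpace.induced toProd inferInstance
  have hc : Continuous[_, t] (h ∘ k) :=
    continuous_induced_rng.mpr ((h₁.comp hk).prodMk (h₂.comp hk))
  exact continuous_compactlyGenerated ⟨h ∘ k, hc⟩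

end FiberProd

/-! # Local sections and fibrations -/

/-- A map admits local sections if the target has an open cover over each member of which
there is a continuous section. -/
def AdmitsLocalSections {X Y : Type u} [TopologicalSpace X] [TopologicalSpace Y]
    (f : C(X, Y)) : Prop :=
  ∀ y : Y, ∃ U : Opens Y, y ∈ U ∧ ∃ σ : C(U, X), ∀ v : U, f (σ v) = v

/-- The homotopy lifting property of `f` with respect to the space `Z`. -/
def HasHomotopyLifting {E B : Type u} [TopologicalSpace E] [TopologicalSpace B] (f : C(E, B))
    (Z : Type*) [TopologicalSpace Z] : Prop :=
  ∀ (h : C(Z × unitInterval, B)) (g : C(Z, E)), (∀ z, f (g z) = h (z, 0)) →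
    ∃ k : C(Z × unitInterval, E), (∀ z, k (z, 0) = g z) ∧ ∀ x, f (k x) = h x

/-- Hurewicz fibrations (in the category of compactly generated Hausdorff spaces). -/
def IsHurewiczFibration {E B : Type u} [TopologicalSpace E] [TopologicalSpace B]
    (f : C(E, B)) : Prop :=
  ∀ Z : CGTop.{u}, HasHomotopyLifting f Z

/-- Serre fibrations: homotopy lifting with respect to all cubes. -/
def IsSerreFibration {E B : Type u} [TopologicalSpace E] [TopologicalSpace B]
    (f : C(E, B)) : Prop :=
  ∀ n : ℕ, HasHomotopyLifting f (Fin n → unitInterval)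

/-- The map `U → V` between open subspaces obtained by restricting `f`. -/
def ContinuousMap.restrictOpens {X Y : Type u} [TopologicalSpace X] [TopologicalSpace Y]
    (f : C(X, Y)) (U : Opens X) (V : Opens Y) (h : ∀ x ∈ U, f x ∈ V) : C(U, V) :=
  ⟨fun x => ⟨f x, h x x.2⟩, (f.continuous.comp continuous_subtype_val).subtype_mk _⟩

/-- `f` is, locally on source and target, a Hurewicz fibration. -/
def IsLocallyHurewiczFibration {X Y : Type u} [TopologicalSpace X] [TopologicalSpace Y]
    (f : C(X, Y)) : Prop :=
  ∀ x : X, ∃ (U : Opens X) (V : Opens Y) (h : ∀ x ∈ U, f x ∈ V),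
    x ∈ U ∧ IsHurewiczFibration (f.restrictOpens U V h)

/-- `f` is, locally on source and target, a Serre fibration. -/
def IsLocallySerreFibration {X Y : Type u} [TopologicalSpace X] [TopologicalSpace Y]
    (f : C(X, Y)) : Prop :=
  ∀ x : X, ∃ (U : Opens X) (V : Opens Y) (h : ∀ x ∈ U, f x ∈ V),
    x ∈ U ∧ IsSerreFibration (f.restrictOpens U V h)

/-! # Topological groupoids -/

/-- A topological groupoid with space of objects `M`: a groupoid object in `CGTop`.
`comp ⟨g, h, _⟩` is the composite `g ∘ h`, defined when `src g = tgt h`. -/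
structure TopGroupoid (M : CGTop.{u}) where
  Arr : CGTop.{u}
  src : C(Arr, M)
  tgt : C(Arr, M)
  one : C(M, Arr)
  inv : C(Arr, Arr)
  comp : C(FiberProd src tgt, Arr)
  src_one : ∀ x, src (one x) = x
  tgt_one : ∀ x, tgt (one x) = x
  src_inv : ∀ g, src (inv g) = tgt g
  tgt_inv : ∀ g, tgt (inv g) = src g
  src_comp : ∀ p, src (comp p) = src p.snd
  tgt_comp : ∀ p, tgt (comp p) = tgt p.fst
  one_comp : ∀ g, comp ⟨one (tgt g), g, src_one _⟩ = g
  comp_one : ∀ g, comp ⟨g, one (src g), (tgt_one _).symm⟩ = g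
  assoc : ∀ (f g h : Arr) (w₁ : src f = tgt g) (w₂ : src g = tgt h),
    comp ⟨comp ⟨f, g, w₁⟩, h, (src_comp ⟨f, g, w₁⟩).trans w₂⟩ =
      comp ⟨f, comp ⟨g, h, w₂⟩, w₁.trans (tgt_comp ⟨g, h, w₂⟩).symm⟩
  inv_comp : ∀ g, comp ⟨inv g, g, src_inv g⟩ = one (src g)
  comp_inv : ∀ g, comp ⟨g, inv g, (tgt_inv g).symm⟩ = one (tgt g)

namespace TopGroupoid

/-- A morphism of topological groupoids: a continuous functor. -/
structure Hom {M N : CGTop.{u}} (G : TopGroupoid M) (H : TopGroupoid N) where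
  obj : C(M, N)
  arr : C(G.Arr, H.Arr)
  src_arr : ∀ g, H.src (arr g) = obj (G.src g)
  tgt_arr : ∀ g, H.tgt (arr g) = obj (G.tgt g)
  arr_one : ∀ x, arr (G.one x) = H.one (obj x)
  arr_comp : ∀ p : FiberProd G.src G.tgt, arr (G.comp p) =
    H.comp ⟨arr p.fst, arr p.snd, by rw [src_arr, tgt_arr, p.w]⟩

/-- A topological groupoid extension: a morphism of topological groupoids with the same
space of objects, which is the identity on objects and which admits local sections on arrows. -/
structure Hom.IsExtension {M : CGTop.{u}} {G H : TopGroupoid M} (F : G.Hom H) : Prop where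
  obj_eq : F.obj = ContinuousMap.id M
  admitsLocalSections : AdmitsLocalSections F.arr

end TopGroupoid

/-! # Principal bundles -/

/-- A principal `G`-bundle over `X`, with `G` acting on the right:
`act ⟨p, γ, _⟩` is `p · γ`, defined when `anchor p = tgt γ`. -/
structure PrincipalBundle {M : CGTop.{u}} (G : TopGroupoid M) (X : CGTop.{u}) where
  total : CGTop.{u}
  proj : C(total, X)
  admitsLocalSections : AdmitsLocalSections proj
  anchor : C(total, M)
  act : C(FiberProd anchor G.tgt, total)
  anchor_act : ∀ x, anchor (act x) = G.src x.snd
  act_one : ∀ p, act ⟨p, G.one (anchor p), (G.tgt_one _).symm⟩ = p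
  act_act : ∀ (p : total) (g h : G.Arr) (w₁ : anchor p = G.tgt g) (w₂ : G.src g = G.tgt h),
    act ⟨act ⟨p, g, w₁⟩, h, (anchor_act ⟨p, g, w₁⟩).trans w₂⟩ =
      act ⟨p, G.comp ⟨g, h, w₂⟩, w₁.trans (G.tgt_comp ⟨g, h, w₂⟩).symm⟩
  proj_act : ∀ x, proj (act x) = proj x.fst
  principal : IsHomeomorph
    (fun x : FiberProd anchor G.tgt => (⟨x.fst, act x, (proj_act x).symm⟩ : FiberProd proj proj))

/-- An object of `BG`: a space together with a principal `G`-bundle over it. -/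
structure BObj {M : CGTop.{u}} (G : TopGroupoid M) : Type (u + 1) where
  base : CGTop.{u}
  bundle : PrincipalBundle G base

/-- A morphism of principal `G`-bundles over varying base spaces. -/
@[ext]
structure BHom {M : CGTop.{u}} {G : TopGroupoid M} (P Q : BObj G) : Type u where
  map : C(P.bundle.total, Q.bundle.total)
  base : C(P.base, Q.base)
  anchor_map : ∀ p, Q.bundle.anchor (map p) = P.bundle.anchor p
  map_act : ∀ x : FiberProd P.bundle.anchor G.tgt, map (P.bundle.act x) =
    Q.bundle.act ⟨map x.fst, x.snd, (anchor_map _).trans x.w⟩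
  proj_map : ∀ p, Q.bundle.proj (map p) = base (P.bundle.proj p)

instance {M : CGTop.{u}} (G : TopGroupoid M) : Category.{u} (BObj G) where
  Hom := BHom
  id P :=
    { map := ContinuousMap.id _
      base := ContinuousMap.id _
      anchor_map := fun _ => rfl
      map_act := fun _ => rfl
      proj_map := fun _ => rfl }
  comp F F' :=
    { map := F'.map.comp F.map
      base := F'.base.comp F.base
      anchor_map := fun p => (F'.anchor_map _).trans (F.anchor_map p)
      map_act := fun x => (congrArg F'.map (F.map_act x)).trans (F'.map_act _)
      proj_map := fun p => (F'.proj_map _).trans (congrArg F'.base (F.proj_map p)) }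

/-- The category `BG` of principal `G`-bundles, fibred over `CGTop`. -/
def TopGroupoid.B {M : CGTop.{u}} (G : TopGroupoid M) :
    BasedCategory.{u, u + 1} CGTop.{u} where
  obj := BObj G
  p :=
    { obj := BObj.base
      map := fun F => BHom.base F }

/-! # The principal bundle associated with a morphism of groupoids -/

namespace TopGroupoid

variable {M : CGTop.{u}} (G : TopGroupoid M)

theorem comp_congr {g g' h h' : G.Arr} (e₁ : g = g') (e₂ : h = h') (w : G.src g = G.tgt h)
    (w' : G.src g' = G.tgt h') : G.comp ⟨g, h, w⟩ = G.comp ⟨g', h', w'⟩ :=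
  congrArg G.comp (FiberProd.ext e₁ e₂)

theorem one_comp' {e g : G.Arr} (he : e = G.one (G.tgt g)) (w : G.src e = G.tgt g) :
    G.comp ⟨e, g, w⟩ = g :=
  (G.comp_congr he rfl w (G.src_one _)).trans (G.one_comp g)

theorem inv_comp_cancel {g h : G.Arr} (w : G.src g = G.tgt h)
    (w' : G.src (G.inv g) = G.tgt (G.comp ⟨g, h, w⟩)) :
    G.comp ⟨G.inv g, G.comp ⟨g, h, w⟩, w'⟩ = h := by
  rw [← G.assoc _ _ _ (G.src_inv g) w]
  exact G.one_comp' (by rw [G.inv_comp, w]) _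

theorem comp_inv_cancel {g h : G.Arr} (w : G.src (G.inv g) = G.tgt h)
    (w' : G.src g = G.tgt (G.comp ⟨G.inv g, h, w⟩)) :
    G.comp ⟨g, G.comp ⟨G.inv g, h, w⟩, w'⟩ = h := by
  rw [← G.assoc _ _ _ (G.tgt_inv g).symm w]
  exact G.one_comp' (by rw [G.comp_inv, ← w, G.src_inv]) _

end TopGroupoid

namespace PrincipalBundle

variable {M N X : CGTop.{u}} {G : TopGroupoid M} {H : TopGroupoid N} (P : PrincipalBundle G X)

theorem act_congr {p p' : P.total} {g g' : G.Arr} (e₁ : p = p') (e₂ : g = g')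
    (w : P.anchor p = G.tgt g) (w' : P.anchor p' = G.tgt g') :
    P.act ⟨p, g, w⟩ = P.act ⟨p', g', w'⟩ :=
  congrArg P.act (FiberProd.ext e₁ e₂)

/-- The division map of a principal bundle: `p · div (p, q) = q`. -/
noncomputable def div : C(FiberProd P.proj P.proj, G.Arr) :=
  ⟨fun x => (P.principal.homeomorph.symm x).snd,
    FiberProd.continuous_snd.comp P.principal.homeomorph.symm.continuous⟩

theorem exists_div (x : FiberProd P.proj P.proj) :
    ∃ w : P.anchor x.fst = G.tgt (P.div x), P.act ⟨x.fst, P.div x, w⟩ = x.snd := by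
  have h := P.principal.homeomorph.apply_symm_apply x
  have h₁ : (P.principal.homeomorph.symm x).fst = x.fst := congrArg FiberProd.fst h
  have h₂ : P.act (P.principal.homeomorph.symm x) = x.snd := congrArg FiberProd.snd h
  have w : P.anchor x.fst = G.tgt (P.div x) := by
    rw [← h₁]; exact (P.principal.homeomorph.symm x).w
  refine ⟨w, ?_⟩
  rw [← h₂]
  exact P.act_congr h₁.symm rfl _ _

theorem tgt_div (x : FiberProd P.proj P.proj) : P.anchor x.fst = G.tgt (P.div x) :=
  (P.exists_div x).1

theorem act_div (x : FiberProd P.proj P.proj) : P.act ⟨x.fst, P.div x, P.tgt_div x⟩ = x.snd :=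
  (P.exists_div x).2

theorem src_div (x : FiberProd P.proj P.proj) : G.src (P.div x) = P.anchor x.snd := by
  rw [← P.act_div x, P.anchor_act]

theorem act_inj {p : P.total} {g g' : G.Arr} (w : P.anchor p = G.tgt g)
    (w' : P.anchor p = G.tgt g') (h : P.act ⟨p, g, w⟩ = P.act ⟨p, g', w'⟩) : g = g' :=
  congrArg FiberProd.snd (P.principal.injective
    (a₁ := ⟨p, g, w⟩) (a₂ := ⟨p, g', w'⟩) (FiberProd.ext rfl h))

theorem div_eq {p q : P.total} (h : P.proj p = P.proj q) {g : G.Arr} (w : P.anchor p = G.tgt g)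
    (e : P.act ⟨p, g, w⟩ = q) : P.div ⟨p, q, h⟩ = g :=
  P.act_inj (P.tgt_div ⟨p, q, h⟩) w ((P.act_div ⟨p, q, h⟩).trans e.symm)

theorem div_self (p : P.total) : P.div ⟨p, p, rfl⟩ = G.one (P.anchor p) :=
  P.div_eq _ _ (P.act_one p)

theorem div_act {p q : P.total} (h : P.proj p = P.proj q) {g : G.Arr}
    (w : P.anchor q = G.tgt g) (h' : P.proj p = P.proj (P.act ⟨q, g, w⟩)) :
    P.div ⟨p, P.act ⟨q, g, w⟩, h'⟩ = G.comp ⟨P.div ⟨p, q, h⟩, g, (P.src_div _).trans w⟩ := by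
  refine P.div_eq _ ((P.tgt_div ⟨p, q, h⟩).trans
    (G.tgt_comp ⟨P.div ⟨p, q, h⟩, g, (P.src_div _).trans w⟩).symm) ?_
  rw [← P.act_act p _ g (P.tgt_div ⟨p, q, h⟩)]
  exact P.act_congr (P.act_div ⟨p, q, h⟩) rfl _ _

variable (φ : G.Hom H)

/-- The space `P ×_N H₁` of pairs `(p, δ)` with `φ₀ (anchor p) = tgt δ`. -/
abbrev PreAssoc : Type u := FiberProd (φ.obj.comp P.anchor) H.tgt

variable {P φ} in
/-- `(p, φ γ ∘ δ)` is identified with `(p · γ, δ)`. -/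
def AssocRel (x y : P.PreAssoc φ) : Prop :=
  ∃ (γ : G.Arr) (w : P.anchor x.fst = G.tgt γ) (w' : H.src (φ.arr γ) = H.tgt y.snd),
    y.fst = P.act ⟨x.fst, γ, w⟩ ∧ x.snd = H.comp ⟨φ.arr γ, y.snd, w'⟩

/-- The coordinate of `x = (p, δ)` in the fibre of `p₀`, so that `x ∼ (p₀, coord)`. -/
noncomputable def coord (p₀ : P.total) (x : P.PreAssoc φ) (h : P.proj p₀ = P.proj x.fst) :
    H.Arr :=
  H.comp ⟨φ.arr (P.div ⟨p₀, x.fst, h⟩), x.snd, by rw [φ.src_arr, P.src_div]; exact x.w⟩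

theorem tgt_coord (p₀ : P.total) (x : P.PreAssoc φ) (h : P.proj p₀ = P.proj x.fst) :
    φ.obj (P.anchor p₀) = H.tgt (P.coord φ p₀ x h) := by
  rw [coord, H.tgt_comp, φ.tgt_arr, ← P.tgt_div]

theorem src_coord (p₀ : P.total) (x : P.PreAssoc φ) (h : P.proj p₀ = P.proj x.fst) :
    H.src (P.coord φ p₀ x h) = H.src x.snd := by
  rw [coord, H.src_comp]

theorem coord_self (x : P.PreAssoc φ) : P.coord φ x.fst x rfl = x.snd :=
  H.one_comp' (by rw [P.div_self, φ.arr_one]; exact congrArg H.one x.w) _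

theorem assocRel_coord (p₀ : P.total) (x : P.PreAssoc φ) (h : P.proj p₀ = P.proj x.fst) :
    AssocRel (⟨p₀, P.coord φ p₀ x h, P.tgt_coord φ p₀ x h⟩ : P.PreAssoc φ) x :=
  ⟨P.div ⟨p₀, x.fst, h⟩, P.tgt_div ⟨p₀, x.fst, h⟩, _, (P.act_div ⟨p₀, x.fst, h⟩).symm, rfl⟩

variable {P φ}

theorem AssocRel.proj_eq {x y : P.PreAssoc φ} (r : AssocRel x y) :
    P.proj x.fst = P.proj y.fst := by
  obtain ⟨γ, w, w', e, -⟩ := r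
  rw [e, P.proj_act]

theorem AssocRel.src_eq {x y : P.PreAssoc φ} (r : AssocRel x y) : H.src x.snd = H.src y.snd := by
  obtain ⟨γ, w, w', -, e⟩ := r
  rw [e, H.src_comp]

theorem AssocRel.coord_eq {x y : P.PreAssoc φ} (r : AssocRel x y) (p₀ : P.total)
    (h : P.proj p₀ = P.proj x.fst) (h' : P.proj p₀ = P.proj y.fst) :
    P.coord φ p₀ x h = P.coord φ p₀ y h' := by
  obtain ⟨x₁, x₂, wx⟩ := x
  obtain ⟨y₁, y₂, wy⟩ := y
  obtain ⟨γ, w, w', e₁, e₂⟩ := r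
  dsimp only at e₁ e₂ w w' h h'
  subst e₁ e₂
  have hs : H.src (φ.arr (P.div ⟨p₀, x₁, h⟩)) = H.tgt (φ.arr γ) := by
    rw [φ.src_arr, φ.tgt_arr, P.src_div, w]
  refine (H.assoc (φ.arr (P.div ⟨p₀, x₁, h⟩)) (φ.arr γ) y₂ hs w').symm.trans ?_
  refine H.comp_congr ?_ rfl _ _
  rw [P.div_act h w h', φ.arr_comp]

theorem assocRel_iff {x y : P.PreAssoc φ} :
    AssocRel x y ↔ ∃ h : P.proj x.fst = P.proj y.fst, P.coord φ x.fst y h = x.snd := by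
  constructor
  · intro r
    exact ⟨r.proj_eq, by rw [← r.coord_eq x.fst rfl r.proj_eq, coord_self]⟩
  · rintro ⟨h, e⟩
    have := P.assocRel_coord φ x.fst y h
    have hx : (⟨x.fst, P.coord φ x.fst y h, P.tgt_coord φ x.fst y h⟩ : P.PreAssoc φ) = x :=
      FiberProd.ext rfl e
    rwa [hx] at this

theorem AssocRel.refl (x : P.PreAssoc φ) : AssocRel x x :=
  assocRel_iff.mpr ⟨rfl, P.coord_self φ x⟩

theorem AssocRel.symm {x y : P.PreAssoc φ} (r : AssocRel x y) : AssocRel y x :=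
  assocRel_iff.mpr ⟨r.proj_eq.symm, by rw [r.coord_eq y.fst r.proj_eq.symm rfl, coord_self]⟩

theorem AssocRel.trans {x y z : P.PreAssoc φ} (r : AssocRel x y) (s : AssocRel y z) :
    AssocRel x z :=
  assocRel_iff.mpr ⟨r.proj_eq.trans s.proj_eq, by
    rw [← s.coord_eq x.fst r.proj_eq, ← r.coord_eq x.fst rfl, coord_self]⟩

variable (P φ)

/-- The equivalence relation on `P ×_N H₁` given by the action of `G`. -/
instance assocSetoid : Setoid (P.PreAssoc φ) where
  r := AssocRel
  iseqv := ⟨AssocRel.refl, AssocRel.symm, AssocRel.trans⟩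

/-- The total space `(P ×_N H₁) / G` of the associated bundle, with the quotient topology. -/
abbrev Assoc : Type u := Quotient (P.assocSetoid φ)

/-- The class of `(p, δ)` in the associated bundle. -/
def assocMk : C(P.PreAssoc φ, P.Assoc φ) := ⟨Quotient.mk _, continuous_quotient_mk'⟩

/-- The projection of the associated bundle: `[p, δ] ↦ proj p`. -/
def assocProj : C(P.Assoc φ, X) where
  toFun := Quotient.lift (fun x => P.proj x.fst) fun _ _ r => AssocRel.proj_eq r
  continuous_toFun := (P.proj.continuous.comp FiberProd.continuous_fst).quotient_lift _

/-- The anchor of the associated bundle: `[p, δ] ↦ src δ`. -/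
def assocAnchor : C(P.Assoc φ, N) where
  toFun := Quotient.lift (fun x => H.src x.snd) fun _ _ r => AssocRel.src_eq r
  continuous_toFun := (H.src.continuous.comp FiberProd.continuous_snd).quotient_lift _

variable {φ}

theorem exists_rep (q : P.Assoc φ) (p₀ : P.total) (h : P.proj p₀ = P.assocProj φ q) :
    ∃ (δ : H.Arr) (w : φ.obj (P.anchor p₀) = H.tgt δ), q = P.assocMk φ ⟨p₀, δ, w⟩ := by
  induction q using Quotient.inductionOn with
  | h x => exact ⟨_, _, (Quotient.sound (P.assocRel_coord φ p₀ x h)).symm⟩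

theorem assocMk_inj {p₀ : P.total} {δ δ' : H.Arr} {w : φ.obj (P.anchor p₀) = H.tgt δ}
    {w' : φ.obj (P.anchor p₀) = H.tgt δ'}
    (h : P.assocMk φ ⟨p₀, δ, w⟩ = P.assocMk φ ⟨p₀, δ', w'⟩) : δ = δ' := by
  have r : AssocRel (⟨p₀, δ, w⟩ : P.PreAssoc φ) ⟨p₀, δ', w'⟩ := Quotient.exact h
  have := r.coord_eq p₀ rfl rfl
  rwa [P.coord_self φ ⟨p₀, δ, w⟩, P.coord_self φ ⟨p₀, δ', w'⟩] at this

/-- The coordinate of a point of the associated bundle in the fibre of `p₀`. -/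
noncomputable def assocCoord (p₀ : P.total) (q : P.Assoc φ) (h : P.proj p₀ = P.assocProj φ q) :
    H.Arr := (P.exists_rep q p₀ h).choose

theorem tgt_assocCoord (p₀ : P.total) (q : P.Assoc φ) (h : P.proj p₀ = P.assocProj φ q) :
    φ.obj (P.anchor p₀) = H.tgt (P.assocCoord p₀ q h) := (P.exists_rep q p₀ h).choose_spec.1

theorem assocMk_assocCoord (p₀ : P.total) (q : P.Assoc φ) (h : P.proj p₀ = P.assocProj φ q) :
    P.assocMk φ ⟨p₀, P.assocCoord p₀ q h, P.tgt_assocCoord p₀ q h⟩ = q :=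
  (P.exists_rep q p₀ h).choose_spec.2.symm

theorem src_assocCoord (p₀ : P.total) (q : P.Assoc φ) (h : P.proj p₀ = P.assocProj φ q) :
    H.src (P.assocCoord p₀ q h) = P.assocAnchor φ q :=
  congrArg (P.assocAnchor φ) (P.assocMk_assocCoord p₀ q h)

theorem assocCoord_mk (p₀ : P.total) (x : P.PreAssoc φ) (h : P.proj p₀ = P.proj x.fst) :
    P.assocCoord p₀ (P.assocMk φ x) h = P.coord φ p₀ x h :=
  P.assocMk_inj (w := P.tgt_assocCoord p₀ _ h) (w' := P.tgt_coord φ p₀ x h)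
    ((P.assocMk_assocCoord p₀ (P.assocMk φ x) h).trans
      (Quotient.sound (P.assocRel_coord φ p₀ x h)).symm)

/-- Over an open set with a local section, the coordinate of a point of the associated bundle
depends continuously on the point. -/
theorem continuous_assocCoord {U : Opens X} (σ : C(U, P.total)) (hσ : ∀ v, P.proj (σ v) = v)
    {W : Type u} [TopologicalSpace W] {f : W → P.Assoc φ} (hf : Continuous f)
    (hU : ∀ z, P.assocProj φ (f z) ∈ U) :
    Continuous fun z => P.assocCoord (σ ⟨_, hU z⟩) (f z) (hσ _) := by
  let V : Set (P.Assoc φ) := P.assocProj φ ⁻¹' U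
  have hV : IsOpen V := U.2.preimage (P.assocProj φ).continuous
  suffices hc : Continuous fun q : V => P.assocCoord (σ ⟨_, q.2⟩) q.1 (hσ _) from
    hc.comp (hf.subtype_mk hU)
  have hq : IsQuotientMap (P.assocMk φ) := isQuotientMap_quotient_mk'
  rw [(hq.restrictPreimage_isOpen hV).continuous_iff]
  have hE : IsOpen (P.assocMk φ ⁻¹' V) := hV.preimage (P.assocMk φ).continuous
  have := hE.compactlyGeneratedSpace_subtype
  have e : ((fun q : V => P.assocCoord (σ ⟨_, q.2⟩) q.1 (hσ _)) ∘
      V.restrictPreimage (P.assocMk φ)) =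
      fun x => P.coord φ (σ ⟨P.proj x.1.fst, x.2⟩) x.1 (hσ _) :=
    funext fun x => P.assocCoord_mk _ x.1 _
  rw [e]
  have h₁ : Continuous fun x : P.assocMk φ ⁻¹' V => x.1.fst :=
    FiberProd.continuous_fst.comp continuous_subtype_val
  have h₂ : Continuous fun x : P.assocMk φ ⁻¹' V => σ ⟨P.proj x.1.fst, x.2⟩ :=
    σ.continuous.comp ((P.proj.continuous.comp h₁).subtype_mk _)
  refine H.comp.continuous.comp (FiberProd.continuous_of ?_ ?_)
  · exact φ.arr.continuous.comp (P.div.continuous.comp (FiberProd.continuous_of h₂ h₁))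
  · exact (FiberProd.continuous_snd (f := φ.obj.comp P.anchor) (g := H.tgt)).comp
      continuous_subtype_val

instance : T2Space (P.Assoc φ) := by
  refine ⟨fun q q' hne => ?_⟩
  by_cases hp : P.assocProj φ q = P.assocProj φ q'
  · obtain ⟨U, hU, σ, hσ⟩ := P.admitsLocalSections (P.assocProj φ q)
    let V : Set (P.Assoc φ) := P.assocProj φ ⁻¹' U
    have hV : IsOpen V := U.2.preimage (P.assocProj φ).continuous
    have hc := P.continuous_assocCoord σ hσ (f := fun x : V => x.1) continuous_subtype_val
      (fun x => x.2)
    have hq' : q' ∈ V := by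
      change P.assocProj φ q' ∈ U
      rwa [← hp]
    have hcne : P.assocCoord (σ ⟨_, hU⟩) q (hσ _) ≠ P.assocCoord (σ ⟨_, hq'⟩) q' (hσ _) := by
      intro hEq
      apply hne
      rw [← P.assocMk_assocCoord (σ ⟨_, hU⟩) q (hσ _),
        ← P.assocMk_assocCoord (σ ⟨_, hq'⟩) q' (hσ _)]
      exact congrArg _ (FiberProd.ext (congrArg σ (Subtype.ext hp)) hEq)
    obtain ⟨A, B, hA, hB, hqA, hqB, hAB⟩ := t2_separation hcne
    refine ⟨_, _, hV.isOpenMap_subtype_val _ (hA.preimage hc),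
      hV.isOpenMap_subtype_val _ (hB.preimage hc), ⟨⟨q, hU⟩, hqA, rfl⟩, ⟨⟨q', hq'⟩, hqB, rfl⟩, ?_⟩
    exact (Set.disjoint_image_iff Subtype.val_injective).mpr (hAB.preimage _)
  · obtain ⟨A, B, hA, hB, hqA, hqB, hAB⟩ := t2_separation hp
    exact ⟨_, _, hA.preimage (P.assocProj φ).continuous, hB.preimage (P.assocProj φ).continuous,
      hqA, hqB, hAB.preimage _⟩

theorem exists_assocAct (x : FiberProd (X := CGTop.of (P.Assoc φ)) (P.assocAnchor φ) H.tgt) :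
    ∃ q : P.Assoc φ, ∀ (p : P.total) (δ : H.Arr) (w : φ.obj (P.anchor p) = H.tgt δ)
      (w' : H.src δ = H.tgt x.snd), x.fst = P.assocMk φ ⟨p, δ, w⟩ →
        q = P.assocMk φ ⟨p, H.comp ⟨δ, x.snd, w'⟩, w.trans (H.tgt_comp ⟨δ, x.snd, w'⟩).symm⟩ := by
  obtain ⟨q, h, wx⟩ := x
  induction q using Quotient.inductionOn with
  | h y =>
    refine ⟨P.assocMk φ ⟨y.fst, H.comp ⟨y.snd, h, wx⟩,
      y.w.trans (H.tgt_comp ⟨y.snd, h, wx⟩).symm⟩, fun p δ w w' e => ?_⟩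
    obtain ⟨γ, v, v', e₁, e₂⟩ : AssocRel y ⟨p, δ, w⟩ := Quotient.exact e
    refine Quotient.sound ⟨γ, v, v'.trans (H.tgt_comp ⟨δ, h, w'⟩).symm, e₁, ?_⟩
    refine Eq.trans ?_ (H.assoc (φ.arr γ) δ h v' w')
    exact H.comp_congr e₂ rfl _ _

variable (φ)

/-- The underlying function of the right action of `H`: `[p, δ] · δ' = [p, δ ∘ δ']`. -/
noncomputable def assocActFun
    (x : FiberProd (X := CGTop.of (P.Assoc φ)) (P.assocAnchor φ) H.tgt) : P.Assoc φ :=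
  (P.exists_assocAct x).choose

variable {φ}

theorem assocActFun_congr {q q' : P.Assoc φ} {h : H.Arr} (e : q = q')
    (w : P.assocAnchor φ q = H.tgt h) (w' : P.assocAnchor φ q' = H.tgt h) :
    P.assocActFun φ ⟨q, h, w⟩ = P.assocActFun φ ⟨q', h, w'⟩ := by
  subst e; rfl

theorem assocActFun_mk (p : P.total) (δ δ' : H.Arr) (w : φ.obj (P.anchor p) = H.tgt δ)
    (w' : H.src δ = H.tgt δ') :
    P.assocActFun φ ⟨P.assocMk φ ⟨p, δ, w⟩, δ', w'⟩ =
      P.assocMk φ ⟨p, H.comp ⟨δ, δ', w'⟩, w.trans (H.tgt_comp ⟨δ, δ', w'⟩).symm⟩ :=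
  (P.exists_assocAct ⟨P.assocMk φ ⟨p, δ, w⟩, δ', w'⟩).choose_spec p δ w w' rfl

theorem assocActFun_eq (x : FiberProd (X := CGTop.of (P.Assoc φ)) (P.assocAnchor φ) H.tgt)
    (p₀ : P.total) (h : P.proj p₀ = P.assocProj φ x.fst) :
    P.assocActFun φ x = P.assocMk φ
      ⟨p₀, H.comp ⟨P.assocCoord p₀ x.fst h, x.snd, (P.src_assocCoord p₀ x.fst h).trans x.w⟩,
        (P.tgt_assocCoord p₀ x.fst h).trans (H.tgt_comp
          ⟨P.assocCoord p₀ x.fst h, x.snd, (P.src_assocCoord p₀ x.fst h).trans x.w⟩).symm⟩ :=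
  (P.exists_assocAct x).choose_spec p₀ _ _ _ (P.assocMk_assocCoord p₀ x.fst h).symm

theorem assocProj_act (x : FiberProd (X := CGTop.of (P.Assoc φ)) (P.assocAnchor φ) H.tgt) :
    P.assocProj φ (P.assocActFun φ x) = P.assocProj φ x.fst := by
  obtain ⟨q, h, wx⟩ := x
  induction q using Quotient.inductionOn with
  | h y =>
    exact (congrArg (P.assocProj φ) (P.assocActFun_mk y.fst y.snd h y.w wx) :)

theorem continuous_assocActFun : Continuous (P.assocActFun φ) := by
  rw [continuous_iff_continuousAt]
  intro x
  obtain ⟨U, hU, σ, hσ⟩ := P.admitsLocalSections (P.assocProj φ x.fst)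
  let V : Set (FiberProd (X := CGTop.of (P.Assoc φ)) (P.assocAnchor φ) H.tgt) :=
    (fun y => P.assocProj φ y.fst) ⁻¹' U
  have hV : IsOpen V :=
    U.2.preimage ((P.assocProj φ).continuous.comp FiberProd.continuous_fst)
  have := hV.compactlyGeneratedSpace_subtype
  suffices hc : Continuous (V.domRestrict (P.assocActFun φ)) from
    (continuousOn_iff_continuous_domRestrict.mpr hc).continuousAt (hV.mem_nhds hU)
  have e : V.domRestrict (P.assocActFun φ) = fun y => _ :=
    funext fun y => P.assocActFun_eq y.1 (σ ⟨_, y.2⟩) (hσ _)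
  rw [e]
  have h₁ : Continuous fun y : V => y.1.fst :=
    FiberProd.continuous_fst.comp continuous_subtype_val
  refine (P.assocMk φ).continuous.comp (FiberProd.continuous_of ?_ ?_)
  · exact σ.continuous.comp (((P.assocProj φ).continuous.comp h₁).subtype_mk _)
  · refine H.comp.continuous.comp (FiberProd.continuous_of ?_ ?_)
    · exact P.continuous_assocCoord σ hσ h₁ fun y => y.2
    · exact (FiberProd.continuous_snd (X := CGTop.of (P.Assoc φ)) (f := P.assocAnchor φ)
        (g := H.tgt)).comp continuous_subtype_val

theorem assocPrincipal : IsHomeomorph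
    (fun x : FiberProd (X := CGTop.of (P.Assoc φ)) (P.assocAnchor φ) H.tgt =>
      (⟨x.fst, P.assocActFun φ x, (P.assocProj_act x).symm⟩ :
        FiberProd (X := CGTop.of (P.Assoc φ)) (Y := CGTop.of (P.Assoc φ))
          (P.assocProj φ) (P.assocProj φ))) := by
  have key : ∀ (x : FiberProd (X := CGTop.of (P.Assoc φ)) (Y := CGTop.of (P.Assoc φ))
      (P.assocProj φ) (P.assocProj φ)) (p₀ : P.total) (h : P.proj p₀ = P.assocProj φ x.fst),
      ∃ (w : H.src (H.inv (P.assocCoord p₀ x.fst h)) =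
          H.tgt (P.assocCoord p₀ x.snd (h.trans x.w)))
        (w' : P.assocAnchor φ x.fst = H.tgt (H.comp ⟨_, _, w⟩)),
        P.assocActFun φ ⟨x.fst, H.comp ⟨_, _, w⟩, w'⟩ = x.snd := by
    intro x p₀ h
    have w : H.src (H.inv (P.assocCoord p₀ x.fst h)) =
        H.tgt (P.assocCoord p₀ x.snd (h.trans x.w)) := by
      rw [H.src_inv, ← P.tgt_assocCoord, ← P.tgt_assocCoord]
    refine ⟨w, by rw [H.tgt_comp, H.tgt_inv, P.src_assocCoord], ?_⟩
    rw [P.assocActFun_eq _ p₀ h]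
    refine Eq.trans ?_ (P.assocMk_assocCoord p₀ x.snd (h.trans x.w))
    exact congrArg (P.assocMk φ) (FiberProd.ext rfl (H.comp_inv_cancel w _))
  have inj : Function.Injective
      (fun x : FiberProd (X := CGTop.of (P.Assoc φ)) (P.assocAnchor φ) H.tgt =>
      (⟨x.fst, P.assocActFun φ x, (P.assocProj_act x).symm⟩ :
        FiberProd (X := CGTop.of (P.Assoc φ)) (Y := CGTop.of (P.Assoc φ))
          (P.assocProj φ) (P.assocProj φ))) := by
    rintro ⟨q, h, w⟩ ⟨q', h', w'⟩ e
    obtain rfl : q = q' := congrArg FiberProd.fst e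
    have e₂ : P.assocActFun φ ⟨q, h, w⟩ = P.assocActFun φ ⟨q, h', w'⟩ := congrArg FiberProd.snd e
    refine FiberProd.ext rfl ?_
    induction q using Quotient.inductionOn with
    | h y =>
      have e₃ := (P.assocActFun_mk y.fst y.snd h y.w w).symm.trans
        (e₂.trans (P.assocActFun_mk y.fst y.snd h' y.w w'))
      have e₄ := P.assocMk_inj e₃
      change h = h'
      have w₁ : H.src y.snd = H.tgt h := w
      have w₂ : H.src y.snd = H.tgt h' := w'
      rw [← H.inv_comp_cancel w₁ ((H.src_inv _).trans (H.tgt_comp ⟨_, _, w₁⟩).symm),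
        ← H.inv_comp_cancel w₂ ((H.src_inv _).trans (H.tgt_comp ⟨_, _, w₂⟩).symm)]
      exact H.comp_congr rfl e₄ _ _
  have surj : ∀ x : FiberProd (X := CGTop.of (P.Assoc φ)) (Y := CGTop.of (P.Assoc φ))
      (P.assocProj φ) (P.assocProj φ), ∃ p₀, P.proj p₀ = P.assocProj φ x.fst := by
    rintro ⟨q, q', w⟩
    induction q using Quotient.inductionOn with
    | h y => exact ⟨y.fst, rfl⟩
  choose p hp using surj
  rw [isHomeomorph_iff_exists_inverse]
  refine ⟨FiberProd.continuous_of FiberProd.continuous_fst P.continuous_assocActFun,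
    fun x => ⟨x.fst, _, (key x (p x) (hp x)).choose_spec.choose⟩, ?_, ?_, ?_⟩
  · intro x
    exact inj (FiberProd.ext rfl (key _ (p _) (hp _)).choose_spec.choose_spec)
  · intro x
    exact FiberProd.ext rfl (key x (p x) (hp x)).choose_spec.choose_spec
  · refine FiberProd.continuous_of FiberProd.continuous_fst ?_
    rw [continuous_iff_continuousAt]
    intro x
    obtain ⟨U, hU, σ, hσ⟩ := P.admitsLocalSections (P.assocProj φ x.fst)
    let V : Set (FiberProd (X := CGTop.of (P.Assoc φ)) (Y := CGTop.of (P.Assoc φ))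
      (P.assocProj φ) (P.assocProj φ)) := (fun y => P.assocProj φ y.fst) ⁻¹' U
    have hV : IsOpen V :=
      U.2.preimage ((P.assocProj φ).continuous.comp FiberProd.continuous_fst)
    have := hV.compactlyGeneratedSpace_subtype
    refine (continuousOn_iff_continuous_domRestrict.mpr ?_).continuousAt (hV.mem_nhds hU)
    have e : V.domRestrict (fun x => H.comp ⟨_, _, (key x (p x) (hp x)).choose⟩) =
        fun y : V => H.comp ⟨_, _, (key y.1 (σ ⟨_, y.2⟩) (hσ _)).choose⟩ := by
      funext y
      have := inj (a₁ := ⟨y.1.fst, _, (key y.1 (p y.1) (hp y.1)).choose_spec.choose⟩)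
        (a₂ := ⟨y.1.fst, _, (key y.1 (σ ⟨_, y.2⟩) (hσ _)).choose_spec.choose⟩)
        (FiberProd.ext rfl ((key y.1 (p y.1) (hp y.1)).choose_spec.choose_spec.trans
          (key y.1 (σ ⟨_, y.2⟩) (hσ _)).choose_spec.choose_spec.symm))
      exact congrArg FiberProd.snd this
    refine Eq.mpr (congrArg Continuous e) ?_
    have h₁ : Continuous fun y : V => y.1.fst :=
      FiberProd.continuous_fst.comp continuous_subtype_val
    have h₂ : Continuous fun y : V => y.1.snd :=
      FiberProd.continuous_snd.comp continuous_subtype_val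
    have h₃ : ∀ y : V, P.assocProj φ y.1.snd ∈ U := fun y => y.1.w ▸ y.2
    refine H.comp.continuous.comp (FiberProd.continuous_of ?_ ?_)
    · exact H.inv.continuous.comp (P.continuous_assocCoord σ hσ h₁ fun y => y.2)
    · refine (P.continuous_assocCoord σ hσ h₂ h₃).congr fun y => ?_
      have : σ ⟨_, h₃ y⟩ = σ ⟨_, y.2⟩ := congrArg σ (Subtype.ext y.1.w.symm)
      simp only [this]

variable (φ)

/-- The principal `H`-bundle `(P ×_N H₁) / G` associated with a principal `G`-bundle `P` and a
morphism of topological groupoids `φ : G → H` : the composite of `P` with the bibundle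
defined by `φ`. -/
noncomputable def assoc : PrincipalBundle H X where
  total := CGTop.of (P.Assoc φ)
  proj := P.assocProj φ
  admitsLocalSections := by
    intro y
    obtain ⟨U, hU, σ, hσ⟩ := P.admitsLocalSections y
    refine ⟨U, hU, ⟨fun v => P.assocMk φ ⟨σ v, H.one (φ.obj (P.anchor (σ v))),
      (H.tgt_one _).symm⟩, ?_⟩, hσ⟩
    refine (P.assocMk φ).continuous.comp (FiberProd.continuous_of σ.continuous ?_)
    exact H.one.continuous.comp (φ.obj.continuous.comp (P.anchor.continuous.comp σ.continuous))
  anchor := P.assocAnchor φ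
  act := ⟨P.assocActFun φ, P.continuous_assocActFun⟩
  anchor_act := by
    rintro ⟨q, h, w⟩
    induction q using Quotient.inductionOn with
    | h y =>
      exact (congrArg (P.assocAnchor φ) (P.assocActFun_mk y.fst y.snd h y.w w)).trans
        (H.src_comp _)
  act_one := by
    intro q
    induction q using Quotient.inductionOn with
    | h y =>
      refine (P.assocActFun_mk y.fst y.snd _ y.w (H.tgt_one _).symm).trans ?_
      exact congrArg (P.assocMk φ) (FiberProd.ext rfl (H.comp_one y.snd))
  act_act := by
    intro q g h w₁ w₂
    induction q using Quotient.inductionOn with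
    | h y =>
      have e := P.assocActFun_mk y.fst y.snd g y.w w₁
      change P.assocActFun φ ⟨P.assocActFun φ ⟨P.assocMk φ y, g, w₁⟩, h, _⟩ =
        P.assocActFun φ ⟨P.assocMk φ y, H.comp ⟨g, h, w₂⟩, _⟩
      refine Eq.trans (P.assocActFun_congr e _ ((H.src_comp ⟨y.snd, g, w₁⟩).trans w₂)) ?_
      refine Eq.trans (P.assocActFun_mk y.fst (H.comp ⟨y.snd, g, w₁⟩) h
        (y.w.trans (H.tgt_comp ⟨y.snd, g, w₁⟩).symm)
        ((H.src_comp ⟨y.snd, g, w₁⟩).trans w₂)) ?_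
      refine Eq.trans ?_ (P.assocActFun_mk y.fst y.snd _ y.w
        (w₁.trans (H.tgt_comp ⟨g, h, w₂⟩).symm)).symm
      exact congrArg (P.assocMk φ) (FiberProd.ext rfl (H.assoc y.snd g h w₁ w₂))
  proj_act := P.assocProj_act
  principal := P.assocPrincipal

end PrincipalBundle

/-- The map `(p, δ) ↦ (F p, δ)`. -/
def BHom.preAssoc {M N : CGTop.{u}} {G : TopGroupoid M} {H : TopGroupoid N}
    (φ : G.Hom H) {P Q : BObj G} (F : BHom P Q) :
    C(P.bundle.PreAssoc φ, Q.bundle.PreAssoc φ) where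
  toFun x := ⟨F.map x.fst, x.snd, (congrArg φ.obj (F.anchor_map x.fst)).trans x.w⟩
  continuous_toFun := FiberProd.continuous_of
    (F.map.continuous.comp FiberProd.continuous_fst) FiberProd.continuous_snd

/-- The map of associated bundles induced by a map of principal bundles:
`[p, δ] ↦ [F p, δ]`. -/
noncomputable def BHom.assoc {M N : CGTop.{u}} {G : TopGroupoid M} {H : TopGroupoid N}
    (φ : G.Hom H) {P Q : BObj G} (F : BHom P Q) :
    BHom (⟨P.base, P.bundle.assoc φ⟩ : BObj H) ⟨Q.base, Q.bundle.assoc φ⟩ where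
  map :=
    { toFun := Quotient.map (BHom.preAssoc φ F) (by
        rintro x y ⟨γ, w, w', e₁, e₂⟩
        exact ⟨γ, (F.anchor_map _).trans w, w',
          (congrArg F.map e₁).trans (F.map_act ⟨x.fst, γ, w⟩), e₂⟩)
      continuous_toFun := (BHom.preAssoc φ F).continuous.quotient_map' _ }
  base := F.base
  anchor_map := by
    intro q
    induction q using Quotient.inductionOn with
    | h y => rfl
  map_act := by
    rintro ⟨q, h, w⟩
    induction q using Quotient.inductionOn with
    | h y =>
      refine Eq.trans (congrArg _ (P.bundle.assocActFun_mk y.fst y.snd h y.w w)) ?_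
      exact (Q.bundle.assocActFun_mk (F.map y.fst) y.snd h
        ((congrArg φ.obj (F.anchor_map y.fst)).trans y.w) w).symm
  proj_map := by
    intro q
    induction q using Quotient.inductionOn with
    | h y => exact F.proj_map y.fst

/-- The morphism `BG → BH` associated with a morphism of topological groupoids `φ : G → H`. -/
noncomputable def TopGroupoid.Hom.mapB {M N : CGTop.{u}} {G : TopGroupoid M}
    {H : TopGroupoid N} (φ : G.Hom H) : BasedFunctor G.B H.B where
  obj P := (⟨P.base, P.bundle.assoc φ⟩ : BObj H)
  map F := BHom.assoc φ F
  map_id P := BHom.ext (ContinuousMap.ext fun q => by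
    induction q using Quotient.inductionOn with
    | h y => rfl) rfl
  map_comp F F' := BHom.ext (ContinuousMap.ext fun q => by
    induction q using Quotient.inductionOn with
    | h y => rfl) rfl
  w := rfl

/-! # Stacks over `CGTop` -/

theorem TopologicalSpace.Opens.isOpenEmbedding_coe {X : Type u} [TopologicalSpace X]
    (U : Opens X) : IsOpenEmbedding (Subtype.val : U → X) := U.2.isOpenEmbedding_subtypeVal

/-- The open-cover topology: a sieve on `X` is covering if it contains a jointly surjective
family of open embeddings. -/
def openCoverTopology : GrothendieckTopology CGTop.{u} where
  sieves X := {S | ∀ x : X, ∃ (V : CGTop.{u}) (i : V ⟶ X) (v : V),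
    S i ∧ IsOpenEmbedding (i : C(V, X)) ∧ (i : C(V, X)) v = x}
  top_mem' X x := ⟨X, 𝟙 X, x, trivial, IsOpenEmbedding.id, rfl⟩
  pullback_stable' := by
    intro X Y S f hS y
    obtain ⟨V, i, v, hi, hio, hv⟩ := hS ((f : C(Y, X)) y)
    let W : Opens Y := ⟨(f : C(Y, X)) ⁻¹' Set.range (i : C(V, X)),
      hio.isOpen_range.preimage (f : C(Y, X)).continuous⟩
    let j : CGTop.of W ⟶ Y := (⟨Subtype.val, continuous_subtype_val⟩ : C(W, Y))
    choose k hk using fun w : W => w.2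
    let l : CGTop.of W ⟶ V := (⟨k, by
      rw [hio.continuous_iff]
      exact ((f : C(Y, X)).continuous.comp continuous_subtype_val).congr
        fun w => (hk w).symm⟩ : C(W, V))
    have e : l ≫ i = j ≫ f := ContinuousMap.ext fun w => hk w
    refine ⟨_, j, ⟨y, v, hv⟩, ?_, W.2.isOpenEmbedding_subtypeVal, rfl⟩
    change S (j ≫ f)
    rw [← e]
    exact S.downward_closed hi l
  transitive' := by
    intro X S hS R hR x
    obtain ⟨V, i, v, hi, hio, hv⟩ := hS x
    obtain ⟨W, j, w, hj, hjo, hw⟩ := hR hi v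
    exact ⟨W, j ≫ i, w, hj, hio.comp hjo, (congrArg (i : C(V, X)) hw).trans hv⟩

/-- Categories over `CGTop`. -/
abbrev OverCG := BasedCategory.{u, u + 1} CGTop.{u}

/-- The category `CGTop / U`, fibred over `CGTop`, associated with the space `U`. -/
def underline (U : CGTop.{u}) : OverCG.{u} := BasedCategory.ofFunctor (Over.forget U)

/-- The morphism `V → U` of fibred categories associated with a continuous map. -/
def underlineMap {V U : CGTop.{u}} (σ : V ⟶ U) : BasedFunctor (underline V) (underline U) where
  toFunctor := Over.map σ
  w := Over.mapForget_eq σ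

/-- A sieve on `U`, regarded as a category fibred over `CGTop`. -/
def sieveCat {U : CGTop.{u}} (S : Sieve U) : OverCG.{u} :=
  BasedCategory.ofFunctor S.arrows.diagram

/-- The inclusion of a sieve on `U` in `CGTop / U`. -/
def sieveIncl {U : CGTop.{u}} (S : Sieve U) : BasedFunctor (sieveCat S) (underline U) where
  toFunctor := ObjectProperty.ι _
  w := rfl

/-- Restriction along the inclusion of a sieve `S` on `U`, from (`2`-Yoneda) objects of `D`
over `U` to descent data for `D` relative to `S`. -/
def restrictToSieve (D : OverCG.{u}) {U : CGTop.{u}} (S : Sieve U) :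
    BasedFunctor (underline U) D ⥤ BasedFunctor (sieveCat S) D where
  obj q := (sieveIncl S).comp q
  map α := BasedCategory.whiskerLeft (sieveIncl S) α

/-- `D` is fibred in groupoids: it is fibred, and every morphism in a fibre is invertible. -/
def IsFiberedInGroupoids (D : OverCG.{u}) : Prop :=
  D.p.IsFibered ∧ ∀ (S : CGTop.{u}) {a b : D.obj} (f : a ⟶ b),
    D.p.IsHomLift (𝟙 S) f → IsIso f

/-- A stack (in groupoids) over `CGTop` with the open-cover topology: for every covering sieve
`S` of a space `U`, the functor from objects over `U` to descent data relative to `S` is an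
equivalence of categories. -/
def IsStack (D : OverCG.{u}) : Prop :=
  IsFiberedInGroupoids D ∧
    ∀ (U : CGTop.{u}), ∀ S ∈ openCoverTopology U, (restrictToSieve D S).IsEquivalence

/-- A presentation of `D` by the topological groupoid `G`: an equivalence `BG → D` over `CGTop`. -/
def IsPresentedBy (D : OverCG.{u}) {M : CGTop.{u}} (G : TopGroupoid M) : Prop :=
  ∃ F : BasedFunctor G.B D, F.toFunctor.IsEquivalence

/-- Topological stacks. -/
def IsTopologicalStack (D : OverCG.{u}) : Prop :=
  IsStack D ∧ ∃ (M : CGTop.{u}) (G : TopGroupoid M), IsPresentedBy D G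

/-- Hurewicz stacks: topological stacks presented by a groupoid whose source map is locally a
Hurewicz fibration. -/
def IsHurewiczStack (D : OverCG.{u}) : Prop :=
  IsStack D ∧ ∃ (M : CGTop.{u}) (G : TopGroupoid M),
    IsLocallyHurewiczFibration G.src ∧ IsPresentedBy D G

/-- Serre stacks: topological stacks presented by a groupoid whose source map is locally a
Serre fibration. -/
def IsSerreStack (D : OverCG.{u}) : Prop :=
  IsStack D ∧ ∃ (M : CGTop.{u}) (G : TopGroupoid M),
    IsLocallySerreFibration G.src ∧ IsPresentedBy D G

/-! # `2`-fibre products -/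

section TwoFiberProduct

variable {X Y Z : OverCG.{u}} (F : BasedFunctor Y X) (G : BasedFunctor Z X)

/-- Objects of the `2`-fibre product `Y ×_X Z`: triples `(y, z, α)` with `y` and `z` over the
same space and `α : F y ≅ G z` an isomorphism in the fibre over this space. -/
structure TwoFiberObj : Type (u + 1) where
  fst : Y.obj
  snd : Z.obj
  base_eq : Y.p.obj fst = Z.p.obj snd
  iso : F.obj fst ≅ G.obj snd
  isHomLift : X.p.IsHomLift (𝟙 (Y.p.obj fst)) iso.hom

variable {F G}

/-- Morphisms of the `2`-fibre product: pairs of morphisms over the same map of spaces which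
are compatible with the given isomorphisms. -/
@[ext]
structure TwoFiberHom (a b : TwoFiberObj F G) : Type u where
  fst : a.fst ⟶ b.fst
  snd : a.snd ⟶ b.snd
  isHomLift : Z.p.IsHomLift (Y.p.map fst) snd
  comm : F.map fst ≫ b.iso.hom = a.iso.hom ≫ G.map snd

instance : Category.{u} (TwoFiberObj F G) where
  Hom := TwoFiberHom
  id a :=
    { fst := 𝟙 _
      snd := 𝟙 _
      isHomLift := by
        rw [CategoryTheory.Functor.map_id]
        exact IsHomLift.id a.base_eq.symm
      comm := by simp }
  comp f g :=
    { fst := f.fst ≫ g.fst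
      snd := f.snd ≫ g.snd
      isHomLift := by
        have := f.isHomLift
        have := g.isHomLift
        rw [CategoryTheory.Functor.map_comp]
        infer_instance
      comm := by rw [CategoryTheory.Functor.map_comp, CategoryTheory.Functor.map_comp, Category.assoc, g.comm,
        ← Category.assoc, f.comm, Category.assoc] }
  id_comp f := TwoFiberHom.ext (Category.id_comp _) (Category.id_comp _)
  comp_id f := TwoFiberHom.ext (Category.comp_id _) (Category.comp_id _)
  assoc f g h := TwoFiberHom.ext (Category.assoc _ _ _) (Category.assoc _ _ _)

variable (F G)

/-- The `2`-fibre product `Y ×_X Z`. -/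
def twoFiberProduct : OverCG.{u} where
  obj := TwoFiberObj F G
  p :=
    { obj := fun a => Y.p.obj a.fst
      map := fun f => Y.p.map (TwoFiberHom.fst f)
      map_id := fun _ => Y.p.map_id _
      map_comp := fun _ _ => Y.p.map_comp _ _ }

/-- The diagonal `Y → Y ×_X Y` of a morphism `F : Y → X`. -/
def twoFiberDiagonal : BasedFunctor Y (twoFiberProduct F F) where
  obj y := (⟨y, y, rfl, Iso.refl _, IsHomLift.id (F.w_obj y)⟩ : TwoFiberObj F F)
  map f := (⟨f, f, inferInstance, by simp⟩ : TwoFiberHom _ _)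
  map_id _ := rfl
  map_comp _ _ := rfl
  w := rfl

end TwoFiberProduct

/-! # Gerbes, Hurewicz and Serre morphisms -/

/-- Epimorphisms: every morphism from a space `U` to `C` lifts, locally on `U` and up to a
`2`-isomorphism, to `D`. -/
def IsEpimorphism {D C : OverCG.{u}} (F : BasedFunctor D C) : Prop :=
  ∀ (U : CGTop.{u}) (q : BasedFunctor (underline U) C),
    ∃ (ι : Type u) (V : ι → CGTop.{u}) (σ : ∀ i, V i ⟶ U),
      (∀ i, IsOpenEmbedding (σ i : C(V i, U))) ∧
      (∀ x : U, ∃ (i : ι) (v : V i), (σ i : C(V i, U)) v = x) ∧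
      ∀ i, ∃ r : BasedFunctor (underline (V i)) D,
        Nonempty (BasedFunctor.comp r F ≅ BasedFunctor.comp (underlineMap (σ i)) q)

/-- A gerbe over a topological stack: a morphism of topological stacks which is an epimorphism
and whose diagonal is an epimorphism. -/
structure IsGerbe {D C : OverCG.{u}} (F : BasedFunctor D C) : Prop where
  source : IsTopologicalStack D
  target : IsTopologicalStack C
  epi : IsEpimorphism F
  diagonal_epi : IsEpimorphism (twoFiberDiagonal F)

/-- Hurewicz morphisms: the `2`-fibre product with every space is a Hurewicz stack. -/
def IsHurewiczMorphism {D C : OverCG.{u}} (F : BasedFunctor D C) : Prop :=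
  ∀ (U : CGTop.{u}) (q : BasedFunctor (underline U) C), IsHurewiczStack (twoFiberProduct F q)

/-- Serre morphisms: the `2`-fibre product with every space is a Serre stack. -/
def IsSerreMorphism {D C : OverCG.{u}} (F : BasedFunctor D C) : Prop :=
  ∀ (U : CGTop.{u}) (q : BasedFunctor (underline U) C), IsSerreStack (twoFiberProduct F q)

/-- Hurewicz gerbes. -/
def IsHurewiczGerbe {D C : OverCG.{u}} (F : BasedFunctor D C) : Prop :=
  IsGerbe F ∧ IsHurewiczMorphism F

/-- Serre gerbes. -/
def IsSerreGerbe {D C : OverCG.{u}} (F : BasedFunctor D C) : Prop :=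
  IsGerbe F ∧ IsSerreMorphism F

/-!
# Groupoid extensions induce Hurewicz and Serre gerbes

Every morphism of principal bundles is cartesian (`BHom.existsUnique_factor`), so that a morphism
over an open embedding is an open embedding of total spaces. This makes `BG` a stack: given a
descent datum relative to a covering sieve of `U`, the glued bundle is, as a set, the disjoint union
of the bundles over the points of `U`, which are themselves members of the sieve; it carries the
topology glued from the bundles over the open members (`DescentDatum.glueBundle`,
`restrictToSieve_isEquivalence`).

Let `φ : G → H` be an extension with object space `M`. Giving a morphism from the `H`-bundle
associated with a `G`-bundle `P` to an `H`-bundle `Q` is the same as giving a `φ`-equivariant map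
`P → Q` (`BHom.exists_of_equivariant`, `BHom.assoc_ext`). Since an `H`-bundle is locally trivial
and `φ` is the identity on objects, it is locally associated with a trivial `G`-bundle, and
`BG → BH` is an epimorphism (`isEpimorphism_mapB`). For the diagonal, an isomorphism between the
`H`-bundles associated with two `G`-bundles compares two local sections of these by a map to the
arrows of `H`; this map lifts locally to the arrows of `G`, and after correction by the lift the two
sections match (`exists_matching_sections`, `isEpimorphism_diagonal`).

Finally, let `U → BH` classify the `H`-bundle `Q`. An object of the `2`-fibre product of `BG` and
`U` is a `G`-bundle with an equivariant map to `Q`, that is, a principal bundle for the action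
groupoid of `G` on the total space of `Q`; hence the `2`-fibre product is presented by this groupoid
(`isPresentedBy_twoFiberProduct`), and it is a stack because being a stack is invariant under
equivalence (`isStack_of_isEquivalence`). An arrow `(e, g)` of the action groupoid is determined by
its source `e · g` and by `g`, so its source map is the base change of the source map of `G` along
the anchor of `Q`. It therefore inherits local homotopy lifting
(`RightSpace.isLocallyHurewiczFibration_src`, `RightSpace.isLocallySerreFibration_src`). For
Hurewicz fibrations this uses that the product of a compactly generated space with the unit
interval is compactly generated, since the lifts take values in fibre products of `CGTop`.
-/

/-! ### Compactly generated spaces -/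

/-- The product of a compactly generated space with a compact Hausdorff space is compactly
generated: open subsets are maps to the Sierpiński space `Prop`, which can be curried. -/
theorem compactlyGeneratedSpace_prod_of_compactSpace {X : Type u} [TopologicalSpace X]
    [CompactlyGeneratedSpace X] {Y : Type} [TopologicalSpace Y] [CompactSpace Y] [T2Space Y] :
    CompactlyGeneratedSpace (X × Y) := by
  refine compactlyGeneratedSpace_of_isOpen fun s hs => ?_
  have hsec : ∀ x, Continuous fun y : Y => ((x, y) ∈ s) := by
    intro x
    have := hs (ULift.{u} Y) (fun y => (x, y.down)) (by fun_prop)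
    rw [continuous_Prop]
    exact this.preimage (continuous_uliftUp (X := Y))
  let c : X → C(Y, Prop) := fun x => ⟨fun y => ((x, y) ∈ s), hsec x⟩
  have hc : Continuous c := by
    refine continuous_from_compactlyGeneratedSpace _ fun K _ _ _ k hk => ?_
    refine ContinuousMap.continuous_of_continuous_uncurry _ ?_
    rw [continuous_Prop]
    have := hs (K × ULift.{u} Y) (fun z => (k z.1, z.2.down)) (by fun_prop)
    exact this.preimage (f := fun z : K × Y => (z.1, ULift.up z.2)) (by fun_prop)
  have := continuous_Prop.mp (ContinuousMap.continuous_uncurry_of_continuous ⟨c, hc⟩)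
  exact this

/-- A version of `FiberProd.continuous_of` for sources in an arbitrary universe, such as cubes,
which live in the lowest one. -/
theorem FiberProd.continuous_of_uLift {X Y Z : CGTop.{u}} {f : C(X, Z)} {g : C(Y, Z)}
    {W : Type*} [TopologicalSpace W] [UCompactlyGeneratedSpace.{u} W]
    {h : W → FiberProd f g} (h₁ : Continuous fun x => (h x).fst)
    (h₂ : Continuous fun x => (h x).snd) : Continuous h := by
  refine continuous_from_uCompactlyGeneratedSpace _ fun S k => ?_
  have aux (K : Type u) [TopologicalSpace K] [CompactSpace K] [T2Space K] (k : C(K, W)) :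
      Continuous (h ∘ k) :=
    FiberProd.continuous_of (h₁.comp k.continuous) (h₂.comp k.continuous)
  exact @aux S _ _ _ k

section

variable {X Y Z : CGTop.{u}} {f : C(X, Z)} {g : C(Y, Z)} {W : Type*} [TopologicalSpace W]

theorem Continuous.fiberFst {h : W → FiberProd f g} (hh : Continuous h) :
    Continuous fun x => (h x).fst := FiberProd.continuous_fst.comp hh

theorem Continuous.fiberSnd {h : W → FiberProd f g} (hh : Continuous h) :
    Continuous fun x => (h x).snd := FiberProd.continuous_snd.comp hh

theorem Continuous.fiberMk {W : Type u} [TopologicalSpace W] [CompactlyGeneratedSpace W]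
    {a : W → X} {b : W → Y} (ha : Continuous a) (hb : Continuous b) (w : ∀ x, f (a x) = g (b x)) :
    Continuous fun x => (⟨a x, b x, w x⟩ : FiberProd f g) :=
  FiberProd.continuous_of ha hb

end

theorem continuous_of_locally {X Y : Type*} [TopologicalSpace X] [TopologicalSpace Y] {f : X → Y}
    (h : ∀ x, ∃ V : Opens X, x ∈ V ∧ Continuous fun v : V => f v) : Continuous f := by
  rw [continuous_iff_continuousAt]
  intro x
  obtain ⟨V, hx, hV⟩ := h x
  exact (continuousOn_iff_continuous_domRestrict.mpr hV).continuousAt (V.2.mem_nhds hx)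

theorem AdmitsLocalSections.surjective {X Y : Type u} [TopologicalSpace X] [TopologicalSpace Y]
    {f : C(X, Y)} (h : AdmitsLocalSections f) : Function.Surjective f := fun y => by
  obtain ⟨U, hU, σ, hσ⟩ := h y
  exact ⟨_, hσ ⟨y, hU⟩⟩

/-- Continuity may be tested after composition with a map that admits local sections. -/
theorem AdmitsLocalSections.continuous_of_comp {X Y Z : Type u} [TopologicalSpace X]
    [TopologicalSpace Y] [TopologicalSpace Z] {f : C(X, Y)} (h : AdmitsLocalSections f) {g : Y → Z}
    (hg : Continuous fun x => g (f x)) : Continuous g := by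
  refine continuous_of_locally fun y => ?_
  obtain ⟨U, hU, σ, hσ⟩ := h y
  refine ⟨U, hU, (hg.comp σ.continuous).congr fun v => ?_⟩
  change g (f (σ v)) = g v
  rw [hσ]

/-- An injective continuous map onto an open set with continuous inverse is an open embedding. -/
theorem isOpenEmbedding_of_inverse {X Y : Type*} [TopologicalSpace X] [TopologicalSpace Y]
    {f : X → Y} (hf : Continuous f) (inj : Function.Injective f) {W : Set Y} (hW : IsOpen W)
    {l : W → X} (hl : Continuous l) (hfW : ∀ x, f x ∈ W) (h : ∀ w, f (l w) = w) :
    IsOpenEmbedding f := by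
  refine .of_continuous_injective_isOpenMap hf inj fun O hO => ?_
  have : f '' O = Subtype.val '' (l ⁻¹' O) := by
    ext y
    constructor
    · rintro ⟨x, hx, rfl⟩
      refine ⟨⟨f x, hfW x⟩, ?_, rfl⟩
      have : l ⟨f x, hfW x⟩ = x := inj (h _)
      change l _ ∈ O
      rwa [this]
    · rintro ⟨w, hw, rfl⟩
      exact ⟨l w, hw, h w⟩
  rw [this]
  exact hW.isOpenMap_subtype_val _ (hO.preimage hl)

/-- Open embeddings are stable under base change. -/
theorem FiberProd.isOpenEmbedding_fst {X Y Z : CGTop.{u}} {f : C(X, Z)} {g : C(Y, Z)}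
    (hg : IsOpenEmbedding g) : IsOpenEmbedding (FiberProd.fst : FiberProd f g → X) := by
  let W : Set X := f ⁻¹' Set.range g
  choose b hb using fun w : W => w.2
  have hbc : Continuous b := by
    rw [hg.continuous_iff]
    exact (f.continuous.comp continuous_subtype_val).congr fun w => (hb w).symm
  have hW : IsOpen W := hg.isOpen_range.preimage f.continuous
  have := hW.compactlyGeneratedSpace_subtype
  refine isOpenEmbedding_of_inverse FiberProd.continuous_fst
    (fun x y h => FiberProd.ext h (hg.injective ?_)) hW
    (l := fun w => ⟨w.1, b w, (hb w).symm⟩) (continuous_subtype_val.fiberMk hbc _)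
    (fun x => ⟨x.snd, x.w.symm⟩) fun w => rfl
  rw [← x.w, ← y.w, h]

/-! ### Principal bundles and their morphisms -/

namespace PrincipalBundle

variable {M X Y : CGTop.{u}} {G : TopGroupoid M} (P : PrincipalBundle G X)

theorem proj_surjective : Function.Surjective P.proj := P.admitsLocalSections.surjective

/-- The principality condition follows from the existence of a continuous division map. -/
theorem isHomeomorph_of_div {T : CGTop.{u}} {proj : C(T, X)} {anchor : C(T, M)}
    {act : C(FiberProd anchor G.tgt, T)} (proj_act : ∀ x, proj (act x) = proj x.fst)
    (d : C(FiberProd proj proj, G.Arr)) (tgt_d : ∀ x, anchor x.fst = G.tgt (d x))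
    (act_d : ∀ x, act ⟨x.fst, d x, tgt_d x⟩ = x.snd)
    (d_act : ∀ x, d ⟨x.fst, act x, (proj_act x).symm⟩ = x.snd) :
    IsHomeomorph (fun x : FiberProd anchor G.tgt =>
      (⟨x.fst, act x, (proj_act x).symm⟩ : FiberProd proj proj)) := by
  rw [isHomeomorph_iff_exists_inverse]
  refine ⟨FiberProd.continuous_of FiberProd.continuous_fst act.continuous,
    fun x => ⟨x.fst, d x, tgt_d x⟩, ?_, ?_, FiberProd.continuous_of FiberProd.continuous_fst
      d.continuous⟩
  · exact fun x => FiberProd.ext rfl (d_act x)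
  · exact fun x => FiberProd.ext rfl (act_d x)

/-- The pullback of a principal bundle along a continuous map. -/
noncomputable def pullback (f : C(Y, X)) : PrincipalBundle G Y where
  total := CGTop.of (FiberProd f P.proj)
  proj := ⟨FiberProd.fst, FiberProd.continuous_fst⟩
  admitsLocalSections y := by
    obtain ⟨U, hU, σ, hσ⟩ := P.admitsLocalSections (f y)
    let V : Opens Y := ⟨f ⁻¹' U, U.2.preimage f.continuous⟩
    let τ : V → FiberProd f P.proj := fun v => ⟨v.1, σ ⟨f v, v.2⟩, (hσ ⟨f v, v.2⟩).symm⟩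
    refine ⟨V, hU, ⟨τ, FiberProd.continuous_of continuous_subtype_val ?_⟩, fun v => rfl⟩
    exact σ.continuous.comp ((f.continuous.comp continuous_subtype_val).subtype_mk _)
  anchor := P.anchor.comp ⟨FiberProd.snd, FiberProd.continuous_snd⟩
  act := ⟨fun x => ⟨x.fst.fst, P.act ⟨x.fst.snd, x.snd, x.w⟩,
    x.fst.w.trans (P.proj_act ⟨x.fst.snd, x.snd, x.w⟩).symm⟩,
    continuous_id.fiberFst.fiberFst.fiberMk (P.act.continuous.comp
      (continuous_id.fiberFst.fiberSnd.fiberMk continuous_id.fiberSnd _)) _⟩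
  anchor_act x := P.anchor_act _
  act_one p := FiberProd.ext rfl (P.act_one p.snd)
  act_act p g h w₁ w₂ := FiberProd.ext rfl (P.act_act p.snd g h w₁ w₂)
  proj_act x := rfl
  principal := by
    refine isHomeomorph_of_div (T := CGTop.of (FiberProd f P.proj)) (G := G) (fun x => rfl)
      ⟨fun x => P.div ⟨x.fst.snd, x.snd.snd, x.fst.w.symm.trans ((congrArg f x.w).trans x.snd.w)⟩,
        P.div.continuous.comp (continuous_id.fiberFst.fiberSnd.fiberMk
          continuous_id.fiberSnd.fiberSnd _)⟩ ?_ ?_ ?_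
    · exact fun x => P.tgt_div ⟨x.fst.snd, x.snd.snd, _⟩
    · exact fun x => FiberProd.ext x.w (P.act_div ⟨x.fst.snd, x.snd.snd, _⟩)
    · exact fun x => P.div_eq _ _ rfl

/-- The unit principal bundle: `G` acting on its arrows by right composition. -/
noncomputable def unit (G : TopGroupoid M) : PrincipalBundle G M where
  total := G.Arr
  proj := G.tgt
  admitsLocalSections x := ⟨⊤, trivial, G.one.comp ⟨Subtype.val, continuous_subtype_val⟩,
    fun v => G.tgt_one v⟩
  anchor := G.src
  act := G.comp
  anchor_act := G.src_comp
  act_one := G.comp_one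
  act_act := G.assoc
  proj_act := G.tgt_comp
  principal := by
    refine isHomeomorph_of_div (G := G) G.tgt_comp
      ⟨fun x => G.comp ⟨G.inv x.fst, x.snd, (G.src_inv _).trans x.w⟩,
        G.comp.continuous.comp (FiberProd.continuous_of
          (G.inv.continuous.comp FiberProd.continuous_fst) FiberProd.continuous_snd)⟩ ?_ ?_ ?_
    · exact fun x => ((G.tgt_comp _).trans (G.tgt_inv _)).symm
    · exact fun x => G.comp_inv_cancel ((G.src_inv _).trans x.w) _
    · exact fun x => G.inv_comp_cancel x.w _

end PrincipalBundle

namespace BHom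

variable {M : CGTop.{u}} {G : TopGroupoid M} {P Q R : BObj G}

/-- A morphism of principal bundles is determined by its map of total spaces. -/
theorem ext_map {F F' : BHom P Q} (h : ∀ p, F.map p = F'.map p) : F = F' := by
  refine BHom.ext (ContinuousMap.ext h) (ContinuousMap.ext fun x => ?_)
  obtain ⟨p, rfl⟩ := P.bundle.proj_surjective x
  rw [← F.proj_map, ← F'.proj_map, h]

/-- A morphism of principal bundles is injective on fibres. -/
theorem map_injective (F : BHom P Q) {p p' : P.bundle.total}
    (h : P.bundle.proj p = P.bundle.proj p') (e : F.map p = F.map p') : p = p' := by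
  have h₁ := P.bundle.act_div ⟨p, p', h⟩
  have h₂ := (F.map_act ⟨p, _, P.bundle.tgt_div ⟨p, p', h⟩⟩).symm.trans
    ((congrArg F.map h₁).trans e.symm)
  have h₃ : P.bundle.div ⟨p, p', h⟩ = G.one (P.bundle.anchor p) := by
    refine Q.bundle.act_inj (p := F.map p) ((F.anchor_map p).trans (P.bundle.tgt_div ⟨p, p', h⟩))
      ((F.anchor_map p).trans (G.tgt_one _).symm) (h₂.trans ?_)
    refine (Q.bundle.act_one _).symm.trans ?_
    exact Q.bundle.act_congr rfl (congrArg G.one (F.anchor_map p)) _ _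
  rw [← P.bundle.act_one p]
  exact (P.bundle.act_congr rfl h₃.symm _ _).trans h₁

/-- A morphism of principal bundles is surjective on fibres. -/
theorem exists_lift (F : BHom P Q) (x : FiberProd F.base Q.bundle.proj) :
    ∃ p, P.bundle.proj p = x.fst ∧ F.map p = x.snd := by
  obtain ⟨p, hp⟩ := P.bundle.proj_surjective x.fst
  have h : Q.bundle.proj (F.map p) = Q.bundle.proj x.snd := by rw [F.proj_map, hp, x.w]
  have w : P.bundle.anchor p = G.tgt (Q.bundle.div ⟨_, _, h⟩) :=
    (F.anchor_map p).symm.trans (Q.bundle.tgt_div ⟨_, _, h⟩)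
  exact ⟨P.bundle.act ⟨p, _, w⟩, (P.bundle.proj_act _).trans hp,
    (F.map_act ⟨p, _, w⟩).trans (Q.bundle.act_div ⟨_, _, h⟩)⟩

/-- The inverse of the comparison map from the total space of the source of a morphism of principal
bundles to the pullback of the total space of the target. It is continuous because, near a point, it
is given by a local section of the source and the division map of the target. -/
noncomputable def lift (F : BHom P Q) : C(FiberProd F.base Q.bundle.proj, P.bundle.total) where
  toFun x := (F.exists_lift x).choose
  continuous_toFun := by
    refine continuous_of_locally fun x => ?_
    obtain ⟨U, hU, σ, hσ⟩ := P.bundle.admitsLocalSections x.fst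
    let V : Opens (FiberProd F.base Q.bundle.proj) :=
      ⟨FiberProd.fst ⁻¹' U, U.2.preimage FiberProd.continuous_fst⟩
    refine ⟨V, hU, ?_⟩
    let s : V → P.bundle.total := fun v => σ ⟨v.1.fst, v.2⟩
    have hs : Continuous s := σ.continuous.comp
      ((FiberProd.continuous_fst.comp continuous_subtype_val).subtype_mk _)
    have hps (v : V) : P.bundle.proj (s v) = v.1.fst := hσ _
    have h (v : V) : Q.bundle.proj (F.map (s v)) = Q.bundle.proj v.1.snd := by
      rw [F.proj_map, hps, v.1.w]
    have w (v : V) : P.bundle.anchor (s v) = G.tgt (Q.bundle.div ⟨_, _, h v⟩) :=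
      (F.anchor_map _).symm.trans (Q.bundle.tgt_div ⟨_, _, h v⟩)
    have hc : Continuous fun v : V => P.bundle.act ⟨s v, _, w v⟩ := by
      exact P.bundle.act.continuous.comp (hs.fiberMk (Q.bundle.div.continuous.comp
        ((F.map.continuous.comp hs).fiberMk continuous_subtype_val.fiberSnd _)) _)
    refine hc.congr fun v => ?_
    have hv := (F.exists_lift v.1).choose_spec
    refine F.map_injective ?_ ?_
    · exact ((P.bundle.proj_act _).trans (hps v)).trans hv.1.symm
    · exact ((F.map_act ⟨s v, _, w v⟩).trans (Q.bundle.act_div ⟨_, _, h v⟩)).trans hv.2.symm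

theorem proj_lift (F : BHom P Q) (x : FiberProd F.base Q.bundle.proj) :
    P.bundle.proj (F.lift x) = x.fst := (F.exists_lift x).choose_spec.1

theorem map_lift (F : BHom P Q) (x : FiberProd F.base Q.bundle.proj) :
    F.map (F.lift x) = x.snd := (F.exists_lift x).choose_spec.2

/-- A morphism of principal bundles over an open embedding is an open embedding. -/
theorem isOpenEmbedding_map (F : BHom P Q) (hF : IsOpenEmbedding F.base) :
    IsOpenEmbedding F.map := by
  have hinj : Function.Injective F.map := fun p p' e => by
    refine F.map_injective (hF.injective ?_) e
    rw [← F.proj_map, ← F.proj_map, e]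
  let W : Set Q.bundle.total := Q.bundle.proj ⁻¹' Set.range F.base
  choose b hb using fun w : W => w.2
  have hbc : Continuous b := by
    rw [hF.continuous_iff]
    exact (Q.bundle.proj.continuous.comp continuous_subtype_val).congr fun w => (hb w).symm
  have hW : IsOpen W := hF.isOpen_range.preimage Q.bundle.proj.continuous
  have := hW.compactlyGeneratedSpace_subtype
  exact isOpenEmbedding_of_inverse F.map.continuous hinj hW
    (l := fun w => F.lift ⟨b w, w.1, hb w⟩)
    (F.lift.continuous.comp (hbc.fiberMk continuous_subtype_val _))
    (fun p => ⟨P.bundle.proj p, (F.proj_map p).symm⟩) fun w => F.map_lift _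

/-- A map of total spaces which respects the anchors and the actions is a morphism of principal
bundles, for a unique map of the bases. -/
theorem exists_of_map (m : C(P.bundle.total, Q.bundle.total))
    (anchor_map : ∀ p, Q.bundle.anchor (m p) = P.bundle.anchor p)
    (map_act : ∀ x : FiberProd P.bundle.anchor G.tgt, m (P.bundle.act x) =
      Q.bundle.act ⟨m x.fst, x.snd, (anchor_map _).trans x.w⟩) :
    ∃ F : BHom P Q, F.map = m := by
  -- The fibres are the orbits, so that `m` maps fibres to fibres.
  choose s hs using P.bundle.proj_surjective
  have key : ∀ p, Q.bundle.proj (m p) = Q.bundle.proj (m (s (P.bundle.proj p))) := fun p => by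
    have h : P.bundle.proj (s (P.bundle.proj p)) = P.bundle.proj p := hs _
    refine (congrArg (fun z => Q.bundle.proj (m z)) (P.bundle.act_div ⟨_, _, h⟩)).symm.trans ?_
    rw [map_act, Q.bundle.proj_act]
  refine ⟨⟨m, ⟨fun x => Q.bundle.proj (m (s x)), ?_⟩, anchor_map, map_act, key⟩, rfl⟩
  exact P.bundle.admitsLocalSections.continuous_of_comp
    ((Q.bundle.proj.continuous.comp m.continuous).congr key)

/-- Morphisms of principal bundles are cartesian. -/
theorem existsUnique_factor (F : BHom Q R) (F' : BHom P R) (g : C(P.base, Q.base))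
    (hg : F.base.comp g = F'.base) :
    ∃! E : BHom P Q, E.base = g ∧ ∀ p, F.map (E.map p) = F'.map p := by
  have w (p : P.bundle.total) : F.base (g (P.bundle.proj p)) = R.bundle.proj (F'.map p) := by
    rw [F'.proj_map, ← hg]; rfl
  let m : C(P.bundle.total, Q.bundle.total) := ⟨fun p => F.lift ⟨_, _, w p⟩,
    F.lift.continuous.comp (FiberProd.continuous_of (g.continuous.comp P.bundle.proj.continuous)
      F'.map.continuous)⟩
  have hm (p) : F.map (m p) = F'.map p := F.map_lift ⟨_, _, w p⟩
  have hpm (p) : Q.bundle.proj (m p) = g (P.bundle.proj p) := F.proj_lift ⟨_, _, w p⟩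
  have am (p) : Q.bundle.anchor (m p) = P.bundle.anchor p := by
    rw [← F.anchor_map, hm, F'.anchor_map]
  refine ⟨⟨m, g, am, fun x => ?_, hpm⟩, ⟨rfl, hm⟩, ?_⟩
  · refine F.map_injective ?_ ?_
    · rw [hpm, Q.bundle.proj_act, P.bundle.proj_act, hpm]
    · rw [hm, F'.map_act, F.map_act]
      exact R.bundle.act_congr (hm _).symm rfl _ _
  · rintro E ⟨hE, h⟩
    refine ext_map fun p => F.map_injective ?_ ((h p).trans (hm p).symm)
    change Q.bundle.proj (E.map p) = Q.bundle.proj (m p)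
    rw [E.proj_map, hE, hpm]

/-- The canonical morphism from the pullback of a principal bundle. -/
noncomputable def ofPullback (Q : BObj G) {Y : CGTop.{u}} (f : C(Y, Q.base)) :
    BHom (⟨Y, PrincipalBundle.pullback Q.bundle f⟩ : BObj G) Q where
  map := ⟨FiberProd.snd, FiberProd.continuous_snd⟩
  base := f
  anchor_map _ := rfl
  map_act _ := rfl
  proj_map p := p.w.symm

end BHom

/-! ### Categories fibred in groupoids -/

/-- Every morphism of `D` is cartesian: factorizations of maps of spaces lift uniquely. -/
def HasUniqueFactorization (D : OverCG.{u}) : Prop :=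
  ∀ ⦃a b c : D.obj⦄ (φ : b ⟶ c) (ψ : a ⟶ c) (g : D.p.obj a ⟶ D.p.obj b),
    g ≫ D.p.map φ = D.p.map ψ → ∃! χ : a ⟶ b, D.p.map χ = g ∧ χ ≫ φ = ψ

/-- Objects of `D` can be pulled back along continuous maps. -/
def HasLifts (D : OverCG.{u}) : Prop :=
  ∀ (c : D.obj) (R : CGTop.{u}) (f : R ⟶ D.p.obj c),
    ∃ (b : D.obj) (h : D.p.obj b = R) (φ : b ⟶ c), D.p.map φ = eqToHom h ≫ f

namespace HasUniqueFactorization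

variable {D : OverCG.{u}} (hD : HasUniqueFactorization D)
include hD

theorem hom_ext {a b c : D.obj} {χ χ' : a ⟶ b} (φ : b ⟶ c) (h : D.p.map χ = D.p.map χ')
    (h' : χ ≫ φ = χ' ≫ φ) : χ = χ' :=
  (hD φ (χ ≫ φ) (D.p.map χ) (D.p.map_comp _ _).symm).unique ⟨rfl, rfl⟩ ⟨h.symm, h'.symm⟩

theorem isIso {a b : D.obj} (φ : a ⟶ b) [IsIso (D.p.map φ)] : IsIso φ := by
  obtain ⟨χ, ⟨h₁, h₂⟩, -⟩ := hD φ (𝟙 b) (inv (D.p.map φ)) (by simp)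
  exact ⟨χ, hD.hom_ext φ (by simp [h₁]) (by simp [h₂]), h₂⟩

/-- A category with lifts all of whose morphisms are cartesian is fibred in groupoids. -/
theorem isFiberedInGroupoids (hD' : HasLifts D) : IsFiberedInGroupoids D := by
  constructor
  · refine Functor.IsFibered.of_exists_isStronglyCartesian fun c R f => ?_
    obtain ⟨b, rfl, φ, hφ⟩ := hD' c R f
    obtain rfl : D.p.map φ = f := by simpa using hφ
    refine ⟨b, φ, ⟨fun {a} g ψ hψ => ?_⟩⟩
    obtain ⟨χ, ⟨h₁, h₂⟩, h₃⟩ := hD φ ψ g (IsHomLift.fac D.p _ ψ |>.trans (by simp))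
    refine ⟨χ, ⟨h₁ ▸ inferInstance, h₂⟩, fun χ' h => h₃ χ' ⟨?_, h.2⟩⟩
    have := h.1
    exact (IsHomLift.fac D.p g χ' |>.trans (by simp)).symm
  · intro S a b f hf
    have : IsIso (D.p.map f) := by
      rw [IsHomLift.fac' D.p (𝟙 S) f]
      infer_instance
    exact hD.isIso f

theorem isIso_natTrans {W : OverCG.{u}} {a b : BasedFunctor W D} (η : a ⟶ b) : IsIso η := by
  have h : ∀ w, IsIso (η.app w) := fun w => by
    have : IsIso (D.p.map (η.app w)) := by
      rw [IsHomLift.fac' D.p (𝟙 (W.p.obj w)) (η.app w)]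
      infer_instance
    exact hD.isIso _
  have : IsIso (X := a.toFunctor) η.toNatTrans := NatIso.isIso_of_isIso_app _
  exact BasedNatIso.isIso_of_toNatTrans_isIso η

/-- Two functors into `D` with compatible cocones over the same object are related by a
natural transformation. -/
theorem exists_natTrans {W : OverCG.{u}} (a b : BasedFunctor W D) {x : D.obj}
    (l : ∀ w, a.obj w ⟶ x) (m : ∀ w, b.obj w ⟶ x)
    (hl : ∀ ⦃w w' : W.obj⦄ (f : w ⟶ w'), a.map f ≫ l w' = l w)
    (hm : ∀ ⦃w w' : W.obj⦄ (f : w ⟶ w'), b.map f ≫ m w' = m w)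
    (h : ∀ w, D.p.map (l w) =
      eqToHom ((a.w_obj w).trans (b.w_obj w).symm) ≫ D.p.map (m w)) :
    ∃ η : a ⟶ b, ∀ w, η.app w ≫ m w = l w := by
  choose η hη using fun w => (hD (m w) (l w) _ (h w).symm).exists
  refine ⟨{ app := η, naturality := fun w w' f => ?_, isHomLift' := fun w => ?_ },
    fun w => (hη w).2⟩
  · refine hD.hom_ext (m w') ?_ ?_
    · have h₁ := Functor.congr_hom a.w f
      have h₂ := Functor.congr_hom b.w f
      simp only [Functor.comp_map] at h₁ h₂
      rw [D.p.map_comp, D.p.map_comp, (hη w).1, (hη w').1, h₁, h₂]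
      simp
    · rw [Category.assoc, Category.assoc, (hη w').2, hl, hm, (hη w).2]
  · refine IsHomLift.of_fac D.p _ _ (a.w_obj w) (b.w_obj w) ?_
    rw [(hη w).1]
    simp

end HasUniqueFactorization

/-! ### Functors on the category of spaces over a space -/

/-- The identity of `U`, as an object of `CGTop / U`. -/
def baseObj (U : CGTop.{u}) : (underline U).obj := (Over.mk (𝟙 U) : Over U)

/-- The structure map of an object of `CGTop / U`. -/
def structMap {U : CGTop.{u}} (f : (underline U).obj) : (underline U).p.obj f ⟶ U := Over.hom f

theorem map_structMap {U : CGTop.{u}} {f f' : (underline U).obj} (k : f ⟶ f') :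
    (underline U).p.map k ≫ structMap f' = structMap f := Over.w k

theorem underline_hom_ext {U : CGTop.{u}} {f f' : (underline U).obj} {k k' : f ⟶ f'}
    (h : (underline U).p.map k = (underline U).p.map k') : k = k' := Over.OverMorphism.ext h

/-- The projection of a space over `U` to `U`. -/
def toBase {U : CGTop.{u}} (f : (underline U).obj) : f ⟶ baseObj U :=
  Over.homMk (U := (f : Over U)) (V := Over.mk (𝟙 U)) (Over.hom f) (by simp)

theorem comp_toBase {U : CGTop.{u}} {f f' : (underline U).obj} (k : f ⟶ f') :
    k ≫ toBase f' = toBase f :=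
  underline_hom_ext (((underline U).p.map_comp _ _).trans (map_structMap k))

theorem CategoryTheory.BasedFunctor.map_p {D W : BasedCategory.{u, u + 1} CGTop.{u}}
    (q : BasedFunctor W D) {a b : W.obj} (f : a ⟶ b) :
    D.p.map (q.map f) = eqToHom (q.w_obj a) ≫ W.p.map f ≫ eqToHom (q.w_obj b).symm :=
  Functor.congr_hom q.w f

/-- An object `x` of a fibred category defines a functor on `CGTop / p x`, by pullback. -/
theorem exists_basedFunctor {D : OverCG.{u}} (hD : HasUniqueFactorization D) (hD' : HasLifts D)
    (x : D.obj) : ∃ (r : BasedFunctor (underline (D.p.obj x)) D) (l : ∀ f, r.obj f ⟶ x),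
      (∀ ⦃f f'⦄ (k : f ⟶ f'), r.map k ≫ l f' = l f) ∧
        ∀ f, D.p.map (l f) = eqToHom (r.w_obj f) ≫ structMap f := by
  let W := underline (D.p.obj x)
  choose b hb l hl using fun f : W.obj => hD' x (W.p.obj f) (structMap f)
  choose m hm using fun (f f' : W.obj) (k : f ⟶ f') =>
    (hD (l f') (l f) (eqToHom (hb f) ≫ W.p.map k ≫ eqToHom (hb f').symm) (by
      rw [hl, hl, ← map_structMap k]; simp [W])).exists
  let r : BasedFunctor W D :=
    { obj := b
      map := fun {f f'} k => m f f' k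
      map_id := fun f => hD.hom_ext (l f) (by
        rw [(hm _ _ _).1]; simp) (by rw [(hm _ _ _).2]; simp)
      map_comp := fun {f f' f''} k k' => hD.hom_ext (l f'') (by
        rw [D.p.map_comp, (hm _ _ _).1, (hm _ _ _).1, (hm _ _ _).1]; simp) (by
        rw [Category.assoc, (hm _ _ _).2, (hm _ _ _).2, (hm _ _ _).2])
      w := CategoryTheory.Functor.ext hb fun f f' k => (hm f f' k).1 }
  exact ⟨r, l, fun f f' k => (hm f f' k).2, hl⟩

theorem isOpenEmbedding_eqToHom_comp {A B C : CGTop.{u}} (h : A = B) (m : B ⟶ C)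
    (hm : IsOpenEmbedding (m : C(B, C))) : IsOpenEmbedding (eqToHom h ≫ m : C(A, C)) := by
  subst h; exact hm

theorem exists_eqToHom_comp {A B C : CGTop.{u}} (h : A = B) (m : B ⟶ C) {x : C}
    (hm : ∃ v, (m : C(B, C)) v = x) : ∃ v, (eqToHom h ≫ m : C(A, C)) v = x := by
  subst h; exact hm

/-- A functor `q` on `CGTop / U` is classified by its value at the identity of `U`: all other values
map to it, cartesianly. -/
theorem exists_cocone {C : OverCG.{u}} {U : CGTop.{u}} (q : BasedFunctor (underline U) C) :
    ∃ (c : C.obj) (hc : C.p.obj c = U) (m : ∀ f, q.obj f ⟶ c),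
      (∀ ⦃f f'⦄ (k : f ⟶ f'), q.map k ≫ m f' = m f) ∧
      ∀ f, C.p.map (m f) = eqToHom (q.w_obj f) ≫ structMap f ≫ eqToHom hc.symm := by
  refine ⟨q.obj (baseObj U), q.w_obj _, fun f => q.map (toBase f), fun f f' k => ?_,
    fun f => q.map_p (toBase f)⟩
  rw [← q.map_comp, comp_toBase]

/-- A criterion for epimorphisms: objects of the target are locally in the image. -/
theorem isEpimorphism_of_locally {D C : OverCG.{u}} (hD : HasUniqueFactorization D)
    (hD' : HasLifts D) (hC : HasUniqueFactorization C) (F : BasedFunctor D C)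
    (h : ∀ (c : C.obj) (x : C.p.obj c), ∃ (d : D.obj) (m : F.obj d ⟶ c),
      IsOpenEmbedding (C.p.map m : C(C.p.obj (F.obj d), C.p.obj c)) ∧
        ∃ v, (C.p.map m : C(C.p.obj (F.obj d), C.p.obj c)) v = x) :
    IsEpimorphism F := by
  intro U q
  obtain ⟨c, rfl, m, hm, hm'⟩ := exists_cocone q
  choose d n hn hx using h c
  refine ⟨C.p.obj c, fun x => D.p.obj (d x),
    fun x => eqToHom (F.w_obj (d x)).symm ≫ C.p.map (n x),
    fun x => isOpenEmbedding_eqToHom_comp _ _ (hn x),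
    fun x => ⟨x, exists_eqToHom_comp _ _ (hx x)⟩, fun x => ?_⟩
  obtain ⟨r, l, hl, hl'⟩ := exists_basedFunctor hD hD' (d x)
  let s := underlineMap (eqToHom (F.w_obj (d x)).symm ≫ C.p.map (n x))
  have e₁ {f f'} (k : f ⟶ f') : F.map (r.map k) ≫ F.map (l f') ≫ n x = F.map (l f) ≫ n x := by
    rw [← Category.assoc, ← F.map_comp, hl]
  have e₂ (f) : C.p.map (F.map (l f) ≫ n x) =
      eqToHom ((F.w_obj _).trans ((r.w_obj f).trans (q.w_obj (s.obj f)).symm)) ≫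
        C.p.map (m (s.obj f)) := by
    have : structMap (s.obj f) =
      structMap f ≫ eqToHom (F.w_obj (d x)).symm ≫ C.p.map (n x) := rfl
    rw [hm', C.p.map_comp, F.map_p, hl', this]
    simp only [Category.assoc, eqToHom_trans_assoc, eqToHom_refl]
    exact (eqToHom_trans_assoc _ (rfl : (underline _).p.obj (s.obj f) = (underline _).p.obj f)
      _).symm
  obtain ⟨η, -⟩ := hC.exists_natTrans (BasedFunctor.comp r F) (BasedFunctor.comp s q)
    (fun f => F.map (l f) ≫ n x) (fun f => m (s.obj f)) (fun f f' k => e₁ k)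
    (fun f f' k => hm (s.map k)) e₂
  have := hC.isIso_natTrans η
  exact ⟨r, ⟨asIso η⟩⟩

/-! ### Invariance of stacks under equivalence -/

/-- Composition with a morphism of categories over `CGTop`. -/
def postcomp {D E : OverCG.{u}} (F : BasedFunctor D E) (W : OverCG.{u}) :
    BasedFunctor W D ⥤ BasedFunctor W E where
  obj q := q.comp F
  map α := BasedCategory.whiskerRight α F
  map_id _ := BasedNatTrans.ext _ _ (NatTrans.ext (funext fun _ => F.map_id _))
  map_comp _ _ := BasedNatTrans.ext _ _ (NatTrans.ext (funext fun _ => F.map_comp _ _))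

section Transfer

variable {D E : OverCG.{u}} (hD : HasUniqueFactorization D) (hD' : HasLifts D)
  (F : BasedFunctor D E) [hF : F.toFunctor.IsEquivalence]
include hD hD' hF

/-- An equivalence over `CGTop` is essentially surjective on fibres. -/
theorem exists_fibre_iso (e : E.obj) : ∃ (d : D.obj) (h : D.p.obj d = E.p.obj e)
    (i : F.obj d ≅ e), E.p.map i.hom = eqToHom ((F.w_obj d).trans h) := by
  obtain ⟨d₀, ⟨i⟩⟩ := hF.essSurj.mem_essImage e
  obtain ⟨d, h, φ, hφ⟩ := hD' d₀ (E.p.obj e) (E.p.map i.inv ≫ eqToHom (F.w_obj d₀))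
  have : IsIso (D.p.map φ) := by rw [hφ]; infer_instance
  have := hD.isIso φ
  refine ⟨d, h, F.mapIso (asIso φ) ≪≫ i, ?_⟩
  have : E.p.map (F.map φ) = _ := F.map_p φ
  simp only [Iso.trans_hom, Functor.mapIso_hom, asIso_hom, Functor.map_comp, this, hφ]
  simp [← Functor.map_comp]

/-- The property of having lifts is invariant under equivalence. -/
theorem hasLifts_of_isEquivalence : HasLifts E := by
  intro e R f
  obtain ⟨d, h, i, hi⟩ := exists_fibre_iso hD hD' F e
  obtain ⟨b, hb, φ, hφ⟩ := hD' d R (f ≫ eqToHom h.symm)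
  refine ⟨F.obj b, (F.w_obj b).trans hb, F.map φ ≫ i.hom, ?_⟩
  rw [E.p.map_comp, hi, F.map_p, hφ]
  simp

/-- An equivalence over `CGTop` induces equivalences on categories of functors over `CGTop`. A
preimage of a functor is chosen fibrewise, so that it is a functor over `CGTop` strictly. -/
theorem postcomp_isEquivalence (W : OverCG.{u}) : (postcomp F W).IsEquivalence where
  faithful := ⟨fun {a b} α β h => BasedNatTrans.ext _ _ (NatTrans.ext (funext fun w =>
    F.map_injective (congrArg (fun γ : BasedNatTrans _ _ => γ.app w) h)))⟩
  full := ⟨fun {a b} β => by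
    let γ (w : W.obj) : F.obj (a.obj w) ⟶ F.obj (b.obj w) := β.app w
    have hγ {w w' : W.obj} (f : w ⟶ w') : F.map (a.map f) ≫ γ w' = γ w ≫ F.map (b.map f) :=
      β.naturality f
    have hγ' (w : W.obj) : E.p.IsHomLift (𝟙 (W.p.obj w)) (γ w) := β.isHomLift' w
    refine ⟨{ app := fun w => F.preimage (γ w), naturality := fun w w' f => ?_,
              isHomLift' := fun w => ?_ }, BasedNatTrans.ext _ _ (NatTrans.ext (funext fun w =>
        F.map_preimage (γ w)))⟩
    · exact F.map_injective (by simpa using hγ f)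
    · have : E.p.IsHomLift (𝟙 (W.p.obj w)) (F.map (F.preimage (γ w))) := by
        rw [F.map_preimage]; exact hγ' w
      exact F.isHomLift_map _ _⟩
  essSurj := ⟨fun q => by
    choose d h i hi using fun w => exists_fibre_iso hD hD' F (q.obj w)
    let r : BasedFunctor W D :=
      { obj := d
        map := fun {w w'} f => F.preimage ((i w).hom ≫ q.map f ≫ (i w').inv)
        map_id := fun w => F.map_injective (by simp)
        map_comp := fun f g => F.map_injective (by simp)
        w := CategoryTheory.Functor.ext (fun w => (h w).trans (q.w_obj w)) fun w w' f => by
          have h₁ := F.map_p (F.preimage ((i w).hom ≫ q.map f ≫ (i w').inv))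
          have h₂ : E.p.map (i w').inv = eqToHom ((F.w_obj _).trans (h w')).symm := by
            rw [← cancel_epi (E.p.map (i w').hom), ← Functor.map_comp, hi]
            simp
          rw [F.map_preimage, E.p.map_comp, E.p.map_comp, hi, h₂, q.map_p] at h₁
          change D.p.map (F.preimage _) = _
          rw [← cancel_epi (eqToHom (F.w_obj (d w))),
            ← cancel_mono (eqToHom (F.w_obj (d w')).symm), Category.assoc, ← h₁]
          simp }
    refine ⟨r, ⟨BasedNatIso.mkNatIso (NatIso.ofComponents i fun {w w'} f => ?_) fun w => ?_⟩⟩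
    · change F.map (F.preimage _) ≫ _ = (i w).hom ≫ q.map f
      simp only [Functor.map_preimage, Category.assoc, Iso.inv_hom_id, Category.comp_id]
    · refine IsHomLift.of_fac E.p _ _ ((F.w_obj _).trans ((h w).trans (q.w_obj w))) (q.w_obj w) ?_
      refine Eq.trans ?_ (congrArg (fun z => eqToHom ((F.w_obj _).trans
        ((h w).trans (q.w_obj w))).symm ≫ z ≫ eqToHom (q.w_obj w)) (hi w)).symm
      simp⟩

/-- A category over `CGTop` which is equivalent to a stack is a stack. -/
theorem isStack_of_isEquivalence (hE : HasUniqueFactorization E)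
    (hS : ∀ (U : CGTop.{u}), ∀ S ∈ openCoverTopology U, (restrictToSieve D S).IsEquivalence) :
    IsStack E := by
  -- Restriction to a sieve commutes with composition with `F`.
  refine ⟨hE.isFiberedInGroupoids (hasLifts_of_isEquivalence hD hD' F), fun U S hSU => ?_⟩
  have := hS U S hSU
  have := postcomp_isEquivalence hD hD' F (underline U)
  have := postcomp_isEquivalence hD hD' F (sieveCat S)
  have : (postcomp F (underline U) ⋙ restrictToSieve E S).IsEquivalence :=
    inferInstanceAs (restrictToSieve D S ⋙ postcomp F (sieveCat S)).IsEquivalence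
  exact Functor.isEquivalence_of_comp_left (postcomp F (underline U)) _

end Transfer

/-! ### Morphisms of `2`-fibre products -/

section TwoFiberProduct

variable {X Y Z : OverCG.{u}} {F : BasedFunctor Y X} {G : BasedFunctor Z X}

theorem TwoFiberHom.map_snd {a b : TwoFiberObj F G} (f : TwoFiberHom a b) : Z.p.map f.snd =
    eqToHom a.base_eq.symm ≫ Y.p.map f.fst ≫ eqToHom b.base_eq := by
  have := f.isHomLift
  exact IsHomLift.fac' Z.p (Y.p.map f.fst) f.snd

theorem TwoFiberObj.map_iso_hom (a : TwoFiberObj F G) : X.p.map a.iso.hom =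
    eqToHom ((F.w_obj _).trans (a.base_eq.trans (G.w_obj _).symm)) := by
  have := a.isHomLift
  exact (IsHomLift.fac' X.p (𝟙 (Y.p.obj a.fst)) a.iso.hom).trans (by simp)

/-- Morphisms of a `2`-fibre product of categories fibred in groupoids are cartesian. -/
theorem hasUniqueFactorization_twoFiberProduct (hX : HasUniqueFactorization X)
    (hY : HasUniqueFactorization Y) (hZ : HasUniqueFactorization Z) (F : BasedFunctor Y X)
    (G : BasedFunctor Z X) : HasUniqueFactorization (twoFiberProduct F G) := by
  intro (a : TwoFiberObj F G) (b : TwoFiberObj F G) (c : TwoFiberObj F G) (φ : TwoFiberHom b c)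
    (ψ : TwoFiberHom a c) (g : Y.p.obj a.fst ⟶ Y.p.obj b.fst)
    (hg : g ≫ Y.p.map φ.fst = Y.p.map ψ.fst)
  obtain ⟨χ₁, ⟨h₁, h₁'⟩, u₁⟩ := hY φ.fst ψ.fst g hg
  obtain ⟨χ₂, ⟨h₂, h₂'⟩, u₂⟩ := hZ φ.snd ψ.snd
    (eqToHom a.base_eq.symm ≫ g ≫ eqToHom b.base_eq) (by
      rw [φ.map_snd, ψ.map_snd, ← hg]; simp)
  refine ⟨(⟨χ₁, χ₂, ?_, ?_⟩ : TwoFiberHom a b), ⟨h₁, TwoFiberHom.ext h₁' h₂'⟩, ?_⟩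
  · refine IsHomLift.of_fac Z.p _ _ a.base_eq.symm b.base_eq.symm ?_
    rw [h₁, h₂]; simp
  · refine hX.hom_ext (G.map φ.snd) ?_ ?_
    · rw [X.p.map_comp, X.p.map_comp, a.map_iso_hom, b.map_iso_hom, F.map_p, G.map_p, h₁, h₂]
      simp
    · rw [Category.assoc, ← φ.comm, Category.assoc, ← G.map_comp, h₂',
        ← Category.assoc, ← F.map_comp, h₁', ψ.comm]
  · rintro (χ : TwoFiberHom a b) ⟨h, h'⟩
    have h' : TwoFiberHom.mk (χ.fst ≫ φ.fst) (χ.snd ≫ φ.snd) _ _ = ψ := h'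
    obtain rfl : Y.p.map χ.fst = g := h
    subst h'
    exact TwoFiberHom.ext (u₁ _ ⟨rfl, rfl⟩) (u₂ _ ⟨χ.map_snd, rfl⟩)

end TwoFiberProduct

/-! ### The fibred category of principal bundles -/

section

variable {M : CGTop.{u}} (G : TopGroupoid M)

theorem hasUniqueFactorization_B : HasUniqueFactorization G.B := by
  intro (a : BObj G) (b : BObj G) (c : BObj G) (φ : BHom b c) (ψ : BHom a c) (g : C(a.base, b.base))
    (hg : φ.base.comp g = ψ.base)
  obtain ⟨E, ⟨h₁, h₂⟩, h₃⟩ := BHom.existsUnique_factor φ ψ g hg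
  exact ⟨E, ⟨h₁, BHom.ext_map h₂⟩, fun E' h => h₃ E' ⟨h.1, fun p =>
    congrArg (fun f : BHom a c => f.map p) h.2⟩⟩

theorem hasLifts_B : HasLifts G.B := fun c R f =>
  ⟨(⟨R, PrincipalBundle.pullback (BObj.bundle c) f⟩ : BObj G), rfl, BHom.ofPullback c f,
    (Category.id_comp _).symm⟩

end

/-! ### Objects of a sieve -/

section Sieve

variable {U : CGTop.{u}} {S : Sieve U}

/-- The structure map of a member of a sieve. -/
def sMap (w : (sieveCat S).obj) : C((sieveCat S).p.obj w, U) := Over.hom w.obj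

/-- A member of a sieve, as an object of the corresponding category. -/
def sObj {Y : CGTop.{u}} (f : C(Y, U)) (hf : S (show Y ⟶ U from f)) : (sieveCat S).obj :=
  ⟨Over.mk (show Y ⟶ U from f), hf⟩

/-- A map of spaces over `U`, as a morphism between members of a sieve. -/
def sHom {w w' : (sieveCat S).obj} (k : C((sieveCat S).p.obj w, (sieveCat S).p.obj w'))
    (h : (sMap w').comp k = sMap w) : w ⟶ w' :=
  ObjectProperty.homMk (Over.homMk k h)

theorem sHom_ext {w w' : (sieveCat S).obj} {k k' : w ⟶ w'}
    (h : (sieveCat S).p.map k = (sieveCat S).p.map k') : k = k' :=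
  ObjectProperty.hom_ext _ (Over.OverMorphism.ext h)

theorem sMap_map {w w' : (sieveCat S).obj} (k : w ⟶ w') :
    (sMap w').comp ((sieveCat S).p.map k) = sMap w := Over.w k.hom

/-- A covering sieve contains every point. -/
theorem mem_of_point (hS : S ∈ openCoverTopology U) (u : U) :
    S (show CGTop.of PUnit.{u + 1} ⟶ U from ContinuousMap.const _ u) := by
  obtain ⟨V, i, v, hi, -, hv⟩ := hS u
  have := S.downward_closed hi (show CGTop.of PUnit.{u + 1} ⟶ V from ContinuousMap.const _ v)
  convert this using 1
  exact ContinuousMap.ext fun _ => hv.symm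

/-- The one-point space at `u` in `U`, as a member of a covering sieve. -/
def sPoint (hS : S ∈ openCoverTopology U) (u : U) : (sieveCat S).obj :=
  sObj (ContinuousMap.const _ u) (mem_of_point hS u)

theorem exists_isOpenEmbedding_sMap (hS : S ∈ openCoverTopology U) (u : U) :
    ∃ w : (sieveCat S).obj, IsOpenEmbedding (sMap w) ∧ u ∈ Set.range (sMap w) := by
  obtain ⟨V, i, v, hi, hi', hv⟩ := hS u
  exact ⟨sObj i hi, hi', v, hv⟩

theorem exists_hom_sPoint (hS : S ∈ openCoverTopology U) (w : (sieveCat S).obj)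
    (v : (sieveCat S).p.obj w) (u : U) (h : sMap w v = u) : ∃ k : sPoint hS u ⟶ w,
      ∀ y, ((sieveCat S).p.map k : C(_, _)) y = v :=
  ⟨sHom (w := sPoint hS u) (ContinuousMap.const _ v) (ContinuousMap.ext fun _ => h), fun _ => rfl⟩

/-- The fibre product of two members of a sieve, one of which is open. -/
theorem exists_overlap (w w' : (sieveCat S).obj) (hw' : IsOpenEmbedding (sMap w')) :
    ∃ (w'' : (sieveCat S).obj) (k : w'' ⟶ w) (_ : w'' ⟶ w'),
      IsOpenEmbedding ((sieveCat S).p.map k : C(_, _)) ∧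
      ∀ v, sMap w v ∈ Set.range (sMap w') → v ∈ Set.range ((sieveCat S).p.map k : C(_, _)) := by
  let f : C(CGTop.of (FiberProd (sMap w) (sMap w')), (sieveCat S).p.obj w) :=
    ⟨FiberProd.fst, FiberProd.continuous_fst⟩
  let w'' : (sieveCat S).obj := sObj ((sMap w).comp f)
    (S.downward_closed (f := (sMap w : _ ⟶ U)) w.property f)
  refine ⟨w'', sHom (w := w'') f rfl, sHom (w := w'') ⟨FiberProd.snd, FiberProd.continuous_snd⟩
    (ContinuousMap.ext fun x => x.w.symm), FiberProd.isOpenEmbedding_fst hw', ?_⟩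
  rintro v ⟨v', h⟩
  exact ⟨⟨v, v', h.symm⟩, rfl⟩

end Sieve

theorem eqToHom_symm_apply {A B : CGTop.{u}} (h : A = B) (y : B) :
    (eqToHom h : C(A, B)) ((eqToHom h.symm : C(B, A)) y) = y := by subst h; rfl

theorem isOpenEmbedding_eqToHom {A B : CGTop.{u}} (h : A = B) :
    IsOpenEmbedding (eqToHom h : C(A, B)) := by subst h; exact IsOpenEmbedding.id

/-! ### Descent data for principal bundles -/

namespace DescentDatum

variable {M : CGTop.{u}} {G : TopGroupoid M} {U : CGTop.{u}} {S : Sieve U}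
  (a : BasedFunctor (sieveCat S) G.B)

/-- The principal bundle which a descent datum assigns to a member of the sieve. -/
abbrev ob (w : (sieveCat S).obj) : BObj G := a.obj w

/-- The morphism of principal bundles which a descent datum assigns to a morphism. -/
abbrev mor {w w' : (sieveCat S).obj} (k : w ⟶ w') : BHom (ob a w) (ob a w') := a.map k

/-- The identification of the base of the bundle over a member of the sieve with this member. -/
def toSource (w : (sieveCat S).obj) : C((ob a w).base, (sieveCat S).p.obj w) :=
  (eqToHom (a.w_obj w) : (ob a w).base ⟶ (sieveCat S).p.obj w)

/-- The inverse of `toSource`. -/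
def ofSource (w : (sieveCat S).obj) : C((sieveCat S).p.obj w, (ob a w).base) :=
  (eqToHom (a.w_obj w).symm : (sieveCat S).p.obj w ⟶ (ob a w).base)

theorem toSource_ofSource (w : (sieveCat S).obj) (v) : toSource a w (ofSource a w v) = v :=
  eqToHom_symm_apply (a.w_obj w) v

theorem ofSource_toSource (w : (sieveCat S).obj) (v) : ofSource a w (toSource a w v) = v :=
  eqToHom_symm_apply (a.w_obj w).symm v

theorem base_mor {w w' : (sieveCat S).obj} (k : w ⟶ w') (x : (ob a w).base) :
    (mor a k).base x = ofSource a w' (((sieveCat S).p.map k : C(_, _)) (toSource a w x)) :=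
  congrArg (fun f : C((ob a w).base, (ob a w').base) => f x) (a.map_p k)

/-- The map from the base of the bundle over a member of the sieve to `U`. -/
def toU (w : (sieveCat S).obj) : C((ob a w).base, U) := (sMap w).comp (toSource a w)

theorem toU_mor {w w' : (sieveCat S).obj} (k : w ⟶ w') (x : (ob a w).base) :
    toU a w' ((mor a k).base x) = toU a w x := by
  rw [base_mor]
  change sMap w' (toSource a w' _) = sMap w (toSource a w x)
  rw [toSource_ofSource, ← sMap_map k]
  rfl

theorem isOpenEmbedding_toU {w : (sieveCat S).obj} (hw : IsOpenEmbedding (sMap w)) :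
    IsOpenEmbedding (toU a w) := hw.comp (isOpenEmbedding_eqToHom _)

theorem range_toU (w : (sieveCat S).obj) : Set.range (toU a w) = Set.range (sMap w) := by
  ext x
  constructor
  · rintro ⟨y, rfl⟩
    exact ⟨_, rfl⟩
  · rintro ⟨y, rfl⟩
    exact ⟨ofSource a w y, congrArg (sMap w) (toSource_ofSource a w y)⟩

theorem isOpenEmbedding_mor {w w' : (sieveCat S).obj} (k : w ⟶ w')
    (hk : IsOpenEmbedding ((sieveCat S).p.map k : C(_, _))) : IsOpenEmbedding (mor a k).map := by
  refine (mor a k).isOpenEmbedding_map ?_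
  have : ⇑(mor a k).base =
      fun x => ofSource a w' (((sieveCat S).p.map k : C(_, _)) (toSource a w x)) :=
    funext (base_mor a k)
  rw [this]
  exact (isOpenEmbedding_eqToHom _).comp (hk.comp (isOpenEmbedding_eqToHom _))

theorem exists_mor_eq {w w' : (sieveCat S).obj} (k : w ⟶ w') (p : (ob a w').bundle.total)
    (v : (sieveCat S).p.obj w)
    (h : ((sieveCat S).p.map k : C(_, _)) v = toSource a w' ((ob a w').bundle.proj p)) :
    ∃ p₀, (mor a k).map p₀ = p := by
  obtain ⟨p₀, -, h₀⟩ := (mor a k).exists_lift ⟨ofSource a w v, p, by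
    rw [base_mor, toSource_ofSource, h, ofSource_toSource]⟩
  exact ⟨p₀, h₀⟩

theorem mor_comp {w w' w'' : (sieveCat S).obj} (k : w ⟶ w') (k' : w' ⟶ w'')
    (p : (ob a w).bundle.total) : (mor a (k ≫ k')).map p = (mor a k').map ((mor a k).map p) :=
  congrArg (fun f : BHom (ob a w) (ob a w'') => f.map p) (a.map_comp k k')

variable (hS : S ∈ openCoverTopology U)

instance (u : U) : Subsingleton (ob a (sPoint hS u)).base :=
  (Function.LeftInverse.injective (ofSource_toSource a (sPoint hS u))).subsingleton
    (β := PUnit.{u + 1})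

/-- Every point of a descent datum comes from the fibre over a point of `U`. -/
theorem exists_sPoint (w : (sieveCat S).obj) (p : (ob a w).bundle.total) (u : U)
    (h : toU a w ((ob a w).bundle.proj p) = u) :
    ∃ (k : sPoint hS u ⟶ w) (p₀ : (ob a (sPoint hS u)).bundle.total), (mor a k).map p₀ = p := by
  obtain ⟨k, hk⟩ := exists_hom_sPoint hS w (toSource a w ((ob a w).bundle.proj p)) u h
  exact ⟨k, exists_mor_eq a k p PUnit.unit (hk _)⟩

/-- The point over a point of `U` from which a point of a descent datum comes is unique. -/
theorem eq_of_mor_eq {w : (sieveCat S).obj} {u u' : U} {k : sPoint hS u ⟶ w}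
    {k' : sPoint hS u' ⟶ w} {p₀ : (ob a (sPoint hS u)).bundle.total}
    {p₀' : (ob a (sPoint hS u')).bundle.total} (h : (mor a k).map p₀ = (mor a k').map p₀') :
    (⟨u, p₀⟩ : Σ u, (ob a (sPoint hS u)).bundle.total) = ⟨u', p₀'⟩ := by
  have e {u : U} {k : sPoint hS u ⟶ w} {p₀ : (ob a (sPoint hS u)).bundle.total} :
      toU a w ((ob a w).bundle.proj ((mor a k).map p₀)) = u := by
    rw [(mor a k).proj_map, toU_mor]; rfl
  obtain rfl : u = u' := by rw [← e (k := k) (p₀ := p₀), h, e]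
  have e' (k : sPoint hS u ⟶ w) (p₀ : (ob a (sPoint hS u)).bundle.total) :
      ((sieveCat S).p.map k : C(_, _)) PUnit.unit =
        toSource a w ((ob a w).bundle.proj ((mor a k).map p₀)) := by
    rw [(mor a k).proj_map, base_mor, toSource_ofSource]
    rfl
  obtain rfl : k = k' := sHom_ext (ContinuousMap.ext fun _ => by
    refine (e' k p₀).trans (Eq.trans ?_ (e' k' p₀').symm)
    rw [h])
  rw [(mor a k).map_injective (Subsingleton.elim _ _) h]

/-- A principal bundle over `U` is covered by its restrictions to open members of the sieve. -/
theorem exists_map_eq (hS : S ∈ openCoverTopology U) {c : BObj G} (hc : c.base = U)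
    (l : ∀ w, BHom (ob a w) c)
    (hl : ∀ w x, (eqToHom hc : C(c.base, U)) ((l w).base x) = toU a w x) (z : c.bundle.total) :
    ∃ w p, IsOpenEmbedding (l w).map ∧ (l w).map p = z := by
  subst hc
  have hl : ∀ w x, (l w).base x = toU a w x := hl
  obtain ⟨w, hw, hz⟩ := exists_isOpenEmbedding_sMap hS (c.bundle.proj z)
  rw [← range_toU a] at hz
  obtain ⟨x, hx⟩ := hz
  obtain ⟨p, -, hp⟩ := (l w).exists_lift ⟨x, z, (hl w x).trans hx⟩
  refine ⟨w, p, (l w).isOpenEmbedding_map ?_, hp⟩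
  rw [show ⇑(l w).base = toU a w from funext (hl w)]
  exact isOpenEmbedding_toU a hw

/-- Morphisms out of a principal bundle over `U` may be constructed on a covering sieve. -/
theorem exists_desc (hS : S ∈ openCoverTopology U) (c c' : BObj G) (hc : c.base = U)
    (l : ∀ w, BHom (ob a w) c) (t : ∀ w, BHom (ob a w) c')
    (hl : ∀ ⦃w w'⦄ (k : w ⟶ w') (p), (l w').map ((mor a k).map p) = (l w).map p)
    (ht : ∀ ⦃w w'⦄ (k : w ⟶ w') (p), (t w').map ((mor a k).map p) = (t w).map p)
    (hl' : ∀ w x, (eqToHom hc : C(c.base, U)) ((l w).base x) = toU a w x)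
    (g : C(c.base, c'.base)) (hg : ∀ w x, (t w).base x = g ((l w).base x)) :
    ∃ T : BHom c c', T.base = g ∧ ∀ w p, T.map ((l w).map p) = (t w).map p := by
  have surj := exists_map_eq a hS hc l hl'
  -- Compatibility is checked in the fibre over a single point, which is a member of the sieve.
  have wd (w w' : (sieveCat S).obj) (p p') (h : (l w).map p = (l w').map p') :
      (t w).map p = (t w').map p' := by
    obtain ⟨u, hu⟩ : ∃ u, toU a w ((ob a w).bundle.proj p) = u := ⟨_, rfl⟩
    have hu' : toU a w' ((ob a w').bundle.proj p') = u := by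
      rw [← hu, ← hl', ← hl', ← (l w).proj_map, ← (l w').proj_map, h]
    obtain ⟨k, p₀, rfl⟩ := exists_sPoint a hS w p u hu
    obtain ⟨k', p₀', rfl⟩ := exists_sPoint a hS w' p' u hu'
    rw [hl, hl] at h
    rw [ht, ht, (l _).map_injective (Subsingleton.elim _ _) h]
  choose w p hw hp using surj
  let T (z : c.bundle.total) : c'.bundle.total := (t (w z)).map (p z)
  have hT (w p) : T ((l w).map p) = (t w).map p := wd _ _ _ _ (hp _)
  have cT : Continuous T := by
    rw [continuous_iff_continuousAt]
    intro z
    rw [← hp z, ← (hw z).continuousAt_iff]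
    exact ((t (w z)).map.continuous.congr fun p => (hT _ p).symm).continuousAt
  have hanchor (z) : c'.bundle.anchor (T z) = c.bundle.anchor z := by
    conv_rhs => rw [← hp z, (l _).anchor_map]
    exact (t _).anchor_map _
  obtain ⟨F, hF⟩ := BHom.exists_of_map ⟨T, cT⟩ hanchor (by
    rintro ⟨z, γ, hγ⟩
    have e : c.bundle.anchor ((l (w z)).map (p z)) = G.tgt γ := by rw [hp, hγ]
    have h₁ := (l (w z)).map_act ⟨p z, γ, ((l _).anchor_map _).symm.trans e⟩
    have h₂ := c.bundle.act_congr (hp z).symm rfl hγ e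
    refine (congrArg T (h₂.trans h₁.symm)).trans ((hT _ _).trans ?_)
    exact (t (w z)).map_act ⟨p z, γ, ((l _).anchor_map _).symm.trans e⟩)
  refine ⟨F, ContinuousMap.ext fun x => ?_, fun w p => ?_⟩
  · obtain ⟨z, rfl⟩ := c.bundle.proj_surjective x
    rw [← F.proj_map, hF]
    change c'.bundle.proj ((t _).map _) = _
    rw [(t _).proj_map, hg, ← (l _).proj_map, hp]
  · rw [hF]; exact hT w p

end DescentDatum

section Restrict

variable {M : CGTop.{u}} {G : TopGroupoid M} {U : CGTop.{u}} {S : Sieve U}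

theorem toU_cocone (q : BasedFunctor (underline U) G.B) (w : (sieveCat S).obj) (x) :
    (eqToHom (q.w_obj (baseObj U)) : C(_, U))
      ((q.map (toBase ((sieveIncl S).obj w)) : BHom _ _).base x) =
      DescentDatum.toU ((sieveIncl S).comp q) w x := by
  have := congrArg (fun f : C(_, _) => (eqToHom (q.w_obj (baseObj U)) : C(_, U)) (f x))
    (q.map_p (toBase ((sieveIncl S).obj w)))
  exact this.trans (eqToHom_symm_apply (q.w_obj (baseObj U)) _)

theorem restrictToSieve_faithful (hS : S ∈ openCoverTopology U) :
    (restrictToSieve G.B S).Faithful := by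
  refine ⟨fun {q q'} α β h => ?_⟩
  have hw (w : (sieveCat S).obj) :
      α.app ((sieveIncl S).obj w) = β.app ((sieveIncl S).obj w) :=
    congrArg (fun γ : BasedNatTrans _ _ => γ.app w) h
  -- Both transformations are determined by their value at the identity of `U`.
  have h₁ : α.app (baseObj U) = β.app (baseObj U) := by
    refine BHom.ext_map fun z => ?_
    obtain ⟨w, p, -, rfl⟩ := DescentDatum.exists_map_eq ((sieveIncl S).comp q) hS
      (q.w_obj (baseObj U)) (fun w => q.map (toBase ((sieveIncl S).obj w))) (toU_cocone q) z
    have e : q.map (toBase ((sieveIncl S).obj w)) ≫ α.app (baseObj U) =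
        q.map (toBase ((sieveIncl S).obj w)) ≫ β.app (baseObj U) := by
      rw [α.naturality, β.naturality, hw]
    exact congrArg (fun f : BHom _ _ => f.map p) e
  refine BasedNatTrans.ext _ _ (NatTrans.ext (funext fun f => ?_))
  refine (hasUniqueFactorization_B G).hom_ext (q'.map (toBase f)) ?_ ?_
  · have := α.isHomLift' f
    have := β.isHomLift' f
    rw [IsHomLift.fac' G.B.p (𝟙 ((underline U).p.obj f)) (α.app f),
      IsHomLift.fac' G.B.p (𝟙 ((underline U).p.obj f)) (β.app f)]
  · rw [← α.naturality, ← β.naturality, h₁]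

theorem restrictToSieve_full (hS : S ∈ openCoverTopology U) :
    (restrictToSieve G.B S).Full := by
  refine ⟨fun {q q'} β => ?_⟩
  let b (w : (sieveCat S).obj) :
    q.obj ((sieveIncl S).obj w) ⟶ q'.obj ((sieveIncl S).obj w) := β.app w
  have hb ⦃w w'⦄ (k : w ⟶ w') : q.map ((sieveIncl S).map k) ≫ b w' =
    b w ≫ q'.map ((sieveIncl S).map k) := β.naturality k
  have hb' (w) : G.B.p.map (b w) = eqToHom ((q.w_obj _).trans (q'.w_obj _).symm) := by
    have : G.B.p.IsHomLift (𝟙 ((sieveCat S).p.obj w)) (b w) := β.isHomLift' w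
    exact (IsHomLift.fac' G.B.p (𝟙 ((sieveCat S).p.obj w)) (b w)).trans (by simp)
  let l (f) := q.map (toBase f)
  let l' (f) := q'.map (toBase f)
  have hl ⦃f f'⦄ (k : f ⟶ f') : q.map k ≫ l f' = l f := by
    rw [← q.map_comp, comp_toBase]
  have hl' ⦃f f'⦄ (k : f ⟶ f') : q'.map k ≫ l' f' = l' f := by
    rw [← q'.map_comp, comp_toBase]
  let g : G.B.p.obj (q.obj (baseObj U)) ⟶ G.B.p.obj (q'.obj (baseObj U)) :=
    eqToHom ((q.w_obj _).trans (q'.w_obj _).symm)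
  have hg (w) : G.B.p.map (b w ≫ l' ((sieveIncl S).obj w)) =
      G.B.p.map (l ((sieveIncl S).obj w)) ≫ g := by
    rw [G.B.p.map_comp, hb', q.map_p, q'.map_p]
    simp [g]
  obtain ⟨T₀, hT, hT'⟩ := DescentDatum.exists_desc ((sieveIncl S).comp q) hS
    (q.obj (baseObj U)) (q'.obj (baseObj U)) (q.w_obj (baseObj U))
    (fun w => l ((sieveIncl S).obj w)) (fun w => b w ≫ l' ((sieveIncl S).obj w))
    (fun w w' k p => congrArg (fun f : BHom _ _ => f.map p) (hl ((sieveIncl S).map k)))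
    (fun w w' k p => congrArg (fun f : BHom _ _ => f.map p)
      (show q.map ((sieveIncl S).map k) ≫ b w' ≫ l' _ = b w ≫ l' _ by
        rw [← Category.assoc, hb, Category.assoc, hl']))
    (toU_cocone q) g (fun w x => congrArg (fun f : C(_, _) => f x) (hg w))
  obtain ⟨T, rfl⟩ : ∃ T : q.obj (baseObj U) ⟶ q'.obj (baseObj U), T = T₀ := ⟨T₀, rfl⟩
  have hT : G.B.p.map T = g := hT
  obtain ⟨η, hη⟩ := (hasUniqueFactorization_B G).exists_natTrans q q'
    (fun f => l f ≫ T) l'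
    (fun f f' k => by rw [← Category.assoc, hl]) hl' (fun f => by
      rw [G.B.p.map_comp, hT, q.map_p, q'.map_p]
      simp [g])
  refine ⟨η, BasedNatTrans.ext _ _ (NatTrans.ext (funext fun w => ?_))⟩
  change η.app ((sieveIncl S).obj w) = b w
  refine (hasUniqueFactorization_B G).hom_ext (l' _) ?_ ((hη _).trans ?_)
  · have := η.isHomLift' ((sieveIncl S).obj w)
    rw [hb', IsHomLift.fac' G.B.p (𝟙 ((underline U).p.obj ((sieveIncl S).obj w))) (η.app _)]
    simp
  · exact BHom.ext_map (hT' w)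

end Restrict

/-! ### Gluing spaces along open subsets -/

section Gluing

variable {E : Type u} {ι : Type*} {T : ι → Type u} [∀ i, TopologicalSpace (T i)]
  (j : ∀ i, T i → E)

/-- The finest topology for which all the maps `j i` are continuous. -/
abbrev glueTopology : TopologicalSpace E := ⨆ i, TopologicalSpace.coinduced (j i) inferInstance

theorem isOpen_glueTopology {s : Set E} :
    IsOpen[glueTopology j] s ↔ ∀ i, IsOpen (j i ⁻¹' s) :=
  isOpen_iSup_iff.trans (forall_congr' fun _ => isOpen_coinduced)

theorem continuous_glueTopology {Y : Type*} [TopologicalSpace Y] {f : E → Y} :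
    Continuous[glueTopology j, _] f ↔ ∀ i, Continuous (f ∘ j i) :=
  continuous_iSup_dom.trans (forall_congr' fun _ => continuous_coinduced_dom)

/-- If the pieces overlap in open subsets with continuous transition functions, then they are open
in the glued space. -/
theorem isOpenEmbedding_glueTopology (inj : ∀ i, Function.Injective (j i))
    (overlap : ∀ i k (t : T i) (t' : T k), j i t = j k t' → ∃ (W : Type u) (_ : TopologicalSpace W)
      (a : W → T i) (b : W → T k), IsOpenEmbedding a ∧ Continuous b ∧
        (∀ w, j i (a w) = j k (b w)) ∧ t ∈ Set.range a) (i : ι) :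
    @IsOpenEmbedding _ _ _ (glueTopology j) (j i) := by
  let _ : TopologicalSpace E := glueTopology j
  refine .of_continuous_injective_isOpenMap ?_ (inj i) fun O hO => ?_
  · exact continuous_iSup_rng (i := i) continuous_coinduced_rng
  · rw [isOpen_glueTopology]
    refine fun k => isOpen_iff_mem_nhds.mpr ?_
    rintro t' ⟨t, ht, e⟩
    obtain ⟨W, _, a, b, ha, hb, hab, ⟨w, rfl⟩⟩ := overlap k i t' t e.symm
    have hw : b w = t := inj i ((hab w).symm.trans e.symm)
    refine Filter.mem_of_superset ((ha.isOpenMap _ (hO.preimage hb)).mem_nhds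
      ⟨w, by rwa [← hw] at ht, rfl⟩) ?_
    rintro _ ⟨w', hw', rfl⟩
    exact ⟨b w', hw', (hab w').symm⟩

theorem compactlyGeneratedSpace_glueTopology [∀ i, CompactlyGeneratedSpace (T i)] :
    @CompactlyGeneratedSpace E (glueTopology j) := by
  let _ : TopologicalSpace E := glueTopology j
  refine compactlyGeneratedSpace_of_isOpen fun s hs => ?_
  rw [isOpen_glueTopology]
  refine fun i => CompactlyGeneratedSpace.isOpen' fun K _ _ _ g hg => ?_
  exact hs K (j i ∘ g) ((continuous_iSup_rng (i := i) continuous_coinduced_rng).comp hg)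

end Gluing

/-- Local sections may be defined on spaces openly embedded in the target. -/
theorem AdmitsLocalSections.of_isOpenEmbedding {X Y : Type u} [TopologicalSpace X]
    [TopologicalSpace Y] {f : C(X, Y)} (h : ∀ y, ∃ (O : Type u) (_ : TopologicalSpace O)
      (b : O → Y) (s : O → X), IsOpenEmbedding b ∧ Continuous s ∧ (∀ o, f (s o) = b o) ∧
        y ∈ Set.range b) : AdmitsLocalSections f := by
  intro y
  obtain ⟨O, _, b, s, hb, hs, hfs, hy⟩ := h y
  let e := hb.isEmbedding.toHomeomorph
  refine ⟨⟨Set.range b, hb.isOpen_range⟩, hy, ⟨s ∘ e.symm, hs.comp e.symm.continuous⟩, ?_⟩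
  intro v
  refine (hfs _).trans ?_
  exact congrArg Subtype.val (e.apply_symm_apply v)

namespace DescentDatum

variable {M : CGTop.{u}} {G : TopGroupoid M} {U : CGTop.{u}} {S : Sieve U}
  (a : BasedFunctor (sieveCat S) G.B) (hS : S ∈ openCoverTopology U)

/-! ### The principal bundle glued from a descent datum -/

/-- The underlying set of the glued bundle: the disjoint union of the bundles which the descent
datum assigns to the points of `U`. Since points are members of every covering sieve, no quotient is
needed. -/
abbrev Glue : Type u := Σ u : U, (ob a (sPoint hS u)).bundle.total

theorem exists_toGlue (w : (sieveCat S).obj) (p : (ob a w).bundle.total) :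
    ∃ z : Glue a hS, ∃ k : sPoint hS z.1 ⟶ w, (mor a k).map z.2 = p := by
  obtain ⟨k, p₀, h⟩ := exists_sPoint a hS w p _ rfl
  exact ⟨⟨_, p₀⟩, k, h⟩

/-- The comparison map from the bundle over a member of the sieve to the glued bundle. -/
noncomputable def toGlue (w : (sieveCat S).obj) (p : (ob a w).bundle.total) : Glue a hS :=
  (exists_toGlue a hS w p).choose

theorem toGlue_mor_sPoint {w : (sieveCat S).obj} {u : U} (k : sPoint hS u ⟶ w)
    (p : (ob a (sPoint hS u)).bundle.total) : toGlue a hS w ((mor a k).map p) = ⟨u, p⟩ :=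
  eq_of_mor_eq a hS (exists_toGlue a hS w ((mor a k).map p)).choose_spec.choose_spec

/-- Every point of the bundle over a member of the sieve comes from the fibre over a point. -/
theorem exists_rep (w : (sieveCat S).obj) (p : (ob a w).bundle.total) :
    ∃ (u : U) (k : sPoint hS u ⟶ w) (p₀ : (ob a (sPoint hS u)).bundle.total),
      (mor a k).map p₀ = p ∧ toGlue a hS w p = ⟨u, p₀⟩ ∧
        u = toU a w ((ob a w).bundle.proj p) := by
  obtain ⟨u, hu⟩ : ∃ u, toU a w ((ob a w).bundle.proj p) = u := ⟨_, rfl⟩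
  obtain ⟨k, p₀, h⟩ := exists_sPoint a hS w p u hu
  exact ⟨u, k, p₀, h, by rw [← h, toGlue_mor_sPoint], hu.symm⟩

theorem toGlue_mor {w w' : (sieveCat S).obj} (k : w ⟶ w') (p : (ob a w).bundle.total) :
    toGlue a hS w' ((mor a k).map p) = toGlue a hS w p := by
  obtain ⟨u, k', p₀, rfl, h, -⟩ := exists_rep a hS w p
  rw [h, ← mor_comp, toGlue_mor_sPoint]

theorem fst_toGlue (w : (sieveCat S).obj) (p : (ob a w).bundle.total) :
    (toGlue a hS w p).1 = toU a w ((ob a w).bundle.proj p) := by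
  obtain ⟨u, k', p₀, -, h, hu⟩ := exists_rep a hS w p
  rw [h, ← hu]

theorem toGlue_inj {w : (sieveCat S).obj} {p p' : (ob a w).bundle.total}
    (h : (ob a w).bundle.proj p = (ob a w).bundle.proj p')
    (e : toGlue a hS w p = toGlue a hS w p') : p = p' := by
  obtain ⟨u, hu⟩ : ∃ u, toU a w ((ob a w).bundle.proj p) = u := ⟨_, rfl⟩
  obtain ⟨k, p₀, rfl⟩ := exists_sPoint a hS w p u hu
  have hp : ((mor a k).base ((ob a _).bundle.proj p₀)) = (ob a w).bundle.proj p' := by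
    rw [← (mor a k).proj_map, h]
  obtain ⟨p₁, -, rfl⟩ := (mor a k).exists_lift ⟨_, p', hp⟩
  rw [toGlue_mor_sPoint, toGlue_mor_sPoint] at e
  rw [eq_of_heq (Sigma.mk.inj e).2]

theorem mem_range_toGlue (w : (sieveCat S).obj) (z : Glue a hS)
    (h : z.1 ∈ Set.range (sMap w)) : z ∈ Set.range (toGlue a hS w) := by
  obtain ⟨v, hv⟩ := h
  obtain ⟨k, -⟩ := exists_hom_sPoint hS w v z.1 hv
  exact ⟨_, toGlue_mor_sPoint a hS k z.2⟩

theorem mem_range_of_toGlue {w : (sieveCat S).obj} {p : (ob a w).bundle.total} :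
    (toGlue a hS w p).1 ∈ Set.range (sMap w) := by
  rw [fst_toGlue]; exact ⟨_, rfl⟩

theorem exists_overlap (w w' : (sieveCat S).obj) (hw' : IsOpenEmbedding (sMap w'))
    (p : (ob a w).bundle.total) (h : (toGlue a hS w p).1 ∈ Set.range (sMap w')) :
    ∃ (w'' : (sieveCat S).obj) (k : w'' ⟶ w) (_ : w'' ⟶ w'),
      IsOpenEmbedding (mor a k).map ∧ p ∈ Set.range (mor a k).map := by
  obtain ⟨w'', k, k', hk, hv⟩ := _root_.exists_overlap w w' hw'
  rw [fst_toGlue] at h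
  obtain ⟨v, hv⟩ := hv _ h
  exact ⟨w'', k, k', isOpenEmbedding_mor a k hk, exists_mor_eq a k p v hv⟩

/-- The glued bundle carries the topology glued from the bundles over the open members of the
sieve. -/
noncomputable instance : TopologicalSpace (Glue a hS) :=
  glueTopology fun w : {w : (sieveCat S).obj // IsOpenEmbedding (sMap w)} => toGlue a hS w.1

theorem isOpenEmbedding_toGlue {w : (sieveCat S).obj} (hw : IsOpenEmbedding (sMap w)) :
    IsOpenEmbedding (toGlue a hS w) := by
  refine isOpenEmbedding_glueTopology
    (fun w : {w : (sieveCat S).obj // IsOpenEmbedding (sMap w)} => toGlue a hS w.1) ?_ ?_ ⟨w, hw⟩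
  · intro w p p' h
    refine toGlue_inj a hS ((isOpenEmbedding_toU a w.2).injective ?_) h
    rw [← fst_toGlue, ← fst_toGlue, h]
  · intro w w' p p' h
    obtain ⟨w'', k, k', hk, hp⟩ := exists_overlap a hS w.1 w'.1 w'.2 p
      (by rw [h]; exact mem_range_of_toGlue a hS)
    exact ⟨_, inferInstance, (mor a k).map, (mor a k').map, hk, (mor a k').map.continuous,
      fun q => by rw [toGlue_mor, toGlue_mor], hp⟩

instance : CompactlyGeneratedSpace (Glue a hS) := compactlyGeneratedSpace_glueTopology _

/-- The comparison map is continuous over all members of the sieve, not only over the open ones,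
which define the topology. -/
theorem continuous_toGlue (w : (sieveCat S).obj) : Continuous (toGlue a hS w) := by
  rw [continuous_iff_continuousAt]
  intro p
  obtain ⟨w', hw', h⟩ := exists_isOpenEmbedding_sMap hS (toGlue a hS w p).1
  obtain ⟨w'', k, k', hk, ⟨p, rfl⟩⟩ := exists_overlap a hS w w' hw' p h
  rw [← hk.continuousAt_iff]
  refine (((isOpenEmbedding_toGlue a hS hw').continuous.comp (mor a k').map.continuous).congr
    fun q => ?_).continuousAt
  change toGlue a hS w' ((mor a k').map q) = toGlue a hS w ((mor a k).map q)
  rw [toGlue_mor, toGlue_mor]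

/-- The projection of the glued bundle. -/
def glueProj : C(Glue a hS, U) where
  toFun z := z.1
  continuous_toFun := (continuous_glueTopology _).mpr fun w =>
    ((toU a w.1).continuous.comp (ob a w.1).bundle.proj.continuous).congr fun p =>
      (fst_toGlue a hS w.1 p).symm

theorem exists_toGlue_eq (z : Glue a hS) : ∃ (w : (sieveCat S).obj) (_ : IsOpenEmbedding (sMap w))
    (p : (ob a w).bundle.total), toGlue a hS w p = z := by
  obtain ⟨w, hw, h⟩ := exists_isOpenEmbedding_sMap hS z.1
  obtain ⟨p, hp⟩ := mem_range_toGlue a hS w z h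
  exact ⟨w, hw, p, hp⟩

instance : T2Space (Glue a hS) := by
  refine ⟨fun z z' hne => ?_⟩
  -- Points with the same projection lie in a common open piece; others are separated in `U`.
  by_cases hp : glueProj a hS z = glueProj a hS z'
  · obtain ⟨w, hw, h⟩ := exists_isOpenEmbedding_sMap hS z.1
    obtain ⟨p, rfl⟩ := mem_range_toGlue a hS w z h
    obtain ⟨p', rfl⟩ := mem_range_toGlue a hS w z' (by
      change (toGlue a hS w p).1 = z'.1 at hp
      rwa [hp] at h)
    obtain ⟨A, B, hA, hB, hpA, hpB, hAB⟩ := t2_separation (show p ≠ p' from fun e => hne (e ▸ rfl))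
    have ho := isOpenEmbedding_toGlue a hS hw
    exact ⟨_, _, ho.isOpenMap _ hA, ho.isOpenMap _ hB, ⟨p, hpA, rfl⟩, ⟨p', hpB, rfl⟩,
      (Set.disjoint_image_iff ho.injective).mpr hAB⟩
  · obtain ⟨A, B, hA, hB, hqA, hqB, hAB⟩ := t2_separation hp
    exact ⟨_, _, hA.preimage (glueProj a hS).continuous, hB.preimage (glueProj a hS).continuous,
      hqA, hqB, hAB.preimage _⟩

theorem anchor_toGlue (w : (sieveCat S).obj) (p : (ob a w).bundle.total) :
    (ob a (sPoint hS (toGlue a hS w p).1)).bundle.anchor (toGlue a hS w p).2 =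
      (ob a w).bundle.anchor p := by
  obtain ⟨u, k, p₀, rfl, h, -⟩ := exists_rep a hS w p
  rw [h, (mor a k).anchor_map]

/-- The anchor of the glued bundle. -/
def glueAnchor : C(Glue a hS, M) where
  toFun z := (ob a (sPoint hS z.1)).bundle.anchor z.2
  continuous_toFun := (continuous_glueTopology _).mpr fun w =>
    (ob a w.1).bundle.anchor.continuous.congr fun p => (anchor_toGlue a hS w.1 p).symm

/-- The underlying function of the action on the glued bundle. -/
def glueActFun (x : FiberProd (X := CGTop.of (Glue a hS)) (glueAnchor a hS) G.tgt) : Glue a hS :=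
  ⟨x.fst.1, (ob a (sPoint hS x.fst.1)).bundle.act ⟨x.fst.2, x.snd, x.w⟩⟩

theorem glueActFun_toGlue (w : (sieveCat S).obj) (p : (ob a w).bundle.total) (g : G.Arr)
    (h : glueAnchor a hS (toGlue a hS w p) = G.tgt g) :
    glueActFun a hS ⟨toGlue a hS w p, g, h⟩ =
      toGlue a hS w ((ob a w).bundle.act ⟨p, g, (anchor_toGlue a hS w p).symm.trans h⟩) := by
  obtain ⟨u, k, p₀, rfl, e, -⟩ := exists_rep a hS w p
  have h₀ : (ob a (sPoint hS u)).bundle.anchor p₀ = G.tgt g := by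
    rw [e] at h; exact h
  have := (mor a k).map_act ⟨p₀, g, h₀⟩
  have aux (z : Glue a hS) (hz : z = ⟨u, p₀⟩) (h : glueAnchor a hS z = G.tgt g) :
      glueActFun a hS ⟨z, g, h⟩ = ⟨u, (ob a (sPoint hS u)).bundle.act ⟨p₀, g, h₀⟩⟩ := by
    subst hz; rfl
  rw [aux _ e h, ← this, toGlue_mor_sPoint]

/-- Continuity on the part of a space lying over an open piece of the glued bundle. -/
theorem continuous_of_toGlue {X : CGTop.{u}} {Y : Type*} [TopologicalSpace Y]
    (q : C(X, Glue a hS)) {f : X → Y}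
    (h : ∀ (w : (sieveCat S).obj), IsOpenEmbedding (sMap w) → ∀ (O : CGTop.{u}) (i : C(O, X))
      (r : C(O, (ob a w).bundle.total)), (∀ o, toGlue a hS w (r o) = q (i o)) →
        Continuous fun o => f (i o)) : Continuous f := by
  refine continuous_of_locally fun x => ?_
  obtain ⟨w, hw, p, hp⟩ := exists_toGlue_eq a hS (q x)
  have hj := isOpenEmbedding_toGlue a hS hw
  let V : Opens X := ⟨q ⁻¹' Set.range (toGlue a hS w), hj.isOpen_range.preimage q.continuous⟩
  let e := hj.isEmbedding.toHomeomorph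
  refine ⟨V, ⟨p, hp⟩, h w hw (CGTop.of V) ⟨Subtype.val, continuous_subtype_val⟩
    ⟨fun v => e.symm ⟨q v, v.2⟩, e.symm.continuous.comp
      ((q.continuous.comp continuous_subtype_val).subtype_mk _)⟩ fun v => ?_⟩
  exact congrArg Subtype.val (e.apply_symm_apply ⟨q v, v.2⟩)

theorem continuous_glueActFun : Continuous (glueActFun a hS) := by
  refine continuous_of_toGlue a hS
    (X := CGTop.of (FiberProd (X := CGTop.of (Glue a hS)) (glueAnchor a hS) G.tgt))
    ⟨FiberProd.fst, FiberProd.continuous_fst⟩ fun w hw O i r hr => ?_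
  have hw (o : O) : (ob a w).bundle.anchor (r o) = G.tgt (i o).snd := by
    rw [← (i o).w, ← anchor_toGlue a hS]
    exact congrArg (glueAnchor a hS) (hr o)
  refine ((continuous_toGlue a hS w).comp ((ob a w).bundle.act.continuous.comp
    (r.continuous.fiberMk i.continuous.fiberSnd hw))).congr fun o => ?_
  refine (glueActFun_toGlue a hS w (r o) (i o).snd
    ((anchor_toGlue a hS w _).trans (hw o))).symm.trans ?_
  exact congrArg (glueActFun a hS) (FiberProd.ext (hr o) rfl)

theorem proj_eq_of_sPoint (u : U) (z z' : (ob a (sPoint hS u)).bundle.total) :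
    (ob a (sPoint hS u)).bundle.proj z = (ob a (sPoint hS u)).bundle.proj z' :=
  Subsingleton.elim _ _

theorem exists_glueDiv (x : FiberProd (X := CGTop.of (Glue a hS)) (Y := CGTop.of (Glue a hS))
      (glueProj a hS) (glueProj a hS)) : ∃ (g : G.Arr) (w : glueAnchor a hS x.fst = G.tgt g),
      glueActFun a hS ⟨x.fst, g, w⟩ = x.snd := by
  obtain ⟨⟨u, z⟩, ⟨u', z'⟩, w⟩ := x
  obtain rfl : u = u' := w
  have h := proj_eq_of_sPoint a hS u z z'
  refine ⟨(ob a (sPoint hS u)).bundle.div ⟨z, z', h⟩,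
    (ob a (sPoint hS u)).bundle.tgt_div ⟨z, z', h⟩, ?_⟩
  exact congrArg (Sigma.mk u) ((ob a (sPoint hS u)).bundle.act_div ⟨z, z', h⟩)

theorem glueActFun_inj {z : Glue a hS} {g g' : G.Arr} (w : glueAnchor a hS z = G.tgt g)
    (w' : glueAnchor a hS z = G.tgt g')
    (h : glueActFun a hS ⟨z, g, w⟩ = glueActFun a hS ⟨z, g', w'⟩) : g = g' :=
  (ob a (sPoint hS z.1)).bundle.act_inj w w' (eq_of_heq (Sigma.mk.inj h).2)

/-- The division map of the glued bundle. -/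
noncomputable def glueDiv : C(FiberProd (X := CGTop.of (Glue a hS)) (Y := CGTop.of (Glue a hS))
      (glueProj a hS) (glueProj a hS), G.Arr) where
  toFun x := (exists_glueDiv a hS x).choose
  continuous_toFun := by
    refine continuous_of_toGlue a hS (X := CGTop.of (FiberProd (X := CGTop.of (Glue a hS))
      (Y := CGTop.of (Glue a hS)) (glueProj a hS) (glueProj a hS)))
      ⟨FiberProd.fst, FiberProd.continuous_fst⟩ fun w hw O i r hr => ?_
    have hr : ∀ o, toGlue a hS w (r o) = (i o).fst := hr
    have hj := isOpenEmbedding_toGlue a hS hw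
    let e := hj.isEmbedding.toHomeomorph
    have hs (o : O) : (i o).snd ∈ Set.range (toGlue a hS w) := mem_range_toGlue a hS w _ (by
      rw [← show (i o).fst.1 = (i o).snd.1 from (i o).w, ← hr]
      exact mem_range_of_toGlue a hS)
    let s : O → (ob a w).bundle.total := fun o => e.symm ⟨(i o).snd, hs o⟩
    have hsc : Continuous s := e.symm.continuous.comp (i.continuous.fiberSnd.subtype_mk _)
    have hs' (o : O) : toGlue a hS w (s o) = (i o).snd :=
      congrArg Subtype.val (e.apply_symm_apply ⟨(i o).snd, hs o⟩)
    have hp (o : O) : (ob a w).bundle.proj (r o) = (ob a w).bundle.proj (s o) := by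
      refine (isOpenEmbedding_toU a hw).injective ?_
      rw [← fst_toGlue a hS, ← fst_toGlue a hS, hr, hs']
      exact (i o).w
    refine ((ob a w).bundle.div.continuous.comp (r.continuous.fiberMk hsc hp)).congr fun o => ?_
    have h₁ := (ob a w).bundle.tgt_div ⟨_, _, hp o⟩
    have h₂ := (exists_glueDiv a hS (i o)).choose_spec
    have h₃ : glueAnchor a hS (toGlue a hS w (r o)) = G.tgt ((ob a w).bundle.div ⟨_, _, hp o⟩) :=
      (anchor_toGlue a hS w _).trans h₁
    refine glueActFun_inj a hS (z := (i o).fst) (by rw [← hr]; exact h₃) h₂.choose ?_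
    refine Eq.trans ?_ h₂.choose_spec.symm
    have e₁ := glueActFun_toGlue a hS w (r o) _ h₃
    rw [(ob a w).bundle.act_div ⟨_, _, hp o⟩, hs'] at e₁
    refine Eq.trans ?_ e₁
    exact congrArg (glueActFun a hS) (FiberProd.ext (hr o).symm rfl)

/-- The principal bundle glued from a descent datum. -/
noncomputable def glueBundle : PrincipalBundle G U where
  total := CGTop.of (Glue a hS)
  proj := glueProj a hS
  admitsLocalSections := AdmitsLocalSections.of_isOpenEmbedding fun u => by
    obtain ⟨w, hw, h⟩ := exists_isOpenEmbedding_sMap hS u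
    rw [← range_toU a] at h
    obtain ⟨x, rfl⟩ := h
    obtain ⟨O, hO, σ, hσ⟩ := (ob a w).bundle.admitsLocalSections x
    refine ⟨O, inferInstance, fun o => toU a w o, fun o => toGlue a hS w (σ o),
      (isOpenEmbedding_toU a hw).comp O.isOpenEmbedding_coe,
      (continuous_toGlue a hS w).comp σ.continuous, fun o => ?_, ⟨⟨x, hO⟩, rfl⟩⟩
    exact (fst_toGlue a hS w _).trans (by rw [hσ])
  anchor := glueAnchor a hS
  act := ⟨glueActFun a hS, continuous_glueActFun a hS⟩
  anchor_act x := (ob a (sPoint hS x.fst.1)).bundle.anchor_act _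
  act_one z := congrArg (Sigma.mk z.1) ((ob a (sPoint hS z.1)).bundle.act_one z.2)
  act_act z g h w₁ w₂ :=
    congrArg (Sigma.mk z.1) ((ob a (sPoint hS z.1)).bundle.act_act z.2 g h w₁ w₂)
  proj_act _ := rfl
  principal := PrincipalBundle.isHomeomorph_of_div (T := CGTop.of (Glue a hS)) (G := G)
    (fun _ => rfl) (glueDiv a hS)
    (fun x => (exists_glueDiv a hS x).choose_spec.choose)
    (fun x => (exists_glueDiv a hS x).choose_spec.choose_spec)
    (fun x => glueActFun_inj a hS (exists_glueDiv a hS _).choose_spec.choose x.w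
      (exists_glueDiv a hS _).choose_spec.choose_spec)

/-- The comparison morphism from the bundle over a member of the sieve to the glued bundle. -/
noncomputable def glueHom (w : (sieveCat S).obj) :
    BHom (ob a w) (⟨U, glueBundle a hS⟩ : BObj G) where
  map := ⟨toGlue a hS w, continuous_toGlue a hS w⟩
  base := toU a w
  anchor_map := anchor_toGlue a hS w
  map_act x := (glueActFun_toGlue a hS w x.fst x.snd _).symm
  proj_map := fst_toGlue a hS w

end DescentDatum

/-- Every descent datum is the restriction of the functor defined by the glued bundle. -/
theorem restrictToSieve_essSurj {M : CGTop.{u}} {G : TopGroupoid M} {U : CGTop.{u}} {S : Sieve U}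
    (hS : S ∈ openCoverTopology U) : (restrictToSieve G.B S).EssSurj := by
  refine ⟨fun a => ?_⟩
  let c : G.B.obj := (⟨U, DescentDatum.glueBundle a hS⟩ : BObj G)
  have hG := hasUniqueFactorization_B G
  obtain ⟨r, l, hl, hl'⟩ := exists_basedFunctor hG (hasLifts_B G) c
  let r : BasedFunctor (underline U) G.B := r
  let m (w : (sieveCat S).obj) : a.obj w ⟶ c := DescentDatum.glueHom a hS w
  obtain ⟨η, -⟩ := hG.exists_natTrans ((sieveIncl S).comp r) a
    (fun w => l ((sieveIncl S).obj w)) m (fun w w' k => hl ((sieveIncl S).map k))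
    (fun w w' k => BHom.ext_map (DescentDatum.toGlue_mor a hS k)) fun w => by
      refine (hl' ((sieveIncl S).obj w)).trans ?_
      have : G.B.p.map (m w) = eqToHom (a.w_obj w) ≫ structMap ((sieveIncl S).obj w) := rfl
      rw [this]
      exact (eqToHom_trans_assoc _ (a.w_obj w) _).symm
  let η : (restrictToSieve G.B S).obj r ⟶ a := η
  have : IsIso η := hG.isIso_natTrans η
  exact ⟨r, ⟨asIso η⟩⟩

/-- Principal bundles satisfy descent. -/
theorem restrictToSieve_isEquivalence {M : CGTop.{u}} (G : TopGroupoid M) (U : CGTop.{u})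
    (S : Sieve U) (hS : S ∈ openCoverTopology U) : (restrictToSieve G.B S).IsEquivalence where
  faithful := restrictToSieve_faithful hS
  full := restrictToSieve_full hS
  essSurj := restrictToSieve_essSurj hS

/-- The category of principal bundles is a topological stack. -/
theorem isTopologicalStack_B {M : CGTop.{u}} (G : TopGroupoid M) : IsTopologicalStack G.B :=
  ⟨⟨(hasUniqueFactorization_B G).isFiberedInGroupoids (hasLifts_B G),
    restrictToSieve_isEquivalence G⟩, M, G, BasedFunctor.id _,
    inferInstanceAs (𝟭 G.B.obj).IsEquivalence⟩

/-! ### Equivariant maps and associated bundles -/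

section Equivariant

variable {M N X : CGTop.{u}} {G : TopGroupoid M} {H : TopGroupoid N} (φ : G.Hom H)

namespace PrincipalBundle

variable (P : PrincipalBundle G X)

/-- The canonical map `p ↦ [p, 1]` from a principal bundle to the associated bundle. -/
noncomputable def assocUnit : C(P.total, (P.assoc φ).total) :=
  (P.assocMk φ).comp ⟨fun p => ⟨p, H.one (φ.obj (P.anchor p)), (H.tgt_one _).symm⟩,
    continuous_id.fiberMk (by fun_prop) _⟩

theorem anchor_assocUnit (p : P.total) :
    (P.assoc φ).anchor (P.assocUnit φ p) = φ.obj (P.anchor p) := H.src_one _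

theorem act_assocUnit (p : P.total) (δ : H.Arr) (w : φ.obj (P.anchor p) = H.tgt δ) :
    (P.assoc φ).act ⟨P.assocUnit φ p, δ, (P.anchor_assocUnit φ p).trans w⟩ =
      P.assocMk φ ⟨p, δ, w⟩ := by
  refine (P.assocActFun_mk p _ δ (H.tgt_one _).symm ((H.src_one _).trans w)).trans ?_
  exact congrArg (P.assocMk φ) (FiberProd.ext rfl (H.one_comp' (by rw [w]) _))

theorem anchor_eq_tgt_arr {p : P.total} {γ : G.Arr} (w : P.anchor p = G.tgt γ) :
    φ.obj (P.anchor p) = H.tgt (φ.arr γ) := by rw [w, φ.tgt_arr]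

/-- The canonical map to the associated bundle is equivariant. -/
theorem assocUnit_act (x : FiberProd P.anchor G.tgt) : P.assocUnit φ (P.act x) =
    (P.assoc φ).act ⟨P.assocUnit φ x.fst, φ.arr x.snd,
      (P.anchor_assocUnit φ x.fst).trans (P.anchor_eq_tgt_arr φ x.w)⟩ := by
  refine Eq.trans ?_ (P.act_assocUnit φ x.fst (φ.arr x.snd) (P.anchor_eq_tgt_arr φ x.w)).symm
  have w' : H.src (φ.arr x.snd) = H.tgt (H.one (φ.obj (P.anchor (P.act x)))) := by
    rw [φ.src_arr, H.tgt_one, P.anchor_act]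
  let z : P.PreAssoc φ := ⟨x.fst, φ.arr x.snd, P.anchor_eq_tgt_arr φ x.w⟩
  let z' : P.PreAssoc φ :=
    ⟨P.act x, H.one (φ.obj (P.anchor (P.act x))), (H.tgt_one _).symm⟩
  suffices r : AssocRel z z' from (Quotient.sound r).symm
  refine ⟨x.snd, x.w, w', rfl, ?_⟩
  change _ = H.comp ⟨φ.arr x.snd, H.one (φ.obj (P.anchor (P.act x))), w'⟩
  refine (H.comp_one (φ.arr x.snd)).symm.trans (H.comp_congr rfl ?_ _ _)
  rw [P.anchor_act, φ.src_arr]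

end PrincipalBundle

namespace BHom

/-- Morphisms out of an associated bundle are determined by their values at the `[p, 1]`. -/
theorem assoc_ext {P : BObj G} {Q : BObj H}
    {F F' : BHom (⟨P.base, P.bundle.assoc φ⟩ : BObj H) Q}
    (h : ∀ p, F.map (P.bundle.assocUnit φ p) = F'.map (P.bundle.assocUnit φ p)) : F = F' := by
  refine ext_map fun q => ?_
  induction q using Quotient.inductionOn with
  | h y =>
    have e := P.bundle.act_assocUnit φ y.fst y.snd y.w
    refine (congrArg F.map e.symm).trans (Eq.trans ?_ (congrArg F'.map e))
    rw [F.map_act, F'.map_act]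
    exact Q.bundle.act_congr (h _) rfl _ _

/-- An equivariant map from a principal `G`-bundle to a principal `H`-bundle induces a morphism
from the associated `H`-bundle. -/
theorem exists_of_equivariant {P : BObj G} {Q : BObj H} (ψ : C(P.bundle.total, Q.bundle.total))
    (anchor_ψ : ∀ p, Q.bundle.anchor (ψ p) = φ.obj (P.bundle.anchor p))
    (ψ_act : ∀ x : FiberProd P.bundle.anchor G.tgt, ψ (P.bundle.act x) =
      Q.bundle.act ⟨ψ x.fst, φ.arr x.snd,
        (anchor_ψ _).trans (P.bundle.anchor_eq_tgt_arr φ x.w)⟩) :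
    ∃ F : BHom (⟨P.base, P.bundle.assoc φ⟩ : BObj H) Q,
      ∀ p, F.map (P.bundle.assocUnit φ p) = ψ p := by
  let f : P.bundle.PreAssoc φ → Q.bundle.total := fun y =>
    Q.bundle.act ⟨ψ y.fst, y.snd, (anchor_ψ _).trans y.w⟩
  have hf : Continuous f := Q.bundle.act.continuous.comp
    ((ψ.continuous.comp continuous_id.fiberFst).fiberMk continuous_id.fiberSnd _)
  have hr (x y : P.bundle.PreAssoc φ) (r : x ≈ y) : f x = f y := by
    obtain ⟨γ, w, w', e₁, e₂⟩ := r
    have h₁ := Q.bundle.act_act (ψ x.fst) (φ.arr γ) y.snd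
      ((anchor_ψ _).trans (P.bundle.anchor_eq_tgt_arr φ w)) w'
    refine Eq.trans (Q.bundle.act_congr rfl e₂ _ _) (h₁.symm.trans ?_)
    exact Q.bundle.act_congr (by rw [e₁]; exact (ψ_act ⟨x.fst, γ, w⟩).symm) rfl _ _
  let m : C((P.bundle.assoc φ).total, Q.bundle.total) := ⟨Quotient.lift f hr, hf.quotient_lift hr⟩
  have ha (q) : Q.bundle.anchor (m q) = (P.bundle.assoc φ).anchor q := by
    induction q using Quotient.inductionOn with
    | h y => exact Q.bundle.anchor_act _
  obtain ⟨F, hF⟩ := exists_of_map (P := (⟨P.base, P.bundle.assoc φ⟩ : BObj H)) m ha (by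
    rintro ⟨q, h, w⟩
    induction q using Quotient.inductionOn with
    | h y =>
      refine (congrArg m (P.bundle.assocActFun_mk y.fst y.snd h y.w w)).trans ?_
      exact (Q.bundle.act_act (ψ y.fst) y.snd h ((anchor_ψ _).trans y.w) w).symm)
  refine ⟨F, fun p => ?_⟩
  rw [hF]
  refine Eq.trans (Q.bundle.act_congr rfl ?_ _ _) (Q.bundle.act_one (ψ p))
  exact congrArg H.one (anchor_ψ p).symm

theorem map_assocUnit {P Q : BObj G} (F : BHom P Q) (p : P.bundle.total) :
    (F.assoc φ).map (P.bundle.assocUnit φ p) = Q.bundle.assocUnit φ (F.map p) := by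
  refine congrArg (Q.bundle.assocMk φ) (FiberProd.ext rfl ?_)
  exact congrArg (fun x => H.one (φ.obj x)) (F.anchor_map p).symm

end BHom

/-- The trivial principal bundle defined by a map to the space of objects. -/
noncomputable abbrev trivialBObj (G : TopGroupoid M) {V : CGTop.{u}} (m : C(V, M)) : BObj G :=
  ⟨V, (PrincipalBundle.unit G).pullback m⟩

/-- The canonical section of the trivial bundle. -/
def trivialSection (G : TopGroupoid M) {V : CGTop.{u}} (m : C(V, M)) (v : V) :
    (trivialBObj G m).bundle.total := (⟨v, G.one (m v), (G.tgt_one _).symm⟩ : FiberProd m G.tgt)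

/-- A section of a principal `H`-bundle, together with a lift of its anchor to the objects of `G`,
defines an equivariant map from a trivial `G`-bundle. -/
theorem exists_of_section {V : CGTop.{u}} (m : C(V, M)) (Q : BObj H) (σ : C(V, Q.bundle.total))
    (hσ : ∀ v, Q.bundle.anchor (σ v) = φ.obj (m v)) :
    ∃ F : BHom (⟨V, (trivialBObj G m).bundle.assoc φ⟩ : BObj H) Q,
      ∀ v, F.base v = Q.bundle.proj (σ v) := by
  have w (x : FiberProd m G.tgt) : Q.bundle.anchor (σ x.fst) = H.tgt (φ.arr x.snd) := by
    rw [hσ, φ.tgt_arr, x.w]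
  let ψ : C(FiberProd m G.tgt, Q.bundle.total) :=
    ⟨fun x => Q.bundle.act ⟨σ x.fst, φ.arr x.snd, w x⟩, Q.bundle.act.continuous.comp
      ((σ.continuous.comp continuous_id.fiberFst).fiberMk
        (φ.arr.continuous.comp continuous_id.fiberSnd) _)⟩
  obtain ⟨F, hF⟩ := BHom.exists_of_equivariant φ (P := trivialBObj G m) (Q := Q) ψ
    (fun x => (Q.bundle.anchor_act _).trans (φ.src_arr _)) (fun x => by
      have w' : H.src (φ.arr x.fst.snd) = H.tgt (φ.arr x.snd) :=
        (φ.src_arr _).trans ((congrArg φ.obj x.w).trans (φ.tgt_arr _).symm)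
      refine Eq.trans ?_ (Q.bundle.act_act (σ x.fst.fst) (φ.arr x.fst.snd) (φ.arr x.snd)
        (w x.fst) w').symm
      exact Q.bundle.act_congr rfl (φ.arr_comp ⟨x.fst.snd, x.snd, x.w⟩) _ _)
  refine ⟨F, fun v => ?_⟩
  have h := F.proj_map ((trivialBObj G m).bundle.assocUnit φ (trivialSection G m v))
  rw [hF] at h
  exact h.symm.trans (Q.bundle.proj_act _)

/-- A section of a principal bundle defines a morphism from a trivial bundle. -/
theorem exists_bHom_of_section {V : CGTop.{u}} (m : C(V, M)) (Q : BObj G)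
    (σ : C(V, Q.bundle.total)) (hσ : ∀ v, Q.bundle.anchor (σ v) = m v) :
    ∃ F : BHom (trivialBObj G m) Q, (∀ v, F.base v = Q.bundle.proj (σ v)) ∧
      ∀ x : FiberProd m G.tgt, F.map x = Q.bundle.act ⟨σ x.fst, x.snd, (hσ _).trans x.w⟩ := by
  let ψ : C(FiberProd m G.tgt, Q.bundle.total) :=
    ⟨fun x => Q.bundle.act ⟨σ x.fst, x.snd, (hσ _).trans x.w⟩, Q.bundle.act.continuous.comp
      ((σ.continuous.comp continuous_id.fiberFst).fiberMk continuous_id.fiberSnd _)⟩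
  obtain ⟨F, hF⟩ := BHom.exists_of_map (P := trivialBObj G m) (Q := Q) ψ
    (fun x => Q.bundle.anchor_act _) (fun x =>
      (Q.bundle.act_act (σ x.fst.fst) x.fst.snd x.snd ((hσ _).trans x.fst.w) x.w).symm)
  refine ⟨F, fun v => ?_, fun x => by rw [hF]; rfl⟩
  have h := F.proj_map (trivialSection G m v)
  rw [hF] at h
  exact h.symm.trans (Q.bundle.proj_act _)

end Equivariant

/-! ### Groupoid extensions induce gerbes -/

section Gerbe

variable {M : CGTop.{u}} {G H : TopGroupoid M} {φ : G.Hom H}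

theorem TopGroupoid.Hom.IsExtension.obj_apply (hφ : φ.IsExtension) (x : M) : φ.obj x = x := by
  rw [hφ.obj_eq]; rfl

/-- Locally, every principal `H`-bundle is trivial, hence associated with a trivial `G`-bundle. -/
theorem isEpimorphism_mapB (hφ : φ.IsExtension) : IsEpimorphism φ.mapB := by
  refine isEpimorphism_of_locally (hasUniqueFactorization_B G) (hasLifts_B G)
    (hasUniqueFactorization_B H) _ fun (Q : BObj H) (x : Q.base) => ?_
  obtain ⟨V, hV, σ, hσ⟩ := Q.bundle.admitsLocalSections x
  let m : C(CGTop.of V, M) := Q.bundle.anchor.comp σ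
  obtain ⟨F, hF⟩ := exists_of_section φ m Q σ fun v => (hφ.obj_apply _).symm
  have hF : ⇑F.base = Subtype.val := funext fun v => (hF v).trans (hσ v)
  refine ⟨trivialBObj G m, F, ?_, (⟨x, hV⟩ : V), congrFun hF _⟩
  change IsOpenEmbedding F.base
  rw [hF]
  exact V.isOpenEmbedding_coe

/-- The geometric content of the diagonal being an epimorphism: an isomorphism between the
bundles associated with two `G`-bundles matches two local sections of these, since the cocycle
comparing two arbitrary ones lifts locally along `G → H`. -/
theorem exists_matching_sections (hφ : φ.IsExtension) {X : CGTop.{u}} (P P' : PrincipalBundle G X)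
    (α : BHom (⟨X, P.assoc φ⟩ : BObj H) ⟨X, P'.assoc φ⟩) (hα : ∀ x, α.base x = x) (x : X) :
    ∃ (W : CGTop.{u}) (i : C(W, X)) (a : C(W, P.total)) (b : C(W, P'.total)),
      IsOpenEmbedding i ∧ x ∈ Set.range i ∧ (∀ v, P.proj (a v) = i v) ∧
      (∀ v, P'.proj (b v) = i v) ∧ (∀ v, P'.anchor (b v) = P.anchor (a v)) ∧
      ∀ v, α.map (P.assocUnit φ (a v)) = P'.assocUnit φ (b v) := by
  obtain ⟨V, hV, s, hs⟩ := P.admitsLocalSections x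
  obtain ⟨V', hV', s', hs'⟩ := P'.admitsLocalSections x
  let V₀ : Opens X := V ⊓ V'
  let a₀ (v : V₀) : P.total := s ⟨v, v.2.1⟩
  have ha₀ : Continuous a₀ := s.continuous.comp (continuous_subtype_val.subtype_mk _)
  let f (v : V₀) : P'.Assoc φ := α.map (P.assocUnit φ (a₀ v))
  have hf : Continuous f := α.map.continuous.comp ((P.assocUnit φ).continuous.comp ha₀)
  have hfp (v : V₀) : P'.assocProj φ (f v) = v :=
    (α.proj_map _).trans ((hα _).trans (hs ⟨v, v.2.1⟩))
  have hfV (v : V₀) : P'.assocProj φ (f v) ∈ V' := by rw [hfp]; exact v.2.2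
  -- `δ` is the cocycle which compares `a₀` with the section `b₀` of `P'`.
  have hc := P'.continuous_assocCoord s' hs' hf hfV
  let b₀ (v : V₀) : P'.total := s' ⟨_, hfV v⟩
  have hb₀ : Continuous b₀ :=
    s'.continuous.comp (((P'.assocProj φ).continuous.comp hf).subtype_mk _)
  let δ (v : V₀) : H.Arr := P'.assocCoord (b₀ v) (f v) (hs' _)
  have hδ : Continuous δ := hc
  obtain ⟨O, hO, τ, hτ⟩ := hφ.admitsLocalSections (δ ⟨x, hV, hV'⟩)
  -- Where `δ` lifts to `g`, the section `b₀ · g` of `P'` matches `a₀`.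
  let W : Opens V₀ := ⟨δ ⁻¹' O, O.2.preimage hδ⟩
  let g (v : W) : G.Arr := τ ⟨δ v.1, v.2⟩
  have hg : Continuous g := τ.continuous.comp ((hδ.comp continuous_subtype_val).subtype_mk _)
  have hφg (v : W) : φ.arr (g v) = δ v.1 := hτ _
  have tgt_g (v : W) : P'.anchor (b₀ v.1) = G.tgt (g v) := by
    rw [← hφ.obj_apply (G.tgt _), ← φ.tgt_arr, hφg, ← hφ.obj_apply (P'.anchor _)]
    exact P'.tgt_assocCoord _ _ _
  have src_g (v : W) : G.src (g v) = P.anchor (a₀ v.1) := by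
    rw [← hφ.obj_apply (G.src _), ← φ.src_arr, hφg, ← hφ.obj_apply (P.anchor _)]
    refine (P'.src_assocCoord _ _ _).trans ((α.anchor_map _).trans ?_)
    exact P.anchor_assocUnit φ _
  refine ⟨CGTop.of W, ⟨fun v => v.1.1, by fun_prop⟩,
    ⟨fun v => a₀ v.1, ha₀.comp continuous_subtype_val⟩,
    ⟨fun v => P'.act ⟨b₀ v.1, g v, tgt_g v⟩, P'.act.continuous.comp
      ((hb₀.comp continuous_subtype_val).fiberMk hg _)⟩,
    V₀.isOpenEmbedding_coe.comp W.isOpenEmbedding_coe, ⟨⟨⟨x, hV, hV'⟩, hO⟩, rfl⟩,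
    fun v => hs _, fun v => (P'.proj_act _).trans ((hs' _).trans (hfp v.1)),
    fun v => (P'.anchor_act _).trans (src_g v), fun v => ?_⟩
  have h₁ := P'.assocMk_assocCoord (b₀ v.1) (f v.1) (hs' _)
  refine h₁.symm.trans (Eq.trans ?_ (P'.assocUnit_act φ ⟨b₀ v.1, g v, tgt_g v⟩).symm)
  refine Eq.trans ?_ (P'.act_assocUnit φ _ _ (P'.anchor_eq_tgt_arr φ (tgt_g v))).symm
  exact congrArg (P'.assocMk φ) (FiberProd.ext rfl (hφg v).symm)

/-- Two matching local sections define morphisms from a common trivial bundle; hence objects of the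
`2`-fibre product of `BG` with itself come locally from the diagonal. -/
theorem isEpimorphism_diagonal (hφ : φ.IsExtension) :
    IsEpimorphism (twoFiberDiagonal φ.mapB) := by
  have hG := hasUniqueFactorization_B G
  refine isEpimorphism_of_locally hG (hasLifts_B G)
    (hasUniqueFactorization_twoFiberProduct (hasUniqueFactorization_B H) hG hG _ _) _ ?_
  rintro ⟨⟨X, P⟩, ⟨X', P'⟩, hX, α, hα⟩ (x : X)
  obtain rfl : X = X' := hX
  have hα' : ∀ y, (α.hom : BHom _ _).base y = y := fun y => by
    have hα : H.B.p.IsHomLift (𝟙 X) α.hom := hα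
    have h := IsHomLift.fac' H.B.p (𝟙 X) α.hom
    exact (congrArg (fun f : C(X, X) => f y) h :)
  obtain ⟨W, i, a, b, hi, hx, ha, hb, hab, h⟩ := exists_matching_sections hφ P P' α.hom hα' x
  obtain ⟨f, hf, hf'⟩ := exists_bHom_of_section (P.anchor.comp a) ⟨X, P⟩ a (fun v => rfl)
  obtain ⟨f', hg, hg'⟩ := exists_bHom_of_section (P.anchor.comp a) ⟨X, P'⟩ b hab
  have hfi : f.base = i := ContinuousMap.ext fun v => (hf v).trans (ha v)
  have hgi : f'.base = i := ContinuousMap.ext fun v => (hg v).trans (hb v)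
  refine ⟨trivialBObj G (P.anchor.comp a), (⟨f, f', ?_, ?_⟩ : TwoFiberHom _ _), ?_, ?_⟩
  · refine IsHomLift.of_fac G.B.p _ _ rfl rfl ?_
    change f.base = _
    rw [hfi, ← hgi]
    rfl
  · refine BHom.assoc_ext φ fun y => ?_
    have e := (f.map_assocUnit φ y).trans ((congrArg (P.assocUnit φ) (hf' y)).trans
      (P.assocUnit_act φ _))
    have e' := (f'.map_assocUnit φ y).trans ((congrArg (P'.assocUnit φ) (hg' y)).trans
      (P'.assocUnit_act φ _))
    refine (congrArg (α.hom : BHom _ _).map e).trans (Eq.trans ?_ e'.symm)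
    refine ((α.hom : BHom _ _).map_act _).trans ?_
    exact (P'.assoc φ).act_congr (h _) rfl _ _
  · change IsOpenEmbedding f.base
    rw [hfi]
    exact hi
  · obtain ⟨v, rfl⟩ := hx
    exact ⟨v, congrArg (fun k : C(W, X) => k v) hfi⟩

/-- A groupoid extension induces a gerbe. -/
theorem isGerbe_mapB (hφ : φ.IsExtension) : IsGerbe φ.mapB where
  source := isTopologicalStack_B G
  target := isTopologicalStack_B H
  epi := isEpimorphism_mapB hφ
  diagonal_epi := isEpimorphism_diagonal hφ

end Gerbe

/-! ### Action groupoids -/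

/-- A space with a right action of a topological groupoid; as for principal bundles,
`act ⟨e, g, _⟩` is `e · g`, defined when `anchor e = tgt g`. -/
structure RightSpace {M : CGTop.{u}} (G : TopGroupoid M) where
  carrier : CGTop.{u}
  anchor : C(carrier, M)
  act : C(FiberProd anchor G.tgt, carrier)
  anchor_act : ∀ x, anchor (act x) = G.src x.snd
  act_one : ∀ e, act ⟨e, G.one (anchor e), (G.tgt_one _).symm⟩ = e
  act_act : ∀ (e : carrier) (g h : G.Arr) (w₁ : anchor e = G.tgt g) (w₂ : G.src g = G.tgt h),
    act ⟨act ⟨e, g, w₁⟩, h, (anchor_act ⟨e, g, w₁⟩).trans w₂⟩ =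
      act ⟨e, G.comp ⟨g, h, w₂⟩, w₁.trans (G.tgt_comp ⟨g, h, w₂⟩).symm⟩

namespace RightSpace

variable {M X : CGTop.{u}} {G : TopGroupoid M} (E : RightSpace G)

theorem act_congr {e e' : E.carrier} {g g' : G.Arr} (h₁ : e = e') (h₂ : g = g')
    (w : E.anchor e = G.tgt g) (w' : E.anchor e' = G.tgt g') :
    E.act ⟨e, g, w⟩ = E.act ⟨e', g', w'⟩ :=
  congrArg E.act (FiberProd.ext h₁ h₂)

theorem act_act' (e : E.carrier) (g h : G.Arr) (w₁ : E.anchor e = G.tgt g)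
    (w₂ : G.src g = G.tgt h) (w₃ : E.anchor (E.act ⟨e, g, w₁⟩) = G.tgt h) {k : G.Arr}
    (hk : G.comp ⟨g, h, w₂⟩ = k) (w₄ : E.anchor e = G.tgt k) :
    E.act ⟨E.act ⟨e, g, w₁⟩, h, w₃⟩ = E.act ⟨e, k, w₄⟩ := by
  subst hk; exact E.act_act e g h w₁ w₂

theorem act_act_of_comp_eq_one (e : E.carrier) (g h : G.Arr) (w₁ : E.anchor e = G.tgt g)
    (w₂ : G.src g = G.tgt h) (w₃ : E.anchor (E.act ⟨e, g, w₁⟩) = G.tgt h)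
    (hk : G.comp ⟨g, h, w₂⟩ = G.one (E.anchor e)) :
    E.act ⟨E.act ⟨e, g, w₁⟩, h, w₃⟩ = e :=
  (E.act_act' e g h w₁ w₂ w₃ hk (G.tgt_one _).symm).trans (E.act_one e)

/-- The arrows of the action groupoid: `(e, g)` is an arrow from `e · g` to `e`. -/
abbrev Arr : CGTop.{u} := CGTop.of (FiberProd E.anchor G.tgt)

theorem src_eq_tgt {x y : FiberProd E.anchor G.tgt} (h : E.act x = y.fst) :
    G.src x.snd = G.tgt y.snd := by
  rw [← y.w, ← h, E.anchor_act]

/-- The action groupoid of a space with a groupoid action: the source of `(e, g)` is `e · g`, its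
target is `e`. -/
def actionGroupoid : TopGroupoid E.carrier where
  Arr := E.Arr
  src := E.act
  tgt := ⟨FiberProd.fst, FiberProd.continuous_fst⟩
  one := ⟨fun e => ⟨e, G.one (E.anchor e), (G.tgt_one _).symm⟩,
    continuous_id.fiberMk (by fun_prop) _⟩
  inv := ⟨fun x => ⟨E.act x, G.inv x.snd, (E.anchor_act x).trans (G.tgt_inv _).symm⟩,
    E.act.continuous.fiberMk (G.inv.continuous.comp continuous_id.fiberSnd) _⟩
  comp := ⟨fun z => ⟨z.fst.fst, G.comp ⟨z.fst.snd, z.snd.snd, E.src_eq_tgt z.w⟩,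
      z.fst.w.trans (G.tgt_comp ⟨z.fst.snd, z.snd.snd, E.src_eq_tgt z.w⟩).symm⟩,
    continuous_id.fiberFst.fiberFst.fiberMk (G.comp.continuous.comp
      (continuous_id.fiberFst.fiberSnd.fiberMk continuous_id.fiberSnd.fiberSnd _)) _⟩
  src_one := E.act_one
  tgt_one _ := rfl
  src_inv x := E.act_act_of_comp_eq_one x.fst x.snd (G.inv x.snd) x.w (G.tgt_inv _).symm _
    ((G.comp_inv _).trans (congrArg G.one x.w.symm))
  tgt_inv _ := rfl
  src_comp z := (E.act_act z.fst.fst z.fst.snd z.snd.snd z.fst.w (E.src_eq_tgt z.w)).symm.trans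
    (E.act_congr z.w rfl _ _)
  tgt_comp _ := rfl
  one_comp x := FiberProd.ext rfl (G.one_comp' (congrArg G.one x.w) _)
  comp_one x := FiberProd.ext rfl ((G.comp_congr rfl (congrArg G.one (E.anchor_act x)) _
    (G.tgt_one _).symm).trans (G.comp_one x.snd))
  assoc x y z h₁ h₂ := FiberProd.ext rfl
    (G.assoc x.snd y.snd z.snd (E.src_eq_tgt h₁) (E.src_eq_tgt h₂))
  inv_comp x := FiberProd.ext rfl ((G.inv_comp x.snd).trans
    (congrArg G.one (E.anchor_act x).symm))
  comp_inv x := FiberProd.ext rfl ((G.comp_inv x.snd).trans (congrArg G.one x.w.symm))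

/-! ### Fibrations -/

/-- An arrow `(e, g)` of the action groupoid is determined by its source `e · g` and by `g`. Hence
the source map of the action groupoid is the base change of the source map of `G` along the anchor,
and it inherits lifts of homotopies. -/
theorem hasHomotopyLifting_src {U : Opens G.Arr} {V : Opens M} (h : ∀ x ∈ U, G.src x ∈ V)
    {Z : Type*} [TopologicalSpace Z] [UCompactlyGeneratedSpace.{u} (Z × unitInterval)]
    (hZ : HasHomotopyLifting (G.src.restrictOpens U V h) Z) {U' : Opens E.actionGroupoid.Arr}
    {V' : Opens E.carrier} (hU' : ∀ x : FiberProd E.anchor G.tgt, x ∈ U' ↔ x.snd ∈ U)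
    (hV' : ∀ e, e ∈ V' ↔ E.anchor e ∈ V) (h' : ∀ x ∈ U', E.actionGroupoid.src x ∈ V') :
    HasHomotopyLifting (E.actionGroupoid.src.restrictOpens U' V' h') Z := by
  intro H s hs
  let s₁ (z : Z) : E.actionGroupoid.Arr := (s z).1
  have hs₁ : Continuous s₁ := continuous_subtype_val.comp s.continuous
  let s₀ (z : Z) : FiberProd E.anchor G.tgt := s₁ z
  have hs₀ : Continuous s₀ := hs₁
  have hsH (z : Z) : E.act (s₀ z) = (H (z, 0)).1 := congrArg Subtype.val (hs z)
  let e (x : Z × unitInterval) : E.carrier := (H x).1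
  have he : Continuous e := continuous_subtype_val.comp H.continuous
  obtain ⟨γ, hγ₀, hγ⟩ := hZ
    ⟨fun x => ⟨E.anchor (e x), (hV' _).mp (H x).2⟩, (E.anchor.continuous.comp he).subtype_mk _⟩
    ⟨fun z => ⟨(s₀ z).snd, (hU' _).mp (s z).2⟩, hs₀.fiberSnd.subtype_mk _⟩ (fun z => by
      refine Subtype.ext ?_
      change G.src (s₀ z).snd = E.anchor (H (z, 0)).1
      rw [← hsH, E.anchor_act])
  let g (x : Z × unitInterval) : G.Arr := (γ x).1
  have hg : Continuous g := continuous_subtype_val.comp γ.continuous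
  have src_g (x) : G.src (g x) = E.anchor (e x) := congrArg Subtype.val (hγ x)
  have g₀ (z : Z) : g (z, 0) = (s₀ z).snd := congrArg Subtype.val (hγ₀ z)
  have w (x) : E.anchor (e x) = G.tgt (G.inv (g x)) := by rw [G.tgt_inv, src_g]
  -- The arrow of the action groupoid with source `e x` which is given by `g x`.
  let e' (x : Z × unitInterval) : E.carrier := E.act ⟨e x, G.inv (g x), w x⟩
  have he' : Continuous e' := E.act.continuous.comp
    (FiberProd.continuous_of_uLift he (G.inv.continuous.comp hg))
  have w' (x) : E.anchor (e' x) = G.tgt (g x) := (E.anchor_act _).trans (G.src_inv _)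
  let k (x : Z × unitInterval) : FiberProd E.anchor G.tgt := ⟨e' x, g x, w' x⟩
  have hk : Continuous k := FiberProd.continuous_of_uLift he' hg
  refine ⟨⟨fun x => ⟨k x, (hU' _).mpr (γ x).2⟩, hk.subtype_mk _⟩, fun z => ?_, fun x => ?_⟩
  · refine Subtype.ext (FiberProd.ext ?_ (g₀ z))
    change E.act ⟨e (z, 0), G.inv (g (z, 0)), _⟩ = (s₀ z).fst
    refine (E.act_congr (hsH z).symm (congrArg G.inv (g₀ z)) _
      ((E.anchor_act _).trans (G.tgt_inv _).symm)).trans ?_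
    exact E.act_act_of_comp_eq_one (s₀ z).fst (s₀ z).snd _ (s₀ z).w (G.tgt_inv _).symm _
      ((G.comp_inv _).trans (congrArg G.one (s₀ z).w.symm))
  · refine Subtype.ext ?_
    exact E.act_act_of_comp_eq_one (e x) (G.inv (g x)) (g x) (w x) (G.src_inv _) _
      ((G.inv_comp _).trans (congrArg G.one (src_g x)))

/-- The preimages of open sets of `G` and `M` in the action groupoid. -/
theorem exists_opens {U : Opens G.Arr} {V : Opens M} (h : ∀ x ∈ U, G.src x ∈ V) :
    ∃ (U' : Opens E.actionGroupoid.Arr) (V' : Opens E.carrier),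
      (∀ x : FiberProd E.anchor G.tgt, x ∈ U' ↔ x.snd ∈ U) ∧ (∀ e, e ∈ V' ↔ E.anchor e ∈ V) ∧
      ∀ x ∈ U', E.actionGroupoid.src x ∈ V' := by
  refine ⟨⟨_, U.2.preimage FiberProd.continuous_snd⟩, ⟨_, V.2.preimage E.anchor.continuous⟩,
    fun x => Iff.rfl, fun e => Iff.rfl, fun (x : FiberProd E.anchor G.tgt) hx => ?_⟩
  have hx' : G.src x.snd ∈ V := h _ hx
  rw [← E.anchor_act] at hx'
  exact hx'

theorem isLocallyHurewiczFibration_src (hG : IsLocallyHurewiczFibration G.src) :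
    IsLocallyHurewiczFibration E.actionGroupoid.src := by
  intro (x : FiberProd E.anchor G.tgt)
  obtain ⟨U, V, h, hx, hUV⟩ := hG x.snd
  obtain ⟨U', V', hU', hV', h'⟩ := E.exists_opens h
  refine ⟨U', V', h', (hU' x).mpr hx, fun Z => ?_⟩
  have := compactlyGeneratedSpace_prod_of_compactSpace (X := Z) (Y := unitInterval)
  exact E.hasHomotopyLifting_src h (hUV Z) hU' hV' h'

theorem isLocallySerreFibration_src (hG : IsLocallySerreFibration G.src) :
    IsLocallySerreFibration E.actionGroupoid.src := by
  intro (x : FiberProd E.anchor G.tgt)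
  obtain ⟨U, V, h, hx, hUV⟩ := hG x.snd
  obtain ⟨U', V', hU', hV', h'⟩ := E.exists_opens h
  exact ⟨U', V', h', (hU' x).mpr hx, fun n => E.hasHomotopyLifting_src h (hUV n) hU' hV' h'⟩

/-! ### Principal bundles for action groupoids -/

/-- A principal bundle for the action groupoid is in particular a principal `G`-bundle. -/
noncomputable def forgetBundle (R : PrincipalBundle E.actionGroupoid X) : PrincipalBundle G X where
  total := R.total
  proj := R.proj
  admitsLocalSections := R.admitsLocalSections
  anchor := E.anchor.comp R.anchor
  act := ⟨fun x => R.act ⟨x.fst, (⟨R.anchor x.fst, x.snd, x.w⟩ : FiberProd E.anchor G.tgt), rfl⟩,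
    R.act.continuous.comp (continuous_id.fiberFst.fiberMk
      ((R.anchor.continuous.comp continuous_id.fiberFst).fiberMk continuous_id.fiberSnd _) _)⟩
  anchor_act x := (congrArg E.anchor (R.anchor_act _)).trans (E.anchor_act _)
  act_one p := R.act_one p
  act_act p g h w₁ w₂ := by
    have w₃ : R.anchor (R.act ⟨p, (⟨R.anchor p, g, w₁⟩ : FiberProd E.anchor G.tgt), rfl⟩) =
        E.act ⟨R.anchor p, g, w₁⟩ := R.anchor_act _
    have w₄ : (⟨_, h, (congrArg E.anchor w₃).trans ((E.anchor_act _).trans w₂)⟩ :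
        FiberProd E.anchor G.tgt) = ⟨E.act ⟨R.anchor p, g, w₁⟩, h, (E.anchor_act _).trans w₂⟩ :=
      FiberProd.ext w₃ rfl
    refine Eq.trans ?_ (R.act_act p (⟨R.anchor p, g, w₁⟩ : FiberProd E.anchor G.tgt)
      (⟨E.act ⟨R.anchor p, g, w₁⟩, h, (E.anchor_act _).trans w₂⟩ : FiberProd E.anchor G.tgt)
      rfl rfl)
    exact R.act_congr rfl w₄ _ _
  proj_act x := R.proj_act _
  principal := by
    have w (x : FiberProd R.proj R.proj) : R.anchor x.fst = FiberProd.fst (R.div x) := R.tgt_div x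
    refine PrincipalBundle.isHomeomorph_of_div (G := G) (fun x => R.proj_act _)
      ⟨fun x => FiberProd.snd (R.div x), FiberProd.continuous_snd.comp R.div.continuous⟩
      (fun x => (congrArg E.anchor (w x)).trans (FiberProd.w (R.div x))) (fun x => ?_) (fun x => ?_)
    · have w₁ : (⟨R.anchor x.fst, FiberProd.snd (R.div x), (congrArg E.anchor (w x)).trans
          (FiberProd.w (R.div x))⟩ : FiberProd E.anchor G.tgt) = R.div x :=
        FiberProd.ext (w x) rfl
      exact (R.act_congr rfl w₁ rfl (R.tgt_div x)).trans (R.act_div x)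
    · exact congrArg FiberProd.snd (R.div_eq _ (g :=
        (⟨R.anchor x.fst, x.snd, x.w⟩ : FiberProd E.anchor G.tgt)) rfl rfl)

/-- A principal `G`-bundle with an equivariant map to `E` is a principal bundle for the action
groupoid. -/
noncomputable def enrichBundle (P : PrincipalBundle G X) (ψ : C(P.total, E.carrier))
    (anchor_ψ : ∀ p, E.anchor (ψ p) = P.anchor p)
    (ψ_act : ∀ x, ψ (P.act x) = E.act ⟨ψ x.fst, x.snd, (anchor_ψ _).trans x.w⟩) :
    PrincipalBundle E.actionGroupoid X :=
  have w (x : FiberProd ψ E.actionGroupoid.tgt) : P.anchor x.fst = G.tgt (FiberProd.snd x.snd) :=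
    (anchor_ψ _).symm.trans ((congrArg E.anchor x.w).trans (FiberProd.w x.snd))
  { total := P.total
    proj := P.proj
    admitsLocalSections := P.admitsLocalSections
    anchor := ψ
    act := ⟨fun x => P.act ⟨x.fst, FiberProd.snd x.snd, w x⟩, P.act.continuous.comp
      (continuous_id.fiberFst.fiberMk (FiberProd.continuous_snd.comp continuous_id.fiberSnd) _)⟩
    anchor_act := fun x => (ψ_act _).trans (E.act_congr x.w rfl _ (FiberProd.w x.snd))
    act_one := fun p => (P.act_congr rfl (congrArg G.one (anchor_ψ p)) _
      (G.tgt_one _).symm).trans (P.act_one p)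
    act_act := fun p x y w₁ w₂ => P.act_act p _ _ (w ⟨p, x, w₁⟩) (E.src_eq_tgt w₂)
    proj_act := fun x => P.proj_act _
    principal := by
      refine PrincipalBundle.isHomeomorph_of_div (G := E.actionGroupoid) (fun x => P.proj_act _)
        ⟨fun x => (⟨ψ x.fst, P.div x, (anchor_ψ _).trans (P.tgt_div x)⟩ :
          FiberProd E.anchor G.tgt), (ψ.continuous.comp continuous_id.fiberFst).fiberMk
            P.div.continuous _⟩ (fun x => rfl) (fun x => P.act_div x) (fun x => ?_)
      exact FiberProd.ext x.w (P.div_eq _ _ rfl) }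

end RightSpace

/-! ### The `2`-fibre product with a space -/

/-- Morphisms of spaces over `U` are cartesian. -/
theorem hasUniqueFactorization_underline (U : CGTop.{u}) :
    HasUniqueFactorization (underline U) := by
  intro (a : Over U) (b : Over U) (c : Over U) (φ : b ⟶ c) (ψ : a ⟶ c) (g : a.left ⟶ b.left)
    (hg : g ≫ φ.left = ψ.left)
  refine ⟨(Over.homMk g (by rw [← Over.w φ, ← Category.assoc, hg, Over.w ψ]) : a ⟶ b),
    ⟨rfl, Over.OverMorphism.ext hg⟩, fun χ hχ => Over.OverMorphism.ext hχ.1⟩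

theorem map_obj_baseObj {X : OverCG.{u}} {U : CGTop.{u}} (q : BasedFunctor (underline U) X) :
    X.p.obj (q.obj (baseObj U)) = U := q.w_obj _

section OverSpace

variable {X Y : OverCG.{u}} {U : CGTop.{u}} {F : BasedFunctor Y X}
  {q : BasedFunctor (underline U) X}

/-- An object of the `2`-fibre product of `F : Y → X` with a space `q : U → X` amounts to an object
`y` of `Y` and this morphism from `F y` to the object of `X` over `U` which classifies `q`. -/
def TwoFiberObj.arrow (a : TwoFiberObj F q) : F.obj a.fst ⟶ q.obj (baseObj U) :=
  a.iso.hom ≫ q.map (toBase a.snd)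

theorem TwoFiberObj.map_arrow (a : TwoFiberObj F q) : X.p.map a.arrow =
    eqToHom ((F.w_obj _).trans a.base_eq) ≫ structMap a.snd ≫
      eqToHom (map_obj_baseObj q).symm := by
  have h : X.p.map (q.map (toBase a.snd)) = eqToHom (q.w_obj a.snd) ≫ structMap a.snd ≫
      eqToHom (map_obj_baseObj q).symm := q.map_p (toBase a.snd)
  rw [TwoFiberObj.arrow, X.p.map_comp, a.map_iso_hom, h]
  simp

theorem TwoFiberHom.map_fst_arrow {a b : TwoFiberObj F q} (g : TwoFiberHom a b) :
    F.map g.fst ≫ b.arrow = a.arrow := by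
  rw [TwoFiberObj.arrow, ← Category.assoc, g.comm, Category.assoc, ← q.map_comp, comp_toBase]
  rfl

theorem TwoFiberHom.ext_fst {a b : TwoFiberObj F q} {g g' : TwoFiberHom a b}
    (h : g.fst = g'.fst) : g = g' :=
  TwoFiberHom.ext h (underline_hom_ext (by rw [g.map_snd, g'.map_snd, h]))

/-- Morphisms of the `2`-fibre product are morphisms of `Y` which are compatible with `arrow`. -/
theorem TwoFiberHom.exists_of_arrow (hX : HasUniqueFactorization X) {a b : TwoFiberObj F q}
    (f : a.fst ⟶ b.fst) (h : F.map f ≫ b.arrow = a.arrow) :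
    ∃ g : TwoFiberHom a b, g.fst = f := by
  let k : (underline U).p.obj a.snd ⟶ (underline U).p.obj b.snd :=
    eqToHom a.base_eq.symm ≫ Y.p.map f ≫ eqToHom b.base_eq
  have hk : k ≫ structMap b.snd = structMap a.snd := by
    have h' := congrArg X.p.map h
    rw [X.p.map_comp, b.map_arrow, a.map_arrow, F.map_p] at h'
    rw [← cancel_epi (eqToHom ((F.w_obj _).trans a.base_eq)),
      ← cancel_mono (eqToHom (map_obj_baseObj q).symm), Category.assoc _ (structMap a.snd)]
    refine Eq.trans ?_ h'
    simp [k]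
  let g : a.snd ⟶ b.snd := (Over.homMk k hk : (a.snd : Over U) ⟶ b.snd)
  have hg : (underline U).p.map g = k := rfl
  refine ⟨⟨f, g, ?_, ?_⟩, rfl⟩
  · refine IsHomLift.of_fac _ _ _ a.base_eq.symm b.base_eq.symm ?_
    rw [hg]; simp [k]
  · refine hX.hom_ext (q.map (toBase b.snd)) ?_ ?_
    · rw [X.p.map_comp, X.p.map_comp, a.map_iso_hom, b.map_iso_hom, F.map_p, q.map_p, hg]
      simp [k]
    · refine (Category.assoc _ _ _).trans (h.trans ?_)
      rw [Category.assoc, ← q.map_comp, comp_toBase]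
      rfl

/-- Objects of the `2`-fibre product may be constructed from their `arrow`. -/
theorem TwoFiberObj.exists_of_arrow (hX : HasUniqueFactorization X) (y : Y.obj)
    (t : F.obj y ⟶ q.obj (baseObj U)) :
    ∃ (z : (underline U).obj) (h : Y.p.obj y = (underline U).p.obj z) (i : F.obj y ≅ q.obj z)
      (hi : X.p.IsHomLift (𝟙 (Y.p.obj y)) i.hom),
        (⟨y, z, h, i, hi⟩ : TwoFiberObj F q).arrow = t := by
  let s : Y.p.obj y ⟶ U :=
    eqToHom (F.w_obj y).symm ≫ X.p.map t ≫ eqToHom (map_obj_baseObj q)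
  obtain ⟨z, e, hz⟩ : ∃ (z : (underline U).obj) (e : Y.p.obj y = (underline U).p.obj z),
      eqToHom e ≫ structMap z = s := ⟨(Over.mk s : Over U), rfl, Category.id_comp _⟩
  have hm : X.p.map (q.map (toBase z)) = eqToHom (q.w_obj z) ≫ structMap z ≫
      eqToHom (map_obj_baseObj q).symm := q.map_p (toBase z)
  obtain ⟨i, ⟨hi, hi'⟩, -⟩ := hX (q.map (toBase z)) t
    (eqToHom ((F.w_obj y).trans (e.trans (q.w_obj z).symm))) (by
      rw [hm, eqToHom_trans_assoc, ← eqToHom_trans (F.w_obj y) e, Category.assoc,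
        reassoc_of% hz]
      simp [s])
  have : IsIso (X.p.map i) := by rw [hi]; infer_instance
  have := hX.isIso i
  refine ⟨z, e, asIso i, IsHomLift.of_fac _ _ _ (F.w_obj y) ((q.w_obj z).trans e.symm) ?_, hi'⟩
  rw [asIso_hom, hi]
  simp

/-- Recognition of the `2`-fibre product of `F : Y → X` with a space: it is a category over `Y`
whose objects carry a morphism to the object of `X` which classifies the space. -/
theorem exists_isEquivalence_twoFiberProduct {W : OverCG.{u}} (hX : HasUniqueFactorization X)
    (hY : HasUniqueFactorization Y) (V : BasedFunctor W Y)
    (t : ∀ w, F.obj (V.obj w) ⟶ q.obj (baseObj U))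
    (ht : ∀ ⦃w w'⦄ (k : w ⟶ w'), F.map (V.map k) ≫ t w' = t w)
    (faithful : ∀ ⦃w w'⦄ (k k' : w ⟶ w'), V.map k = V.map k' → k = k')
    (full : ∀ ⦃w w'⦄ (f : V.obj w ⟶ V.obj w'), F.map f ≫ t w' = t w → ∃ k, V.map k = f)
    (essSurj : ∀ (y : Y.obj) (s : F.obj y ⟶ q.obj (baseObj U)),
      ∃ (w : W.obj) (i : V.obj w ⟶ y), IsIso i ∧ F.map i ≫ s = t w) :
    ∃ Φ : BasedFunctor W (twoFiberProduct F q), Φ.toFunctor.IsEquivalence := by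
  choose z h i hi ha using fun w => TwoFiberObj.exists_of_arrow hX (V.obj w) (t w)
  let a (w : W.obj) : TwoFiberObj F q := ⟨V.obj w, z w, h w, i w, hi w⟩
  choose m hm using fun (w w' : W.obj) (k : w ⟶ w') =>
    TwoFiberHom.exists_of_arrow hX (a := a w) (b := a w') (V.map k)
      ((congrArg (F.map (V.map k) ≫ ·) (ha w')).trans ((ht k).trans (ha w).symm))
  let Φ : BasedFunctor W (twoFiberProduct F q) :=
    { obj := a
      map := fun {w w'} k => m w w' k
      map_id := fun w => TwoFiberHom.ext_fst ((hm _ _ _).trans (V.map_id w))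
      map_comp := fun {w w' w''} k k' => TwoFiberHom.ext_fst ((hm _ _ _).trans
        ((V.map_comp k k').trans (congrArg₂ (· ≫ ·) (hm _ _ k).symm (hm _ _ k').symm)))
      w := CategoryTheory.Functor.ext V.w_obj fun w w' k =>
        (congrArg Y.p.map (hm w w' k)).trans (V.map_p k) }
  have hΦ := hasUniqueFactorization_twoFiberProduct hX hY (hasUniqueFactorization_underline U) F q
  refine ⟨Φ, ⟨fun {w w'} k k' e => ?_⟩, ⟨fun {w w'} (g : TwoFiberHom (a w) (a w')) => ?_⟩,
    ⟨fun (b : TwoFiberObj F q) => ?_⟩⟩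
  · exact faithful k k' ((hm _ _ k).symm.trans ((congrArg TwoFiberHom.fst e).trans (hm _ _ k')))
  · obtain ⟨k, hk⟩ := full g.fst ((congrArg (F.map g.fst ≫ ·) (ha w')).symm.trans
      (g.map_fst_arrow.trans (ha w)))
    exact ⟨k, TwoFiberHom.ext_fst ((hm _ _ k).trans hk)⟩
  · obtain ⟨w, j, hj, hj'⟩ := essSurj b.fst b.arrow
    obtain ⟨g, hg⟩ := TwoFiberHom.exists_of_arrow hX (a := a w) (b := b) j (hj'.trans (ha w).symm)
    let g' : Φ.obj w ⟶ b := g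
    have : IsIso ((twoFiberProduct F q).p.map g') := by
      change IsIso (Y.p.map g.fst)
      rw [hg]; infer_instance
    have := hΦ.isIso g'
    exact ⟨w, ⟨asIso g'⟩⟩

end OverSpace

/-! ### The `2`-fibre product as a quotient stack -/

namespace RightSpace

variable {M : CGTop.{u}} {G : TopGroupoid M}

/-- A morphism of principal bundles for the action groupoid is a morphism of the underlying
principal `G`-bundles. -/
noncomputable def forgetHom (E : RightSpace G) {R R' : BObj E.actionGroupoid} (f : BHom R R') :
    BHom (⟨R.base, E.forgetBundle R.bundle⟩ : BObj G) ⟨R'.base, E.forgetBundle R'.bundle⟩ where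
  map := f.map
  base := f.base
  anchor_map p := congrArg E.anchor (f.anchor_map p)
  map_act x := by
    let y : FiberProd E.anchor G.tgt := ⟨R.bundle.anchor x.fst, x.snd, x.w⟩
    let y' : FiberProd E.anchor G.tgt := ⟨R'.bundle.anchor (f.map x.fst), x.snd,
      (congrArg E.anchor (f.anchor_map x.fst)).trans x.w⟩
    have hy : y = y' := FiberProd.ext (f.anchor_map x.fst).symm rfl
    exact (f.map_act ⟨x.fst, y, rfl⟩).trans
      (R'.bundle.act_congr rfl hy (f.anchor_map x.fst) rfl)
  proj_map := f.proj_map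

/-- The morphism from the quotient stack of a `G`-space to `BG`. -/
noncomputable def forget (E : RightSpace G) : BasedFunctor E.actionGroupoid.B G.B where
  obj (R : BObj E.actionGroupoid) := (⟨R.base, E.forgetBundle R.bundle⟩ : BObj G)
  map f := E.forgetHom f
  map_id _ := rfl
  map_comp _ _ := rfl
  w := rfl

/-- The total space of a principal `H`-bundle, with the action of `G` through a morphism to `H`
which is the identity on objects. -/
def ofPrincipalBundle {H : TopGroupoid M} (φ : G.Hom H) (hφ : ∀ x, φ.obj x = x) {X : CGTop.{u}}
    (Q : PrincipalBundle H X) : RightSpace G :=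
  have w (x : FiberProd Q.anchor G.tgt) : Q.anchor x.fst = H.tgt (φ.arr x.snd) := by
    rw [φ.tgt_arr, hφ, x.w]
  { carrier := Q.total
    anchor := Q.anchor
    act := ⟨fun x => Q.act ⟨x.fst, φ.arr x.snd, w x⟩, Q.act.continuous.comp
      (continuous_id.fiberFst.fiberMk (φ.arr.continuous.comp continuous_id.fiberSnd) _)⟩
    anchor_act := fun x => (Q.anchor_act _).trans ((φ.src_arr _).trans (hφ _))
    act_one := fun p => (Q.act_congr rfl ((φ.arr_one _).trans (congrArg H.one (hφ _))) _
      (H.tgt_one _).symm).trans (Q.act_one p)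
    act_act := fun p g h w₁ w₂ => (Q.act_act p (φ.arr g) (φ.arr h) (w ⟨p, g, w₁⟩) (by
      rw [φ.src_arr, φ.tgt_arr, w₂])).trans
        (Q.act_congr rfl (φ.arr_comp ⟨g, h, w₂⟩).symm _ _) }

end RightSpace

section Presentation

variable {M : CGTop.{u}} {G H : TopGroupoid M}

/-- The `2`-fibre product of `BG → BH` with a space `U → BH` classifying a principal bundle `Q` is
the quotient stack of the total space of `Q` by the action of `G`: a morphism to `Q` from the bundle
associated with a `G`-bundle `P` is an equivariant map from `P` to `Q`. -/
theorem isPresentedBy_twoFiberProduct (φ : G.Hom H) (hφ : ∀ x, φ.obj x = x) {U : CGTop.{u}}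
    (q : BasedFunctor (underline U) H.B) :
    ∃ E : RightSpace G, IsPresentedBy (twoFiberProduct φ.mapB q) E.actionGroupoid := by
  let Q : BObj H := q.obj (baseObj U)
  let E := RightSpace.ofPrincipalBundle φ hφ Q.bundle
  have ht (R : BObj E.actionGroupoid) :
      ∃ T : BHom (⟨R.base, (E.forgetBundle R.bundle).assoc φ⟩ : BObj H) Q,
        ∀ p, T.map ((E.forgetBundle R.bundle).assocUnit φ p) = R.bundle.anchor p :=
    BHom.exists_of_equivariant φ (P := ⟨R.base, E.forgetBundle R.bundle⟩) (Q := Q)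
      R.bundle.anchor (fun p => (hφ _).symm) (fun x => R.bundle.anchor_act _)
  choose t ht using ht
  refine ⟨E, exists_isEquivalence_twoFiberProduct (hasUniqueFactorization_B H)
    (hasUniqueFactorization_B G) E.forget t ?_ ?_ ?_ ?_⟩
  · intro (R : BObj E.actionGroupoid) (R' : BObj E.actionGroupoid) (k : BHom R R')
    refine BHom.assoc_ext φ (P := ⟨R.base, E.forgetBundle R.bundle⟩) fun p => ?_
    refine Eq.trans ?_ (ht R p).symm
    refine (congrArg (t R').map (BHom.map_assocUnit φ (E.forget.map k) p)).trans ?_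
    exact (ht R' _).trans (k.anchor_map p)
  · intro (R : BObj E.actionGroupoid) (R' : BObj E.actionGroupoid) (k : BHom R R')
      (k' : BHom R R') e
    have e' : E.forgetHom k = E.forgetHom k' := e
    have e₁ : (E.forgetHom k).map = (E.forgetHom k').map := congrArg BHom.map e'
    have e₂ : (E.forgetHom k).base = (E.forgetHom k').base := congrArg BHom.base e'
    exact BHom.ext e₁ e₂
  · intro (R : BObj E.actionGroupoid) (R' : BObj E.actionGroupoid)
      (f : BHom ⟨R.base, E.forgetBundle R.bundle⟩ ⟨R'.base, E.forgetBundle R'.bundle⟩) hf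
    have hf' (p : R.bundle.total) : R'.bundle.anchor (f.map p) = R.bundle.anchor p := by
      have h := congrArg (fun T : BHom _ Q =>
        T.map ((E.forgetBundle R.bundle).assocUnit φ p)) hf
      refine (ht R' _).symm.trans (Eq.trans ?_ (h.trans (ht R p)))
      exact (congrArg (t R').map (BHom.map_assocUnit φ f p)).symm
    refine ⟨({ map := f.map, base := f.base, anchor_map := hf', proj_map := f.proj_map,
               map_act := fun x => ?_ } : BHom R R'), rfl⟩
    let y : FiberProd E.anchor G.tgt := x.snd
    have w : R.bundle.anchor x.fst = y.fst := x.w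
    let z : FiberProd E.anchor G.tgt :=
      ⟨R.bundle.anchor x.fst, y.snd, (congrArg E.anchor w).trans y.w⟩
    let z' : FiberProd E.anchor G.tgt := ⟨R'.bundle.anchor (f.map x.fst), y.snd,
      (congrArg E.anchor ((hf' _).trans w)).trans y.w⟩
    have hz : y = z := FiberProd.ext w.symm rfl
    have hz' : z' = y := FiberProd.ext ((hf' _).trans w) rfl
    refine (congrArg f.map (R.bundle.act_congr rfl hz x.w rfl)).trans ?_
    refine (f.map_act ⟨x.fst, y.snd, z.w⟩).trans ?_
    exact R'.bundle.act_congr rfl hz' rfl ((hf' _).trans w)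
  -- A `G`-bundle with an equivariant map to `Q` is a bundle for the action groupoid.
  · intro (P : BObj G) (s : BHom ⟨P.base, P.bundle.assoc φ⟩ Q)
    let ψ : C(P.bundle.total, E.carrier) := s.map.comp (P.bundle.assocUnit φ)
    have anchor_ψ (p) : E.anchor (ψ p) = P.bundle.anchor p :=
      (s.anchor_map _).trans ((P.bundle.anchor_assocUnit φ p).trans (hφ _))
    have ψ_act (x : FiberProd P.bundle.anchor G.tgt) :
        ψ (P.bundle.act x) = E.act ⟨ψ x.fst, x.snd, (anchor_ψ _).trans x.w⟩ :=
      (congrArg s.map (P.bundle.assocUnit_act φ x)).trans (s.map_act _)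
    let R : BObj E.actionGroupoid := ⟨P.base, E.enrichBundle P.bundle ψ anchor_ψ ψ_act⟩
    let i : BHom (⟨P.base, E.forgetBundle R.bundle⟩ : BObj G) P :=
      { map := ContinuousMap.id _
        base := ContinuousMap.id _
        anchor_map := fun p => (anchor_ψ p).symm
        map_act := fun x => rfl
        proj_map := fun p => rfl }
    let i' : E.forget.obj R ⟶ P := i
    have : IsIso (G.B.p.map i') := inferInstanceAs (IsIso (𝟙 P.base))
    refine ⟨R, i', (hasUniqueFactorization_B G).isIso i', ?_⟩
    refine BHom.assoc_ext φ (P := ⟨P.base, E.forgetBundle R.bundle⟩) fun p => ?_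
    refine Eq.trans ?_ (ht R p).symm
    exact congrArg s.map (BHom.map_assocUnit φ i p)

/-- The `2`-fibre product of `BG → BH` with a space is a stack, being equivalent to some `BK`. -/
theorem isStack_twoFiberProduct (φ : G.Hom H) {U : CGTop.{u}}
    (q : BasedFunctor (underline U) H.B) {N : CGTop.{u}} {K : TopGroupoid N}
    (h : IsPresentedBy (twoFiberProduct φ.mapB q) K) : IsStack (twoFiberProduct φ.mapB q) := by
  obtain ⟨Φ, hΦ⟩ := h
  exact isStack_of_isEquivalence (hasUniqueFactorization_B K) (hasLifts_B K) Φ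
    (hasUniqueFactorization_twoFiberProduct (hasUniqueFactorization_B H)
      (hasUniqueFactorization_B G) (hasUniqueFactorization_underline U) _ _)
    (fun U S hS => restrictToSieve_isEquivalence K U S hS)

end Presentation

theorem mainTheorem3 {M : CGTop.{u}} {G H : TopGroupoid M} (F : G.Hom H) (hF : F.IsExtension) :
    (IsLocallyHurewiczFibration G.src → IsHurewiczGerbe F.mapB) ∧
      (IsLocallySerreFibration G.src → IsSerreGerbe F.mapB) := by
  refine ⟨fun h => ⟨isGerbe_mapB hF, fun U q => ?_⟩, fun h => ⟨isGerbe_mapB hF, fun U q => ?_⟩⟩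
  all_goals obtain ⟨E, hE⟩ := isPresentedBy_twoFiberProduct F hF.obj_apply q
  · exact ⟨isStack_twoFiberProduct F q hE, _, _, E.isLocallyHurewiczFibration_src h, hE⟩
  · exact ⟨isStack_twoFiberProduct F q hE, _, _, E.isLocallySerreFibration_src h, hE⟩
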